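/- Let $V\subset\mathbb C^N$ be an algebraic variety (the common zero set of a family of polynomials), let $G$ be a domain in $V$ (a nonempty connected relatively open subset), and let $\Gamma\subset U(n)$ be a finite unitary group with $|\Gamma|=m$. Let $\mathbb B^n\subset\mathbb C^n$ be the open unit ball. Suppose that there are a complex analytic subvariety $V_1\subsetneq\mathbb B^n$, a nowhere dense complex analytic subvariety $V_2\subset G$, and an $m$-sheeted holomorphic covering map $F:\mathbb B^n\setminus V_1\to G\setminus V_2$ (every point of $G\setminus V_2$ has a neighbourhood whose preimage is a disjoint union of $m$ open sets, each mapped biholomorphically onto the neighbourhood) whose deck transformation group is $\Gamma$, acting linearly. Suppose that $F$ is algebraic, i.e. each component $F_j$ of $F=(F_1,\dots,F_N)$ satisfies $P_j(z,F_j(z))=0$ on $\mathbb B^n\setminus V_1$ for some nontrivial polynomial $P_j\in\mathbb C[z,w]$. Then the Bergman kernel form of $G$ is algebraic. Here $\operatorname{Reg}G$, the set of points near which $G$ is a complex submanifold of $\mathbb C^N$, is $n$-dimensional, and the Bergman kernel form of $G$ is the form $$K_G(x,\bar x)=i^{n^2}\sum_k\varphi_k(x)\wedge\overline{\varphi_k(x)}\qquad(x\in\operatorname{Reg}G),$$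 where $(\varphi_k)$ is any orthonormal basis of the Hilbert space of holomorphic $(n,0)$-forms $\varphi$ on $\operatorname{Reg}G$ with $i^{n^2}\int_{\operatorname{Reg}G}\varphi\wedge\overline\varphi<\infty$, with inner product $(\varphi,\psi)=i^{n^2}\int_{\operatorname{Reg}G}\varphi\wedge\overline\psi$. It is algebraic if every point of $\operatorname{Reg}G$ has an open neighbourhood $U$ in $\mathbb C^N\cong\mathbb R^{2N}$ carrying a differential form $\psi$ with $\psi|_{\operatorname{Reg}G}=K_G$ on $U\cap\operatorname{Reg}G$, the coefficients of $\psi$ being real-algebraic: their real and imaginary parts are real analytic functions $f$ on $U$ with $Q(x,f(x))=0$ on $U$ for some nontrivial real polynomial $Q$ in $2N+1$ variables. The dimension $n$ is arbitrary and $\Gamma$ is not assumed to be fixed-point free. -/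

import Mathlib

open Set MeasureTheory

noncomputable section

namespace AlgBergman

/-! Throughout, `ℂᴺ` is the coordinate space `Fin N → ℂ`; "holomorphic" is complex analytic. -/

/-! ### The unit ball and its unitary maps -/

/-- The open Euclidean unit ball `𝔹ⁿ` of `ℂⁿ`. -/
def unitBall (n : ℕ) : Set (Fin n → ℂ) := {z | ∑ i, ‖z i‖ ^ 2 < 1}

/-- The linear action of a unitary matrix on `ℂⁿ`. -/
def act {n : ℕ} (γ : Matrix.unitaryGroup (Fin n) ℂ) (z : Fin n → ℂ) : Fin n → ℂ :=
  (γ : Matrix (Fin n) (Fin n) ℂ).mulVec z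

/-! ### Algebraic varieties, domains in them, analytic subvarieties -/

/-- `V` is an (affine, possibly reducible) algebraic variety in `ℂᴺ`: the common zero set of
an ideal of polynomials. -/
def IsAlgebraicVariety {N : ℕ} (V : Set (Fin N → ℂ)) : Prop :=
  ∃ I : Ideal (MvPolynomial (Fin N) ℂ), V = MvPolynomial.zeroLocus ℂ I

/-- `G` is a domain in `V`: a nonempty connected relatively open subset of `V`. -/
def IsDomainIn {N : ℕ} (G V : Set (Fin N → ℂ)) : Prop :=
  IsConnected G ∧ ∃ O : Set (Fin N → ℂ), IsOpen O ∧ G = V ∩ O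

/-- `A` is a complex analytic subvariety of `M`: a subset which, near every point of `M`, is cut
out in `M` by finitely many holomorphic functions. -/
def IsAnalyticSubvariety {N : ℕ} (A M : Set (Fin N → ℂ)) : Prop :=
  A ⊆ M ∧ ∀ p ∈ M, ∃ U : Set (Fin N → ℂ), IsOpen U ∧ p ∈ U ∧
    ∃ (k : ℕ) (f : Fin k → (Fin N → ℂ) → ℂ), (∀ i, AnalyticOnNhd ℂ (f i) U) ∧
      A ∩ U = {x | x ∈ M ∩ U ∧ ∀ i, f i x = 0}

/-! ### Algebraic functions and maps -/

/-- A holomorphic function `f` on `U ⊆ ℂⁿ` is complex-algebraic if `P (z, f z) = 0` on `U` for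
some nontrivial complex polynomial `P`; the variable `none` of `P` stands for the value `f z`. -/
def IsComplexAlgebraicOn {n : ℕ} (f : (Fin n → ℂ) → ℂ) (U : Set (Fin n → ℂ)) : Prop :=
  AnalyticOnNhd ℂ f U ∧ ∃ P : MvPolynomial (Option (Fin n)) ℂ, P ≠ 0 ∧
    ∀ z ∈ U, MvPolynomial.eval (fun o : Option (Fin n) => o.elim (f z) z) P = 0

/-- A map into `ℂᴺ` is complex-algebraic if each of its components is. -/
def IsComplexAlgebraicMapOn {n N : ℕ} (F : (Fin n → ℂ) → (Fin N → ℂ))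
    (U : Set (Fin n → ℂ)) : Prop :=
  ∀ j, IsComplexAlgebraicOn (fun z => F z j) U

/-- The real coordinates of a point of `ℂᴺ = ℝ²ᴺ`: `inl j` is `Re xⱼ`, `inr j` is `Im xⱼ`. -/
def realCoord {N : ℕ} (x : Fin N → ℂ) : Fin N ⊕ Fin N → ℝ :=
  Sum.elim (fun j => (x j).re) (fun j => (x j).im)

/-- A real analytic function `f` on `U ⊆ ℂᴺ = ℝ²ᴺ` is real-algebraic if `P (x, f x) = 0` on `U`
for some nontrivial real polynomial `P` in the `2N` real coordinates and the value. -/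
def IsRealAlgebraicOn {N : ℕ} (f : (Fin N → ℂ) → ℝ) (U : Set (Fin N → ℂ)) : Prop :=
  AnalyticOnNhd ℝ f U ∧ ∃ P : MvPolynomial (Option (Fin N ⊕ Fin N)) ℝ, P ≠ 0 ∧
    ∀ x ∈ U, MvPolynomial.eval
      (fun o : Option (Fin N ⊕ Fin N) => o.elim (f x) (realCoord x)) P = 0

/-! ### Holomorphic coverings and their deck groups -/

/-- `F` is an `m`-sheeted holomorphic covering map from the open set `M₁ ⊆ ℂⁿ` onto
`M₂ ⊆ ℂᴺ`: every point of `M₂` has a neighbourhood `W ∩ M₂` whose preimage is a disjoint union of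
`m` open sheets, each mapped biholomorphically onto `W ∩ M₂` (the inverse `g` is holomorphic on
`W ∩ M₂`, i.e. the restriction of a holomorphic map of the ambient space). -/
def IsHolomorphicCovering {n N : ℕ} (m : ℕ) (F : (Fin n → ℂ) → (Fin N → ℂ))
    (M₁ : Set (Fin n → ℂ)) (M₂ : Set (Fin N → ℂ)) : Prop :=
  MapsTo F M₁ M₂ ∧ AnalyticOnNhd ℂ F M₁ ∧
    ∀ q ∈ M₂, ∃ W : Set (Fin N → ℂ), IsOpen W ∧ q ∈ W ∧ ∃ U : Fin m → Set (Fin n → ℂ),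
      (∀ i, IsOpen (U i)) ∧ Pairwise (fun i j => Disjoint (U i) (U j)) ∧
      (⋃ i, U i) = M₁ ∩ F ⁻¹' W ∧
      ∀ i, ∃ g : (Fin N → ℂ) → (Fin n → ℂ), AnalyticOnNhd ℂ g W ∧
        (∀ y ∈ W ∩ M₂, g y ∈ U i ∧ F (g y) = y) ∧ ∀ x ∈ U i, g (F x) = x

/-- The deck transformation group of `F` on `M₁` is `Γ`: the elements of `Γ` restrict to deck
transformations, and every self-homeomorphism `τ` of `M₁` with `F ∘ τ = F` is of this form. -/
def HasDeckGroup {n N : ℕ} (F : (Fin n → ℂ) → (Fin N → ℂ)) (M₁ : Set (Fin n → ℂ))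
    (Γ : Subgroup (Matrix.unitaryGroup (Fin n) ℂ)) : Prop :=
  (∀ γ ∈ Γ, ∀ z ∈ M₁, act γ z ∈ M₁ ∧ F (act γ z) = F z) ∧
    ∀ τ : M₁ ≃ₜ M₁, (∀ z : M₁, F (τ z : Fin n → ℂ) = F z) →
      ∃ γ ∈ Γ, ∀ z : M₁, (τ z : Fin n → ℂ) = act γ z

/-! ### Complex submanifolds of `ℂᴺ` and regular points -/

/-- `φ : Ω → M` is a holomorphic parametrization, with `Ω ⊆ ℂᵈ` open, of a relatively open piece
`M ∩ U` of `M`, with a holomorphic inverse. (It is the inverse of a holomorphic chart of `M`.) -/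
def IsChart {N : ℕ} (d : ℕ) (M : Set (Fin N → ℂ)) (Ω : Set (Fin d → ℂ))
    (φ : (Fin d → ℂ) → (Fin N → ℂ)) : Prop :=
  IsOpen Ω ∧ AnalyticOnNhd ℂ φ Ω ∧ ∃ U : Set (Fin N → ℂ), IsOpen U ∧ φ '' Ω = M ∩ U ∧
    ∃ ρ : (Fin N → ℂ) → (Fin d → ℂ), AnalyticOnNhd ℂ ρ U ∧ ∀ z ∈ Ω, ρ (φ z) = z

/-- The set of regular points of `X`: those near which `X` is a complex submanifold of `ℂᴺ`. -/
def regularPart {N : ℕ} (X : Set (Fin N → ℂ)) : Set (Fin N → ℂ) :=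
  {p | ∃ (d : ℕ) (Ω : Set (Fin d → ℂ)) (φ : (Fin d → ℂ) → (Fin N → ℂ)),
    IsChart d X Ω φ ∧ p ∈ φ '' Ω}

/-- The vectors tangent to the complex submanifold `M` at `x`. -/
def tangentVectors {N : ℕ} (M : Set (Fin N → ℂ)) (x : Fin N → ℂ) : Set (Fin N → ℂ) :=
  {v | ∃ (d : ℕ) (Ω : Set (Fin d → ℂ)) (φ : (Fin d → ℂ) → (Fin N → ℂ)) (z w : Fin d → ℂ),
    IsChart d M Ω φ ∧ z ∈ Ω ∧ φ z = x ∧ v = fderiv ℂ φ z w}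

/-- A countable atlas of the `n`-dimensional complex submanifold `M` (the domains of some of the
charts may be empty). -/
structure CountableAtlas {N : ℕ} (n : ℕ) (M : Set (Fin N → ℂ)) where
  /-- the domain of the `k`-th parametrization -/
  dom : ℕ → Set (Fin n → ℂ)
  /-- the `k`-th parametrization -/
  param : ℕ → (Fin n → ℂ) → (Fin N → ℂ)
  isChart : ∀ k, IsChart n M (dom k) (param k)
  covers : M = ⋃ k, param k '' dom k

/-- The part of the `k`-th coordinate domain whose points are not yet covered by an earlier chart;
the images of these pieces form a partition of `M`. -/
def CountableAtlas.piece {N n : ℕ} {M : Set (Fin N → ℂ)} (𝒜 : CountableAtlas n M) (k : ℕ) :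
    Set (Fin n → ℂ) :=
  {z ∈ 𝒜.dom k | ∀ j < k, 𝒜.param k z ∉ 𝒜.param j '' 𝒜.dom j}

/-! ### `(n,0)`-forms, their `L²` inner product and the Bergman space

An `(n,0)`-form on the `n`-dimensional submanifold `M ⊆ ℂᴺ` is given by complex `n`-linear
alternating forms on `ℂᴺ`, one for each point; only their values on tangent vectors of `M` at
points of `M` matter. -/

/-- Families of complex `n`-linear alternating forms on `ℂᴺ`. -/
abbrev NForm (N n : ℕ) : Type := (Fin N → ℂ) → ((Fin N → ℂ) [⋀^Fin n]→ₗ[ℂ] ℂ)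

/-- The coefficient `h` in `φ^*ω = h dz₁ ∧ ⋯ ∧ dzₙ`. -/
def coeff {N n : ℕ} (ω : NForm N n) (φ : (Fin n → ℂ) → (Fin N → ℂ)) (z : Fin n → ℂ) : ℂ :=
  ω (φ z) (fun j => fderiv ℂ φ z (Pi.single j 1))

/-- `ω` is a holomorphic `(n,0)`-form on `M`: its coefficient in each holomorphic chart is
holomorphic. -/
def IsHolomorphicForm {N n : ℕ} (M : Set (Fin N → ℂ)) (ω : NForm N n) : Prop :=
  ∀ Ω φ, IsChart n M Ω φ → AnalyticOnNhd ℂ (coeff ω φ) Ω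

/-- `ω` vanishes as an `(n,0)`-form on `M`. -/
def VanishesOn {N n : ℕ} (M : Set (Fin N → ℂ)) (ω : NForm N n) : Prop :=
  ∀ Ω φ, IsChart n M Ω φ → ∀ z ∈ Ω, coeff ω φ z = 0

/-- The inner product `(ω, η) = i^{n²} ∫_M ω ∧ η̄`. In a chart with `ω = h dz` and `η = g dz` one
has `i^{n²} ω ∧ η̄ = 2ⁿ h ḡ dλ` with `λ` the Lebesgue measure of `ℂⁿ`, and the integral over `M`
is the sum of the integrals over the pieces of a countable atlas. -/
def l2Inner {N n : ℕ} {M : Set (Fin N → ℂ)} (𝒜 : CountableAtlas n M) (ω η : NForm N n) : ℂ :=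
  ∑' k, (2 : ℂ) ^ n * ∫ z in 𝒜.piece k,
    coeff ω (𝒜.param k) z * (starRingEnd ℂ) (coeff η (𝒜.param k) z)

/-- The Bergman space `A²_{(n,0)}(M)`: holomorphic `(n,0)`-forms with `i^{n²} ∫_M ω ∧ ω̄ < ∞`. -/
def MemBergmanSpace {N n : ℕ} {M : Set (Fin N → ℂ)} (𝒜 : CountableAtlas n M)
    (ω : NForm N n) : Prop :=
  IsHolomorphicForm M ω ∧
    ∑' k, (2 : ENNReal) ^ n * ∫⁻ z in 𝒜.piece k, ‖coeff ω (𝒜.param k) z‖ₑ ^ 2 < ⊤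

/-- `φ` is an orthonormal basis of the Hilbert space `A²_{(n,0)}(M)`: an orthonormal family in it
whose orthogonal complement is trivial. -/
def IsBergmanBasis {N n : ℕ} {M : Set (Fin N → ℂ)} (𝒜 : CountableAtlas n M) {ι : Type}
    (φ : ι → NForm N n) : Prop :=
  (∀ k, MemBergmanSpace 𝒜 (φ k)) ∧
  (∀ k, l2Inner 𝒜 (φ k) (φ k) = 1) ∧
  (∀ k l, k ≠ l → l2Inner 𝒜 (φ k) (φ l) = 0) ∧
  ∀ ω, MemBergmanSpace 𝒜 ω → (∀ k, l2Inner 𝒜 ω (φ k) = 0) → VanishesOn M ω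

/-! ### The Bergman kernel form and its algebraicity -/

/-- A complex alternating form, regarded as a real alternating form. -/
def toReal {N n : ℕ} (η : (Fin N → ℂ) [⋀^Fin n]→ₗ[ℂ] ℂ) : (Fin N → ℂ) [⋀^Fin n]→ₗ[ℝ] ℂ :=
  { η.toMultilinearMap.restrictScalars ℝ with
    map_eq_zero_of_eq' := fun v _ _ h hij => η.map_eq_zero_of_eq v h hij }

/-- Complex-valued real alternating `2n`-forms on `ℂᴺ`; the `2n` arguments are indexed by
`Fin n ⊕ Fin n`. -/
abbrev RealForm (N n : ℕ) : Type := (Fin N → ℂ) [⋀^Fin n ⊕ Fin n]→ₗ[ℝ] ℂ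

/-- The `(n,n)`-form `i^{n²} η ∧ η̄`. -/
def wedgeConj {N n : ℕ} (η : (Fin N → ℂ) [⋀^Fin n]→ₗ[ℂ] ℂ) : RealForm N n :=
  Complex.I ^ (n ^ 2) • (LinearMap.mul' ℝ ℂ).compAlternatingMap
    ((toReal η).domCoprod (Complex.conjAe.toLinearMap.compAlternatingMap (toReal η)))

/-- `K` is the (diagonal) Bergman kernel form `K_M(x, x̄) = i^{n²} ∑ₖ φₖ(x) ∧ φₖ(x)‾` of the
`n`-dimensional complex submanifold `M`, where `(φₖ)` is a (finite or countably infinite)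
orthonormal basis of the Bergman space. The equality is one of forms on `M`: it is tested on
tangent vectors of `M`. -/
def IsBergmanKernelForm {N : ℕ} (n : ℕ) (M : Set (Fin N → ℂ))
    (K : (Fin N → ℂ) → RealForm N n) : Prop :=
  ∃ (𝒜 : CountableAtlas n M) (ι : Set ℕ) (φ : ι → NForm N n), IsBergmanBasis 𝒜 φ ∧
    ∀ x ∈ M, ∀ v : Fin n ⊕ Fin n → (Fin N → ℂ), (∀ j, v j ∈ tangentVectors M x) →
      HasSum (fun k => wedgeConj (φ k x) v) (K x v)

/-- The standard basis of `ℂᴺ` as a real vector space, dual to the coordinates `realCoord`. -/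
def realBasisVector {N : ℕ} : Fin N ⊕ Fin N → (Fin N → ℂ) :=
  Sum.elim (fun j => Pi.single j 1) (fun j => Pi.single j Complex.I)

/-- A form on `U ⊆ ℂᴺ = ℝ²ᴺ` is real-algebraic if its coefficients (with respect to the real
coordinates) have real-algebraic real and imaginary parts. -/
def IsRealAlgebraicForm {N n : ℕ} (ψ : (Fin N → ℂ) → RealForm N n)
    (U : Set (Fin N → ℂ)) : Prop :=
  ∀ s : Fin n ⊕ Fin n → Fin N ⊕ Fin N,
    IsRealAlgebraicOn (fun x => (ψ x (fun j => realBasisVector (s j))).re) U ∧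
    IsRealAlgebraicOn (fun x => (ψ x (fun j => realBasisVector (s j))).im) U

/-- A form `K` on the submanifold `M` is real-algebraic if near every point of `M` it is the
restriction to `M` of a real-algebraic form on an open set of `ℂᴺ`. -/
def IsRealAlgebraicFormOn {N n : ℕ} (M : Set (Fin N → ℂ))
    (K : (Fin N → ℂ) → RealForm N n) : Prop :=
  ∀ p ∈ M, ∃ (U : Set (Fin N → ℂ)) (ψ : (Fin N → ℂ) → RealForm N n),
    IsOpen U ∧ p ∈ U ∧ IsRealAlgebraicForm ψ U ∧
    ∀ x ∈ U ∩ M, ∀ v : Fin n ⊕ Fin n → (Fin N → ℂ), (∀ j, v j ∈ tangentVectors M x) →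
      ψ x v = K x v

/-- The Bergman kernel form of the `n`-dimensional analytic space `G`, by definition that of the
manifold of regular points of `G`, exists and is algebraic. -/
def HasAlgebraicBergmanKernel {N : ℕ} (n : ℕ) (G : Set (Fin N → ℂ)) : Prop :=
  (∃ K, IsBergmanKernelForm n (regularPart G) K) ∧
    ∀ K, IsBergmanKernelForm n (regularPart G) K → IsRealAlgebraicFormOn (regularPart G) K

end AlgBergman

end

noncomputable section

namespace AlgBergman

open Metric Filter Topology Complex

/-! ### Functions of several complex variables: Cauchy's formula on polydiscs -/

/-! Write M for the regular part of G and B for the ball minus V₁. Pulling an (n,0)-form ω on M back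
by F gives a holomorphic coefficient h on B with h(γz) det γ = h(z) for γ ∈ Γ, and i^{n²}∫_M ω ∧ ω̄
= (2ⁿ/m) ∫_B |h|², because F has m sheets. Conversely every square integrable invariant h descends:
the quotient h / jac is constant on fibres, and fibres are Γ-orbits, since Γ acts freely on B and
has as many elements as there are sheets. The descended coefficient is first defined off V₂ and
extends across it because it is square integrable. So, up to a constant, the Bergman space of M is
the space of invariant L² holomorphic functions on B (`exists_form`, `l2Inner_eq`).

These functions extend over V₁ to the whole ball, where the kernel n!/πⁿ (1 - ⟨z,w⟩)^{-(n+1)}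
reproduces them; averaging it over Γ against the determinant gives the kernel of the invariant
subspace (`integral_mul_conj_invKernel`). Parseval then evaluates the sum of the |φₖ|² upstairs: it
is a constant times Σ_γ det γ (1 - ⟨γz,z⟩)^{-(n+1)}, rational in z and z̄ (`hasSum_coeff`). Fixed
points of Γ in the ball do no harm, as they lie in V₁.

To come down, parametrize M near a point by n of the ambient coordinates, so that the inverse chart
is a coordinate projection π. If k is the kernel coefficient in this chart, then |jac(π∘F)|² ·
k(π∘F) is the function just found. Algebraic functions are closed under field operations,
conjugation and differentiation, so k∘π∘F is algebraic over the real polynomials in z, as are the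
components of π∘F. The 2n real coordinates of π∘F together with k∘π∘F are 2n+1 functions in
transcendence degree at most 2n, hence satisfy a polynomial relation. Since π∘F is a local
homeomorphism, the relation holds for k on an open part of the chart, and by real analyticity of k
on all of it (`exists_mvPolynomial_kernelCoeff`). Finally x ↦ k(π x) π^*(i^{n²} dz ∧ dz̄) is a form
on an open set of ℂᴺ that restricts to the kernel form.

The function theory this rests on is proved on the way: Cauchy's formula on polydiscs, Osgood's
lemma, removable singularities of L² holomorphic functions along thin sets, and the reproducing
formula of the ball, derived from Gaussian integrals. -/

lemma mem_closedBall_pi_iff {n : ℕ} {c z : Fin n → ℂ} {R : ℝ} (hR : 0 ≤ R) :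
    z ∈ closedBall c R ↔ ∀ i, z i ∈ closedBall (c i) R := by
  simp [mem_closedBall, dist_pi_le_iff hR]

lemma torusMap_mem_closedBall {n : ℕ} (c : Fin n → ℂ) {R : ℝ} (hR : 0 ≤ R) (θ : Fin n → ℝ) :
    torusMap c (fun _ => R) θ ∈ closedBall c R := by
  rw [mem_closedBall_pi_iff hR]
  intro i
  simpa [circleMap, torusMap] using circleMap_mem_closedBall (c i) hR (θ i)

lemma torusMap_sub_ne_zero {n : ℕ} {c w : Fin n → ℂ} {R : ℝ} (hR : 0 < R) (hw : w ∈ ball c R)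
    (θ : Fin n → ℝ) (i : Fin n) : torusMap c (fun _ => R) θ i - w i ≠ 0 := by
  intro h
  have h1 : dist (w i) (c i) < R := (dist_pi_lt_iff hR).1 hw i
  have h2 : torusMap c (fun _ => R) θ i = circleMap (c i) R (θ i) := rfl
  rw [sub_eq_zero, h2] at h
  have := circleMap_mem_sphere (c i) hR.le (θ i)
  rw [h, mem_sphere] at this
  linarith

lemma continuous_torusMap {n : ℕ} (c : Fin n → ℂ) (R : Fin n → ℝ) : Continuous (torusMap c R) := by
  unfold torusMap
  fun_prop

lemma continuous_torusMap_apply {n : ℕ} (c : Fin n → ℂ) (R : Fin n → ℝ) (i : Fin n) :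
    Continuous fun θ => torusMap c R θ i :=
  (continuous_apply i).comp (continuous_torusMap c R)

lemma torusIntegrable_of_continuousOn {n : ℕ} {c : Fin n → ℂ} {R : ℝ} (hR : 0 ≤ R)
    {f : (Fin n → ℂ) → ℂ} (hf : ContinuousOn f (closedBall c R)) :
    TorusIntegrable f c (fun _ => R) := by
  refine Continuous.integrableOn_Icc ?_
  exact hf.comp_continuous (continuous_torusMap _ _) (torusMap_mem_closedBall c hR)

/-- Induction on the dimension: splitting off the first variable leaves an inner torus integral for
the induction hypothesis and an outer circle integral for the one-variable formula. Only joint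
continuity and separate differentiability are assumed, so that Osgood's lemma can be deduced. -/
theorem torusIntegral_cauchy {n : ℕ} {c : Fin n → ℂ} {R : ℝ} (hR : 0 < R) {f : (Fin n → ℂ) → ℂ}
    (hf : ContinuousOn f (closedBall c R))
    (hd : ∀ z ∈ closedBall c R, ∀ i, DifferentiableOn ℂ (fun t => f (Function.update z i t))
      (ball (c i) R)) {w : Fin n → ℂ} (hw : w ∈ ball c R) :
    torusIntegral (fun z => (∏ i, (z i - w i)⁻¹) * f z) c (fun _ => R) =
      (2 * Real.pi * I) ^ n * f w := by
  induction n with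
  | zero => simp [Subsingleton.elim c w]
  | succ n ih =>
    have hTI : TorusIntegrable (fun z => (∏ i, (z i - w i)⁻¹) * f z) c (fun _ => R) := by
      refine Continuous.integrableOn_Icc ?_
      refine Continuous.mul ?_
        (hf.comp_continuous (continuous_torusMap _ _) (torusMap_mem_closedBall c hR.le))
      refine continuous_finsetProd _ fun i _ => ?_
      refine Continuous.inv₀ ?_ fun θ => torusMap_sub_ne_zero hR hw θ i
      exact (continuous_torusMap_apply _ _ i).sub continuous_const
    rw [torusIntegral_succ hTI]
    have hw' : ∀ i, w i ∈ ball (c i) R := fun i => (dist_pi_lt_iff hR).1 hw i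
    have key : ∀ x ∈ closedBall (c 0) R, ∀ y ∈ closedBall (c ∘ Fin.succ) R,
        (Fin.cons x y : Fin (n + 1) → ℂ) ∈ closedBall c R := by
      intro x hx y hy
      rw [mem_closedBall_pi_iff hR.le] at hy ⊢
      intro i
      refine Fin.cases ?_ (fun i => ?_) i
      · simpa using hx
      · simpa using hy i
    have hcons : ∀ x, Continuous fun y : Fin n → ℂ => (Fin.cons x y : Fin (n + 1) → ℂ) := by
      intro x
      refine continuous_pi fun i => Fin.cases ?_ (fun i => ?_) i
      · simpa using continuous_const
      · simpa using continuous_apply i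
    have hcons' : ∀ y : Fin n → ℂ, Continuous fun x : ℂ => (Fin.cons x y : Fin (n + 1) → ℂ) := by
      intro y
      refine continuous_pi fun i => Fin.cases ?_ (fun i => ?_) i
      · simpa using continuous_id'
      · simpa using continuous_const
    have hinner : ∀ x ∈ sphere (c 0) R,
        torusIntegral (fun y => (∏ i, ((Fin.cons x y : Fin (n + 1) → ℂ) i - w i)⁻¹) *
          f (Fin.cons x y)) (c ∘ Fin.succ) (fun _ => R) =
        (2 * Real.pi * I) ^ n * ((x - w 0)⁻¹ * f (Fin.cons x (w ∘ Fin.succ))) := by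
      intro x hx
      have hx' := sphere_subset_closedBall hx
      have := ih (c := c ∘ Fin.succ) (f := fun y => f (Fin.cons x y)) (w := w ∘ Fin.succ)
        (hf.comp (hcons x).continuousOn fun y hy => key x hx' y hy)
        (fun z hz i => by
          have := hd (Fin.cons x z) (key x hx' z hz) i.succ
          simpa [Fin.cons_update] using this)
        ((dist_pi_lt_iff hR).2 fun i => hw' i.succ)
      simp only [Fin.prod_univ_succ, Fin.cons_zero, Fin.cons_succ, mul_assoc]
      rw [torusIntegral_const_mul]
      simp only [Function.comp_apply] at this
      rw [this]
      ring
    have hR' : (fun _ : Fin (n + 1) => R) ∘ Fin.succ = fun _ => R := rfl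
    rw [hR', circleIntegral.integral_congr hR.le hinner]
    have h1 : DiffContOnCl ℂ (fun x => f (Fin.cons x (w ∘ Fin.succ))) (ball (c 0) R) := by
      have hmem : w ∘ Fin.succ ∈ closedBall (c ∘ Fin.succ) R :=
        ball_subset_closedBall ((dist_pi_lt_iff hR).2 fun i => hw' i.succ)
      refine ⟨?_, ?_⟩
      · have := hd (Fin.cons (c 0) (w ∘ Fin.succ)) (key _ (mem_closedBall_self hR.le) _ hmem) 0
        simpa [Fin.update_cons_zero] using this
      · rw [closure_ball _ hR.ne']
        exact hf.comp (hcons' _).continuousOn fun x hx => key x hx _ hmem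
    have h2 := h1.circleIntegral_sub_inv_smul (hw' 0)
    simp only [smul_eq_mul] at h2
    rw [circleIntegral.integral_const_mul, h2, ← mul_assoc, pow_succ]
    congr 2
    ext i
    refine Fin.cases ?_ (fun i => ?_) i <;> simp

/-- No differentiation under the integral sign: the Cauchy kernel is an analytic map of w into the
Banach algebra of continuous functions on the parameter box, because inversion is analytic at units,
and integration against φ is a continuous linear functional. -/
theorem analyticOnNhd_torusIntegral {n : ℕ} {c : Fin n → ℂ} {R : ℝ} (hR : 0 < R)
    {φ : (Fin n → ℂ) → ℂ} (hφ : TorusIntegrable φ c (fun _ => R)) :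
    AnalyticOnNhd ℂ (fun w => torusIntegral (fun z => (∏ i, (z i - w i)⁻¹) * φ z) c (fun _ => R))
      (ball c R) := by
  intro w hw
  let K : Set (Fin n → ℝ) := Icc 0 fun _ => 2 * Real.pi
  have : CompactSpace K := isCompact_iff_compactSpace.1 isCompact_Icc
  let μ : Measure K := Measure.comap (↑) (volume : Measure (Fin n → ℝ))
  let ψ : (Fin n → ℝ) → ℂ := fun θ =>
    (∏ i, R * exp (θ i * I) * I : ℂ) * φ (torusMap c (fun _ => R) θ)
  have hψ : Integrable (fun θ : K => ψ θ) μ := by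
    have h := hφ.function_integrable
    simp only [smul_eq_mul] at h
    have : μ.map ((↑) : K → (Fin n → ℝ)) = volume.restrict K := map_comap_subtype_coe measurableSet_Icc _
    have h' : Integrable ψ (μ.map ((↑) : K → (Fin n → ℝ))) := by rw [this]; exact h
    exact (integrable_map_measure h'.1 measurable_subtype_coe.aemeasurable).1 h'
  let e : Fin n → C(K, ℂ) := fun i =>
    ⟨fun θ => torusMap c (fun _ => R) θ i,
      (continuous_torusMap_apply c (fun _ => R) i).comp continuous_subtype_val⟩
  -- Integration against the integrable density ψ; its operator norm is at most the L¹ norm of ψ.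
  let Λ : C(K, ℂ) →L[ℂ] ℂ := LinearMap.mkContinuous
    { toFun := fun g => ∫ θ, g θ * ψ θ ∂μ
      map_add' := fun g h => by
        simp only [ContinuousMap.add_apply, add_mul]
        refine integral_add ?_ ?_ <;>
        refine hψ.bdd_mul (ContinuousMap.continuous _).aestronglyMeasurable
          (ae_of_all _ fun θ => ContinuousMap.norm_coe_le_norm _ θ)
      map_smul' := fun a g => by
        simp only [ContinuousMap.smul_apply, smul_eq_mul, mul_assoc, RingHom.id_apply]
        exact integral_const_mul _ _ }
    (∫ θ, ‖ψ θ‖ ∂μ) (fun g => by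
      refine (norm_integral_le_of_norm_le (hψ.norm.const_mul ‖g‖) (ae_of_all _ fun θ => ?_)).trans ?_
      · rw [norm_mul]
        gcongr
        exact ContinuousMap.norm_coe_le_norm _ θ
      · rw [integral_const_mul, mul_comm])
  let G : (Fin n → ℂ) → C(K, ℂ) := fun w => ∏ i, Ring.inverse (e i - algebraMap ℂ _ (w i))
  have hunit : ∀ w ∈ ball c R, ∀ i, IsUnit (e i - algebraMap ℂ C(K, ℂ) (w i)) := by
    intro w hw i
    rw [ContinuousMap.isUnit_iff_forall_ne_zero]
    intro θ
    exact torusMap_sub_ne_zero hR hw θ i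
  have hG : AnalyticAt ℂ G w := by
    refine Finset.analyticAt_fun_prod _ fun i _ => ?_
    obtain ⟨u, hu⟩ := hunit w hw i
    have h1 : AnalyticAt ℂ (fun w : Fin n → ℂ => e i - algebraMap ℂ C(K, ℂ) (w i)) w := by
      refine analyticAt_const.sub ?_
      exact ((algebraMapCLM ℂ C(K, ℂ)).comp
        (ContinuousLinearMap.proj (R := ℂ) (φ := fun _ : Fin n => ℂ) i)).analyticAt w
    have h2 : AnalyticAt ℂ (Ring.inverse : C(K, ℂ) → C(K, ℂ)) (e i - algebraMap ℂ _ (w i)) := by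
      rw [← hu]; exact analyticAt_inverse u
    exact AnalyticAt.comp_of_eq (g := Ring.inverse) (f := fun w : Fin n → ℂ => e i - algebraMap ℂ C(K, ℂ) (w i)) h2 h1 rfl
  have hΛ : AnalyticAt ℂ (fun w => Λ (G w)) w := (Λ.analyticAt _).comp hG
  refine hΛ.congr ?_
  filter_upwards [isOpen_ball.mem_nhds hw] with w hw
  have hval : ∀ θ : K, G w θ = ∏ i, (torusMap c (fun _ => R) θ i - w i)⁻¹ := by
    intro θ
    simp only [G, ContinuousMap.prod_apply]
    refine Finset.prod_congr rfl fun i _ => ?_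
    have := Ring.mul_inverse_cancel _ (hunit w hw i)
    have h3 := congrArg (fun g : C(K, ℂ) => g θ) this
    simp only [ContinuousMap.mul_apply, ContinuousMap.one_apply] at h3
    exact eq_inv_of_mul_eq_one_right h3
  change ∫ θ, G w θ * ψ θ ∂μ = _
  rw [torusIntegral, ← integral_subtype_comap measurableSet_Icc]
  refine integral_congr_ae (ae_of_all _ fun θ => ?_)
  simp only [hval, ψ, smul_eq_mul]
  ring

/-- A polydisc function with a Cauchy integral representation is analytic. -/
theorem analyticAt_of_torusIntegral {n : ℕ} {c : Fin n → ℂ} {R : ℝ} (hR : 0 < R)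
    {f : (Fin n → ℂ) → ℂ} (hφ : TorusIntegrable f c (fun _ => R))
    (h : ∀ w ∈ ball c R, torusIntegral (fun z => (∏ i, (z i - w i)⁻¹) * f z) c (fun _ => R) =
      (2 * Real.pi * I) ^ n * f w) : AnalyticAt ℂ f c := by
  have h1 := (analyticOnNhd_torusIntegral hR hφ c (mem_ball_self hR)).const_smul
    (c := ((2 * Real.pi * I) ^ n : ℂ)⁻¹)
  refine h1.congr ?_
  filter_upwards [ball_mem_nhds c hR] with w hw
  simp only [Pi.smul_apply, h w hw, smul_eq_mul]
  rw [inv_mul_cancel_left₀]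
  exact pow_ne_zero _ (by simp [Real.pi_ne_zero])

/-- **Osgood's lemma**. -/
theorem analyticOnNhd_of_continuousOn_of_separately {n : ℕ} {Ω : Set (Fin n → ℂ)} (hΩ : IsOpen Ω)
    {f : (Fin n → ℂ) → ℂ} (hf : ContinuousOn f Ω)
    (hd : ∀ z ∈ Ω, ∀ i, DifferentiableAt ℂ (fun t => f (Function.update z i t)) (z i)) :
    AnalyticOnNhd ℂ f Ω := by
  intro c hc
  obtain ⟨R, hR, hsub⟩ := nhds_basis_closedBall.mem_iff.1 (hΩ.mem_nhds hc)
  have hfc := hf.mono hsub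
  refine analyticAt_of_torusIntegral hR (torusIntegrable_of_continuousOn hR.le hfc) fun w hw => ?_
  refine torusIntegral_cauchy hR hfc (fun z hz i t ht => ?_) hw
  have hz' : Function.update z i t ∈ closedBall c R := by
    rw [mem_closedBall_pi_iff hR.le] at hz ⊢
    intro j
    rcases eq_or_ne j i with rfl | hj
    · simpa using ht.le
    · simpa [hj] using hz j
  have := hd _ (hsub hz') i
  simp only [Function.update_idem, Function.update_self] at this
  exact this.differentiableWithinAt

theorem analyticOnNhd_of_differentiableOn {n : ℕ} {Ω : Set (Fin n → ℂ)} (hΩ : IsOpen Ω)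
    {f : (Fin n → ℂ) → ℂ} (hf : DifferentiableOn ℂ f Ω) : AnalyticOnNhd ℂ f Ω := by
  refine analyticOnNhd_of_continuousOn_of_separately hΩ hf.continuousOn fun z hz i => ?_
  have h1 : DifferentiableAt ℂ f (Function.update z i (z i)) := by
    rw [Function.update_eq_self]; exact hf.differentiableAt (hΩ.mem_nhds hz)
  have h2 : DifferentiableAt ℂ (fun t : ℂ => Function.update z i t) (z i) :=
    (hasFDerivAt_update z (z i)).differentiableAt
  exact DifferentiableAt.comp (z i) h1 h2

lemma differentiable_update {n : ℕ} (z : Fin n → ℂ) (i : Fin n) :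
    Differentiable ℂ (fun t : ℂ => Function.update z i t) :=
  fun t => (hasFDerivAt_update z t).differentiableAt

/-- Locally bounded pointwise limits of analytic functions are analytic. -/
theorem analyticOnNhd_of_tendsto {n : ℕ} {Ω : Set (Fin n → ℂ)} (hΩ : IsOpen Ω) {ι : Type*}
    {l : Filter ι} [l.NeBot] [l.IsCountablyGenerated] {F : ι → (Fin n → ℂ) → ℂ}
    {f : (Fin n → ℂ) → ℂ} (hF : ∀ j, AnalyticOnNhd ℂ (F j) Ω)
    (hb : ∀ z ∈ Ω, ∃ C : ℝ, ∀ᶠ w in 𝓝 z, ∀ j, ‖F j w‖ ≤ C)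
    (hlim : ∀ z ∈ Ω, Tendsto (fun j => F j z) l (𝓝 (f z))) : AnalyticOnNhd ℂ f Ω := by
  intro c hc
  obtain ⟨C, hC⟩ := hb c hc
  obtain ⟨R, hR, hsub⟩ := nhds_basis_closedBall.mem_iff.1 (inter_mem (hΩ.mem_nhds hc) hC)
  have hmem := torusMap_mem_closedBall c hR.le
  have hcont : ∀ j, ContinuousOn (F j) (closedBall c R) := fun j =>
    (hF j).continuousOn.mono fun z hz => (hsub hz).1
  have hfC : ∀ z ∈ closedBall c R, ‖f z‖ ≤ C := fun z hz =>
    le_of_tendsto (hlim z (hsub hz).1).norm (Eventually.of_forall fun j => (hsub hz).2 j)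
  have hmeas : AEStronglyMeasurable (fun θ : Fin n → ℝ => f (torusMap c (fun _ => R) θ))
      (volume.restrict (Icc 0 fun _ => 2 * Real.pi)) :=
    aestronglyMeasurable_of_tendsto_ae l (fun j => ((hcont j).comp_continuous
      (continuous_torusMap _ _) hmem).aestronglyMeasurable)
      (ae_of_all _ fun θ => hlim _ (hsub (hmem θ)).1)
  have hint : TorusIntegrable f c (fun _ => R) := by
    refine Integrable.mono' (g := fun _ => C) ?_ hmeas (ae_of_all _ fun θ => hfC _ (hmem θ))
    exact integrableOn_const isCompact_Icc.measure_lt_top.ne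
  refine analyticAt_of_torusIntegral hR hint fun w hw => ?_
  -- Each `F j` satisfies Cauchy's formula; the uniform bound C lets dominated convergence carry the
  -- formula over to f, which a priori is only bounded and measurable on the torus.
  have hcauchy : ∀ j, torusIntegral (fun z => (∏ i, (z i - w i)⁻¹) * F j z) c (fun _ => R) =
      (2 * Real.pi * I) ^ n * F j w := by
    intro j
    refine torusIntegral_cauchy hR (hcont j) (fun z hz i t ht => ?_) hw
    have hz' : Function.update z i t ∈ closedBall c R := by
      rw [mem_closedBall_pi_iff hR.le] at hz ⊢
      intro k
      rcases eq_or_ne k i with rfl | hk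
      · simpa using ht.le
      · simpa [hk] using hz k
    exact (DifferentiableAt.comp t (hF j _ (hsub hz').1).differentiableAt
      (differentiable_update z i t)).differentiableWithinAt
  have hR2 := (hlim w (hsub (ball_subset_closedBall hw)).1).const_mul ((2 * Real.pi * I) ^ n : ℂ)
  refine tendsto_nhds_unique ?_ hR2
  simp only [← hcauchy, torusIntegral, smul_eq_mul]
  have hkc : Continuous fun θ : Fin n → ℝ => (∏ i, R * exp (θ i * I) * I : ℂ) *
      ∏ i, (torusMap c (fun _ => R) θ i - w i)⁻¹ := by
    refine Continuous.mul (by fun_prop) (continuous_finsetProd _ fun i _ => ?_)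
    refine Continuous.inv₀ ?_ fun θ => torusMap_sub_ne_zero hR hw θ i
    exact (continuous_torusMap_apply _ _ i).sub continuous_const
  refine tendsto_integral_filter_of_dominated_convergence
    (fun θ => ‖(∏ i, R * exp (θ i * I) * I : ℂ) *
      ∏ i, (torusMap c (fun _ => R) θ i - w i)⁻¹‖ * C) ?_ ?_ ?_ ?_
  · refine Eventually.of_forall fun j => ?_
    simp only [← mul_assoc]
    exact (hkc.mul ((hcont j).comp_continuous
      (continuous_torusMap _ _) hmem)).aestronglyMeasurable
  · refine Eventually.of_forall fun j => ae_of_all _ fun θ => ?_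
    rw [← mul_assoc, norm_mul]
    gcongr
    exact (hsub (hmem θ)).2 j
  · exact (hkc.norm.mul continuous_const).integrableOn_Icc
  · refine ae_of_all _ fun θ => ?_
    simp only [← mul_assoc]
    exact (hlim _ (hsub (hmem θ)).1).const_mul _

/-! ### Unitary invariance of Lebesgue measure, rotation averages and the mean value property -/

/-- The real determinant of a complex linear map is the norm from ℂ to ℝ of its complex determinant.
-/
lemma abs_det_restrictScalars {E : Type*} [AddCommGroup E] [Module ℂ E] [Module ℝ E]
    [IsScalarTower ℝ ℂ E] [FiniteDimensional ℂ E] (A : E →ₗ[ℂ] E) :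
    |LinearMap.det (A.restrictScalars ℝ)| = ‖LinearMap.det A‖ ^ 2 := by
  rw [LinearMap.det_restrictScalars, Algebra.norm_complex_eq]
  simp [Complex.normSq_eq_norm_sq]

lemma measurePreserving_of_norm_det_eq_one {n : ℕ} (A : (Fin n → ℂ) →ₗ[ℂ] (Fin n → ℂ))
    (hA : ‖LinearMap.det A‖ = 1) : MeasurePreserving A volume volume := by
  have h1 := abs_det_restrictScalars A
  rw [hA, one_pow] at h1
  have h2 : LinearMap.det (A.restrictScalars ℝ) ≠ 0 := by
    intro h; rw [h] at h1; simp at h1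
  refine ⟨(LinearMap.continuous_of_finiteDimensional A).measurable, ?_⟩
  have := Measure.map_linearMap_addHaar_eq_smul_addHaar (μ := (volume : Measure (Fin n → ℂ))) h2
  rw [abs_inv, h1] at this
  simpa using this

lemma measurePreserving_act {n : ℕ} (γ : Matrix.unitaryGroup (Fin n) ℂ) :
    MeasurePreserving (act γ) volume volume := by
  have := measurePreserving_of_norm_det_eq_one (Matrix.toLin' (γ : Matrix (Fin n) (Fin n) ℂ)) ?_
  · exact this
  · rw [LinearMap.det_toLin']
    exact CStarRing.norm_of_mem_unitary (Matrix.det_of_mem_unitary γ.2)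

lemma measurePreserving_smul {n : ℕ} {u : ℂ} (hu : ‖u‖ = 1) :
    MeasurePreserving (fun z : Fin n → ℂ => u • z) volume volume := by
  refine measurePreserving_of_norm_det_eq_one (u • LinearMap.id) ?_
  simp [hu]

/-- A measure invariant under the rotations `z ↦ e^{iθ} z` integrates a function like its circle
averages. -/
theorem integral_eq_integral_circleAverage {n : ℕ} {ν : Measure (Fin n → ℂ)} [SFinite ν]
    (hν : ∀ u : ℂ, ‖u‖ = 1 → MeasurePreserving (fun z : Fin n → ℂ => u • z) ν ν)
    {h : (Fin n → ℂ) → ℂ} (hh : Integrable h ν) :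
    ∫ z, h z ∂ν = ∫ z, Real.circleAverage (fun t : ℂ => h (t • z)) 0 1 ∂ν := by
  have hu : ∀ θ, ‖circleMap 0 1 θ‖ = 1 := fun θ => by simp
  -- The shear (θ, z) ↦ (θ, e^{iθ} z) preserves the product measure; this supplies the joint
  -- integrability that Fubini needs.
  have hmp : MeasurePreserving (fun p : ℝ × (Fin n → ℂ) => (p.1, circleMap 0 1 p.1 • p.2))
      ((volume.restrict (Ioc 0 (2 * Real.pi))).prod ν)
      ((volume.restrict (Ioc 0 (2 * Real.pi))).prod ν) := by
    refine MeasurePreserving.skew_product (g := fun θ z => circleMap 0 1 θ • z)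
      (MeasurePreserving.id _) ?_ (ae_of_all _ fun θ => (hν _ (hu θ)).map_eq)
    exact Continuous.measurable (by fun_prop)
  have hint : Integrable (fun p : ℝ × (Fin n → ℂ) => h (circleMap 0 1 p.1 • p.2))
      ((volume.restrict (Ioc 0 (2 * Real.pi))).prod ν) := by
    have h1 : Integrable (fun p : ℝ × (Fin n → ℂ) => h p.2)
      ((volume.restrict (Ioc 0 (2 * Real.pi))).prod ν) := hh.comp_snd _
    exact hmp.integrable_comp_of_integrable h1
  simp only [Real.circleAverage_def, intervalIntegral.integral_of_le Real.two_pi_pos.le]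
  rw [integral_smul, ← integral_integral_swap (f := fun θ z => h (circleMap 0 1 θ • z)) hint]
  have : ∀ θ, ∫ z, h (circleMap 0 1 θ • z) ∂ν = ∫ z, h z ∂ν := by
    intro θ
    have h3 := hν _ (hu θ)
    have h4 := integral_map (μ := ν) (f := h) h3.measurable.aemeasurable
      (by rw [h3.map_eq]; exact hh.1)
    rw [h3.map_eq] at h4
    exact h4.symm
  simp only [this]
  have hpi : (Real.pi : ℂ) ≠ 0 := by simp [Real.pi_ne_zero]
  simp [Real.pi_pos.le]
  field_simp

lemma measurePreserving_smul_restrict {n : ℕ} {s : Set (Fin n → ℂ)}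
    (hs : ∀ u : ℂ, ‖u‖ = 1 → ∀ z ∈ s, u • z ∈ s) (u : ℂ) (hu : ‖u‖ = 1) (hm : MeasurableSet s) :
    MeasurePreserving (fun z : Fin n → ℂ => u • z) (volume.restrict s) (volume.restrict s) := by
  have h := (measurePreserving_smul (n := n) hu).restrict_preimage hm
  have : (fun z : Fin n → ℂ => u • z) ⁻¹' s = s := by
    ext z
    refine ⟨fun hz => ?_, hs u hu z⟩
    have hu0 : u ≠ 0 := by rintro rfl; simp at hu
    have := hs u⁻¹ (by simp [hu]) _ hz
    simpa [smul_smul, hu0] using this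
  rwa [this] at h

/-- A set is balanced: closed under multiplication by complex numbers of norm at most one. -/
lemma circleAverage_smul_eq {n : ℕ} {h : (Fin n → ℂ) → ℂ} {z : Fin n → ℂ}
    (hh : ∀ t : ℂ, ‖t‖ ≤ 1 → AnalyticAt ℂ h (t • z)) :
    Real.circleAverage (fun t : ℂ => h (t • z)) 0 1 = h 0 := by
  have hd : ∀ t : ℂ, ‖t‖ ≤ 1 → DifferentiableAt ℂ (fun t : ℂ => h (t • z)) t := fun t ht =>
    (hh t ht).differentiableAt.comp t (f := fun t : ℂ => t • z) (by fun_prop)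
  have := circleAverage_of_differentiable_on_off_countable (f := fun t : ℂ => h (t • z)) (c := 0)
    (R := 1) countable_empty
    (fun t ht => (hd t (by simpa using ht)).continuousAt.continuousWithinAt)
    (fun t ht => hd t (by have := ht.1; simp at this; exact this.le))
  simpa using this

/-- Almost every disc {t z : |t| ≤ 1} lies where h is analytic, so the circle averages are all h 0.
-/
theorem integral_eq_mul_apply_zero {n : ℕ} {ν : Measure (Fin n → ℂ)} [SFinite ν]
    (hν : ∀ u : ℂ, ‖u‖ = 1 → MeasurePreserving (fun z : Fin n → ℂ => u • z) ν ν)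
    {h : (Fin n → ℂ) → ℂ} (hh : Integrable h ν)
    (ha : ∀ᵐ z ∂ν, ∀ t : ℂ, ‖t‖ ≤ 1 → AnalyticAt ℂ h (t • z)) :
    ∫ z, h z ∂ν = ν.real univ * h 0 := by
  rw [integral_eq_integral_circleAverage hν hh, integral_congr_ae (g := fun _ => h 0)]
  · simp
  · filter_upwards [ha] with z hz using circleAverage_smul_eq hz

/-- The mean value inequality for `|h|²`. -/
theorem volume_ball_mul_enorm_sq_le {n : ℕ} {c : Fin n → ℂ} {r : ℝ}
    {h : (Fin n → ℂ) → ℂ} (hh : AnalyticOnNhd ℂ h (closedBall c r)) :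
    volume (ball c r) * ‖h c‖ₑ ^ 2 ≤ ∫⁻ z in ball c r, ‖h z‖ₑ ^ 2 := by
  -- The square of h is again holomorphic and has modulus |h|², so the mean value equality for it
  -- gives the inequality.
  set g : (Fin n → ℂ) → ℂ := fun z => h (c + z) ^ 2 with hg
  have hga : AnalyticOnNhd ℂ g (closedBall 0 r) := by
    intro z hz
    have h1 : AnalyticAt ℂ h (c + z) := hh _ (by simpa using hz)
    have h2 : AnalyticAt ℂ (fun z : Fin n → ℂ => c + z) z := by fun_prop
    exact (h1.comp_of_eq h2 rfl).pow 2
  have hint : IntegrableOn g (ball 0 r) :=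
    (hga.continuousOn.integrableOn_compact (isCompact_closedBall _ _)).mono_set ball_subset_closedBall
  have hbal : ∀ t : ℂ, ‖t‖ ≤ 1 → ∀ z ∈ ball (0 : Fin n → ℂ) r, t • z ∈ ball (0 : Fin n → ℂ) r := by
    intro t ht z hz
    simp only [mem_ball_zero_iff] at hz ⊢
    rw [norm_smul]
    nlinarith [norm_nonneg z]
  have hmv := integral_eq_mul_apply_zero (ν := volume.restrict (ball 0 r))
    (fun u hu => measurePreserving_smul_restrict (fun u hu => hbal u hu.le) u hu measurableSet_ball)
    hint (by
      filter_upwards [ae_restrict_mem measurableSet_ball] with z hz t ht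
      exact hga _ (ball_subset_closedBall (hbal t ht z hz)))
  have hvol : volume (ball c r) = volume (ball (0 : Fin n → ℂ) r) :=
    Measure.addHaar_ball_center _ c r
  have hlt : volume (ball (0 : Fin n → ℂ) r) ≠ ⊤ := measure_ball_lt_top.ne
  have h1 : volume (ball c r) * ‖h c‖ₑ ^ 2 = ‖∫ z in ball 0 r, g z‖ₑ := by
    rw [hmv, enorm_mul, hvol]
    have h2 : ‖(((volume.restrict (ball (0 : Fin n → ℂ) r)).real univ : ℝ) : ℂ)‖ₑ =
        volume (ball (0 : Fin n → ℂ) r) := by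
      rw [← ofReal_norm, Complex.norm_real, Real.norm_of_nonneg measureReal_nonneg]
      simp [Measure.real, hlt]
    rw [h2]
    simp [hg, enorm_pow]
  rw [h1]
  refine (enorm_integral_le_lintegral_enorm _).trans (le_of_eq ?_)
  have hpre : ball (0 : Fin n → ℂ) r = (fun z => c + z) ⁻¹' ball c r := by
    ext z; simp
  have hmp := (measurePreserving_add_left (volume : Measure (Fin n → ℂ)) c).setLIntegral_comp_preimage_emb
    (measurableEmbedding_addLeft c) (fun z => ‖h z‖ₑ ^ 2) (ball c r)
  rw [← hmp, ← hpre]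
  simp [hg, enorm_pow]

/-- Local uniform control of holomorphic functions by their `L²` norm. -/
theorem exists_enorm_sq_le_mul_lintegral {n : ℕ} {Ω : Set (Fin n → ℂ)} (hΩ : IsOpen Ω)
    {c : Fin n → ℂ} (hc : c ∈ Ω) : ∃ C : ENNReal, C ≠ ⊤ ∧ ∀ᶠ z in 𝓝 c, ∀ h : (Fin n → ℂ) → ℂ,
      AnalyticOnNhd ℂ h Ω → ‖h z‖ₑ ^ 2 ≤ C * ∫⁻ w in Ω, ‖h w‖ₑ ^ 2 := by
  obtain ⟨R, hR, hsub⟩ := nhds_basis_closedBall.mem_iff.1 (hΩ.mem_nhds hc)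
  have hpos : volume (ball (0 : Fin n → ℂ) (R / 2)) ≠ 0 :=
    (measure_ball_pos _ _ (by positivity)).ne'
  have hlt : volume (ball (0 : Fin n → ℂ) (R / 2)) ≠ ⊤ := measure_ball_lt_top.ne
  refine ⟨(volume (ball (0 : Fin n → ℂ) (R / 2)))⁻¹, ENNReal.inv_ne_top.2 hpos, ?_⟩
  filter_upwards [ball_mem_nhds c (half_pos hR)] with z hz h hh
  have hzΩ : closedBall z (R / 2) ⊆ Ω := (closedBall_subset_closedBall' (by
    have : dist z c < R / 2 := hz
    linarith)).trans hsub
  have h1 := volume_ball_mul_enorm_sq_le (hh.mono hzΩ)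
  rw [Measure.addHaar_ball_center] at h1
  have h2 : ∫⁻ w in ball z (R / 2), ‖h w‖ₑ ^ 2 ≤ ∫⁻ w in Ω, ‖h w‖ₑ ^ 2 :=
    lintegral_mono_set (ball_subset_closedBall.trans hzΩ)
  calc ‖h z‖ₑ ^ 2 = (volume (ball (0 : Fin n → ℂ) (R / 2)))⁻¹ *
        (volume (ball (0 : Fin n → ℂ) (R / 2)) * ‖h z‖ₑ ^ 2) := by
        rw [← mul_assoc, ENNReal.inv_mul_cancel hpos hlt, one_mul]
    _ ≤ _ := by gcongr; exact h1.trans h2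

/-! ### Thin sets -/

/-- `A` is thin in `Ω`: near every point of `Ω` it is contained in the zero set of a holomorphic
function that does not vanish identically. -/
def IsThinIn {n : ℕ} (A Ω : Set (Fin n → ℂ)) : Prop :=
  ∀ p ∈ Ω, ∃ f : (Fin n → ℂ) → ℂ, AnalyticAt ℂ f p ∧ (¬ ∀ᶠ z in 𝓝 p, f z = 0) ∧
    ∀ᶠ z in 𝓝 p, z ∈ A → f z = 0

/-- A substitute for Weierstrass preparation. On a line through p and a nearby point where f ≠ 0,
the zeros of f are isolated, so some small circle around p in this line avoids them; by compactness
the same circle works on all parallel lines near p. -/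
lemma exists_slice {n : ℕ} {f : (Fin n → ℂ) → ℂ} {p : Fin n → ℂ} (hf : AnalyticAt ℂ f p)
    (hne : ¬ ∀ᶠ z in 𝓝 p, f z = 0) {U : Set (Fin n → ℂ)} (hU : U ∈ 𝓝 p) :
    ∃ (v : Fin n → ℂ) (r δ : ℝ), 0 < r ∧ 0 < δ ∧
      (∀ z ∈ ball p δ, ∀ t : ℂ, ‖t‖ ≤ 2 * r → z + t • v ∈ U ∧ AnalyticAt ℂ f (z + t • v)) ∧
      (∀ z ∈ ball p δ, ∀ t : ℂ, ‖t‖ = r → f (z + t • v) ≠ 0) := by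
  obtain ⟨ρ, hρ, hsub⟩ := nhds_basis_ball.mem_iff.1 (inter_mem hU hf.eventually_analyticAt)
  have hfreq : ∃ᶠ z in 𝓝 p, f z ≠ 0 := not_eventually.1 hne
  -- The radius ρ/4 makes ρ/2 + 2‖v‖ < ρ, so translates by t v with |t| ≤ 2 of points within ρ/2 of
  -- p stay where f is analytic.
  obtain ⟨q, hfq, hq⟩ := (hfreq.and_eventually (ball_mem_nhds p (show 0 < ρ / 4 by positivity))).exists
  set v := q - p with hv
  have hvn : ‖v‖ < ρ / 4 := by simpa [hv, dist_eq_norm] using hq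
  have hmem : ∀ z ∈ ball p (ρ / 2), ∀ t : ℂ, ‖t‖ ≤ 2 → z + t • v ∈ ball p ρ := by
    intro z hz t ht
    rw [mem_ball, dist_eq_norm] at hz ⊢
    have : z + t • v - p = (z - p) + t • v := by abel
    rw [this]
    refine (norm_add_le _ _).trans_lt ?_
    rw [norm_smul]
    nlinarith [norm_nonneg t, norm_nonneg v]
  have hga : AnalyticOnNhd ℂ (fun t : ℂ => f (p + t • v)) (closedBall 0 2) := by
    intro t ht
    have h1 : AnalyticAt ℂ f (p + t • v) :=
      (hsub (hmem p (mem_ball_self (by positivity)) t (by simpa using ht))).2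
    exact h1.comp_of_eq (f := fun t : ℂ => p + t • v) (by fun_prop) rfl
  have hpunct : ∀ᶠ t in 𝓝[≠] (0 : ℂ), f (p + t • v) ≠ 0 := by
    by_contra hcon
    have hfr : ∃ᶠ t in 𝓝[≠] (0 : ℂ), f (p + t • v) = 0 :=
      (not_eventually.1 hcon).mono fun _ => not_not.1
    have := hga.eqOn_zero_of_preconnected_of_frequently_eq_zero
      (convex_closedBall _ _).isPreconnected (mem_closedBall_self (by norm_num)) hfr
      (show (1 : ℂ) ∈ closedBall (0 : ℂ) 2 by simp)
    simp [hv] at this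
    exact hfq this
  rw [eventually_nhdsWithin_iff] at hpunct
  obtain ⟨ε, hε, hεs⟩ := Metric.eventually_nhds_iff_ball.1 hpunct
  set r := min (ε / 2) 1 with hr
  have hr0 : 0 < r := by positivity
  have hr1 : r ≤ 1 := min_le_right _ _
  have hrε : r < ε := (min_le_left _ _).trans_lt (by linarith)
  have hcirc : ∀ᶠ z in 𝓝 p, ∀ t ∈ sphere (0 : ℂ) r, f (z + t • v) ≠ 0 := by
    refine (isCompact_sphere _ _).eventually_forall_of_forall_eventually fun t ht => ?_
    have htn : ‖t‖ = r := by simpa using ht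
    have h1 : ContinuousAt f (p + t • v) :=
      (hsub (hmem p (mem_ball_self (by positivity)) t (by linarith))).2.continuousAt
    have h2 : ContinuousAt (fun x : (Fin n → ℂ) × ℂ => f (x.1 + x.2 • v)) (p, t) :=
      ContinuousAt.comp (f := fun x : (Fin n → ℂ) × ℂ => x.1 + x.2 • v) h1
        (Continuous.continuousAt (by fun_prop))
    refine h2.eventually_ne ?_
    refine hεs t (by simpa [htn] using hrε) ?_
    rintro rfl
    simp at htn
    linarith
  obtain ⟨δ, hδ, hδs⟩ := Metric.eventually_nhds_iff_ball.1 hcirc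
  refine ⟨v, r, min δ (ρ / 2), hr0, by positivity, fun z hz t ht => ?_, fun z hz t ht => ?_⟩
  · exact hsub (hmem z (ball_subset_ball (min_le_right _ _) hz) t (by linarith))
  · exact hδs z (ball_subset_ball (min_le_left _ _) hz) t (by simpa using ht)

/-- By the identity theorem on the disc of radius 2r: the zeros cannot accumulate, as f does not
vanish on the inner circle. -/
lemma eventually_slice_ne_zero {n : ℕ} {f : (Fin n → ℂ) → ℂ} {z v : Fin n → ℂ} {r : ℝ}
    (hr : 0 < r) (ha : ∀ t : ℂ, ‖t‖ ≤ 2 * r → AnalyticAt ℂ f (z + t • v))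
    (hne : ∀ t : ℂ, ‖t‖ = r → f (z + t • v) ≠ 0) {t₀ : ℂ} (ht₀ : ‖t₀‖ < 2 * r) :
    ∀ᶠ t in 𝓝[≠] t₀, f (z + t • v) ≠ 0 := by
  by_contra hcon
  have hfr : ∃ᶠ t in 𝓝[≠] t₀, f (z + t • v) = 0 :=
    (not_eventually.1 hcon).mono fun _ => not_not.1
  have hga : AnalyticOnNhd ℂ (fun t : ℂ => f (z + t • v)) (ball 0 (2 * r)) := by
    intro t ht
    exact (ha t (mem_ball_zero_iff.1 ht).le).comp_of_eq (f := fun t : ℂ => z + t • v) (by fun_prop) rfl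
  have hrn : ‖(r : ℂ)‖ = r := by simp [hr.le]
  have := hga.eqOn_zero_of_preconnected_of_frequently_eq_zero (convex_ball _ _).isPreconnected
    (by simpa using ht₀) hfr (show (r : ℂ) ∈ ball (0 : ℂ) (2 * r) by
      rw [mem_ball_zero_iff, hrn]; linarith)
  exact hne r hrn this

/-- Locally the set lies in the zeros of a function whose restrictions to parallel lines have
isolated zeros; Fubini along these lines gives measure zero. -/
theorem IsThinIn.volume_eq_zero {n : ℕ} {A Ω : Set (Fin n → ℂ)} (hA : IsThinIn A Ω)
    (hAΩ : A ⊆ Ω) : volume A = 0 := by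
  refine measure_null_of_locally_null _ fun p hp => ?_
  obtain ⟨f, hf, hne, hfA⟩ := hA p (hAΩ hp)
  obtain ⟨v, r, δ, hr, hδ, h1, h2⟩ := exists_slice hf hne hfA
  refine ⟨A ∩ ball p δ, inter_mem_nhdsWithin _ (ball_mem_nhds p hδ), ?_⟩
  set Z : Set (Fin n → ℂ) := {z ∈ ball p δ | f z = 0} with hZ
  have hsub : A ∩ ball p δ ⊆ Z := fun z hz => ⟨hz.2, by
    have := (h1 z hz.2 0 (by simp [hr.le])).1
    simp only [zero_smul, add_zero] at this
    exact this hz.1⟩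
  refine measure_mono_null hsub ?_
  have hcont : ContinuousOn f (ball p δ) := fun z hz => by
    have := (h1 z hz 0 (by simp [hr.le])).2
    simp only [zero_smul, add_zero] at this
    exact this.continuousAt.continuousWithinAt
  have hmeas : MeasurableSet Z := by
    have hopen : IsOpen (ball p δ ∩ f ⁻¹' {0}ᶜ) :=
      hcont.isOpen_inter_preimage isOpen_ball isOpen_compl_singleton
    have : Z = ball p δ \ (ball p δ ∩ f ⁻¹' {0}ᶜ) := by
      ext z; simp [hZ]
    rw [this]
    exact measurableSet_ball.diff hopen.measurableSet
  have hae : ∀ᵐ y ∂(volume : Measure (Fin n → ℂ)), y ∈ Zᶜ := by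
    refine ae_mem_of_ae_add_linearMap_mem (𝕜 := ℂ) (LinearMap.toSpanSingleton ℂ _ v)
      (volume : Measure ℂ) volume hmeas.compl fun y => ?_
    change volume _ = 0
    -- Around a point t₀ of the slice, the slice is the single point t₀.
    refine measure_null_of_locally_null _ fun t₀ ht₀ => ?_
    simp only [mem_compl_iff, LinearMap.toSpanSingleton_apply, not_not, mem_ofPred_eq] at ht₀
    refine ⟨{t₀}, ?_, by simp⟩
    have h3 := eventually_slice_ne_zero (t₀ := 0) hr (fun t ht => (h1 _ ht₀.1 t ht).2)
      (h2 _ ht₀.1) (by simpa using hr)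
    rw [eventually_nhdsWithin_iff] at h3
    have h4 : Tendsto (fun t => t - t₀) (𝓝 t₀) (𝓝 0) := by
      have : Continuous fun t : ℂ => t - t₀ := by fun_prop
      simpa using this.tendsto t₀
    rw [mem_nhdsWithin_iff_eventually]
    filter_upwards [h4.eventually h3] with t ht htZ
    simp only [mem_compl_iff, LinearMap.toSpanSingleton_apply, not_not, mem_ofPred_eq] at htZ
    by_contra hne
    refine ht (by simpa [sub_eq_zero] using hne) ?_
    rw [add_assoc, ← add_smul]
    simpa using htZ.2
  rw [ae_iff] at hae
  simpa using hae

lemma IsThinIn.frequently_notMem {n : ℕ} {A Ω : Set (Fin n → ℂ)} (hA : IsThinIn A Ω)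
    {p : Fin n → ℂ} (hp : p ∈ Ω) : ∃ᶠ z in 𝓝 p, z ∉ A := by
  obtain ⟨f, -, hne, hfA⟩ := hA p hp
  refine (Frequently.and_eventually (not_eventually.1 hne) hfA).mono fun z hz hzA => ?_
  exact hz.1 (hz.2 hzA)

/-! ### Removable singularities of square integrable holomorphic functions -/

lemma volume_ball_mul_enorm_sq_le_one {g : ℂ → ℂ} {c : ℂ} {r : ℝ}
    (hg : ∀ z ∈ closedBall c r, AnalyticAt ℂ g z) :
    volume (ball c r) * ‖g c‖ₑ ^ 2 ≤ ∫⁻ z in ball c r, ‖g z‖ₑ ^ 2 := by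
  have hmp := volume_preserving_funUnique (Fin 1) ℂ
  have hpre : ∀ r, (MeasurableEquiv.funUnique (Fin 1) ℂ) ⁻¹' ball c r = ball (fun _ => c) r := by
    intro r
    rcases le_or_gt r 0 with hr | hr
    · simp [ball_eq_empty.2 hr]
    · ext z
      simp [dist_pi_lt_iff hr]
  have h := volume_ball_mul_enorm_sq_le (n := 1) (c := fun _ => c) (r := r)
    (h := fun z => g (z 0)) (by
      intro z hz
      have hz0 : z 0 ∈ closedBall c r := by
        have := dist_le_pi_dist z (fun _ => c) 0
        exact this.trans hz
      exact (hg _ hz0).comp_of_eq (f := fun z : Fin 1 → ℂ => z 0)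
        ((ContinuousLinearMap.proj (R := ℂ) (φ := fun _ : Fin 1 => ℂ) 0).analyticAt z) rfl)
  have h1 := hmp.measure_preimage_equiv (ball c r)
  have h2 := hmp.setLIntegral_comp_preimage_emb (MeasurableEquiv.measurableEmbedding _)
    (fun z => ‖g z‖ₑ ^ 2) (ball c r)
  rw [hpre] at h1 h2
  rw [← h1, ← h2]
  exact h

/-- The mean value inequality on the disc of radius |z - c|/2 about z, which avoids c, bounds |z -
c|² |g z|² by the integral of |g|² over a shrinking disc. That integral tends to 0, so Riemann's
removable singularity theorem applies at c. -/
lemma isLittleO_of_lintegral_lt_top {g : ℂ → ℂ} {c : ℂ} {U : Set ℂ} (hU : U ∈ 𝓝 c)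
    (hg : ∀ z ∈ U \ {c}, AnalyticAt ℂ g z) (hint : ∫⁻ z in U \ {c}, ‖g z‖ₑ ^ 2 ≠ ⊤) :
    (fun z => g z - g c) =o[𝓝[≠] c] fun z => (z - c)⁻¹ := by
  have hinv : Tendsto (fun z : ℂ => ‖(z - c)⁻¹‖) (𝓝[≠] c) atTop := by
    refine tendsto_norm_cobounded_atTop.comp (tendsto_inv₀_nhdsNE_zero.comp ?_)
    refine tendsto_nhdsWithin_iff.2 ⟨?_, ?_⟩
    · have : Continuous fun z : ℂ => z - c := by fun_prop
      simpa using (this.tendsto c).mono_left nhdsWithin_le_nhds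
    · filter_upwards [self_mem_nhdsWithin] with z hz
      simpa [sub_eq_zero] using hz
  have hconst : (fun _ : ℂ => g c) =o[𝓝[≠] c] fun z => (z - c)⁻¹ :=
    Asymptotics.isLittleO_const_left.2 (Or.inr hinv)
  refine Asymptotics.IsLittleO.sub ?_ hconst
  obtain ⟨R, hR, hRU⟩ := nhds_basis_ball.mem_iff.1 hU
  have hsmall : Tendsto (fun z : ℂ => ∫⁻ w in ball z (‖z - c‖ / 2), ‖g w‖ₑ ^ 2
      ∂(volume.restrict (U \ {c}))) (𝓝 c) (𝓝 0) := by
    refine tendsto_setLIntegral_zero hint ?_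
    have h0 : Tendsto (fun z : ℂ => volume (ball z (‖z - c‖ / 2))) (𝓝 c) (𝓝 0) := by
      simp only [Complex.volume_ball]
      have : Continuous fun z : ℂ => ENNReal.ofReal (‖z - c‖ / 2) ^ 2 * NNReal.pi := by
        refine ENNReal.continuous_mul_const (by simp) |>.comp ?_
        exact (ENNReal.continuous_pow 2).comp (ENNReal.continuous_ofReal.comp (by fun_prop))
      simpa using this.tendsto c
    refine tendsto_of_tendsto_of_tendsto_of_le_of_le tendsto_const_nhds h0 (fun _ => zero_le) ?_
    intro z
    exact Measure.restrict_apply_le _ _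
  rw [Asymptotics.isLittleO_iff]
  intro ε hε
  -- The constant π/4 is the area π (|z - c|/2)² of the disc divided by |z - c|².
  have hev := (hsmall.mono_left (nhdsWithin_le_nhds (s := {c}ᶜ))).eventually
    (gt_mem_nhds (show (0 : ENNReal) < ENNReal.ofReal (Real.pi / 4 * ε ^ 2) by
      rw [ENNReal.ofReal_pos]; positivity))
  filter_upwards [hev, self_mem_nhdsWithin, nhdsWithin_le_nhds (ball_mem_nhds c (half_pos hR))]
    with z hz hzc hzR
  have hzc' : z ≠ c := hzc
  have hpos : 0 < ‖z - c‖ := norm_pos_iff.2 (sub_ne_zero.2 hzc')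
  have hzR' : ‖z - c‖ < R / 2 := by simpa [dist_eq_norm] using hzR
  have hsub : closedBall z (‖z - c‖ / 2) ⊆ U \ {c} := by
    intro w hw
    rw [mem_closedBall, dist_eq_norm] at hw
    refine ⟨hRU ?_, ?_⟩
    · rw [mem_ball, dist_eq_norm]
      have : w - c = (w - z) + (z - c) := by ring
      rw [this]
      linarith [norm_add_le (w - z) (z - c)]
    · rintro rfl
      rw [norm_sub_rev] at hw
      linarith
  have h1 := volume_ball_mul_enorm_sq_le_one (g := g) (c := z) (r := ‖z - c‖ / 2)
    (fun w hw => hg w (hsub hw))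
  rw [Measure.restrict_restrict measurableSet_ball,
    inter_eq_left.2 (ball_subset_closedBall.trans hsub)] at hz
  have h2 := h1.trans_lt hz
  rw [Complex.volume_ball, ← ofReal_norm, ← ENNReal.ofReal_pow (by positivity),
    ← ENNReal.ofReal_pow (by positivity)] at h2
  have hpi : ((NNReal.pi : NNReal) : ENNReal) = ENNReal.ofReal Real.pi := by
    rw [← NNReal.coe_real_pi, ENNReal.ofReal_coe_nnreal]
  rw [hpi, ← ENNReal.ofReal_mul (by positivity), ← ENNReal.ofReal_mul (by positivity),
    ENNReal.ofReal_lt_ofReal_iff (by positivity)] at h2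
  rw [norm_inv]
  have h3 : (‖z - c‖ * ‖g z‖) ^ 2 < ε ^ 2 := by
    have : 0 < Real.pi / 4 := by positivity
    have h4 : Real.pi / 4 * (‖z - c‖ * ‖g z‖) ^ 2 < Real.pi / 4 * ε ^ 2 := by
      calc _ = (‖z - c‖ / 2) ^ 2 * Real.pi * ‖g z‖ ^ 2 := by ring
        _ < _ := h2
    exact lt_of_mul_lt_mul_left h4 this.le
  have h5 := abs_lt_of_sq_lt_sq h3 hε.le
  rw [abs_of_nonneg (by positivity)] at h5
  rw [← div_eq_mul_inv, le_div_iff₀ hpos]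
  linarith

/-- Square integrable holomorphic functions extend across a discrete set. -/
lemma exists_differentiableOn_extension {D A : Set ℂ} (hD : IsOpen D)
    (hA : ∀ t ∈ D, ∀ᶠ s in 𝓝[≠] t, s ∉ A) {g : ℂ → ℂ} (hg : ∀ t ∈ D \ A, AnalyticAt ℂ g t)
    (hint : ∫⁻ t in D \ A, ‖g t‖ₑ ^ 2 ≠ ⊤) :
    ∃ G : ℂ → ℂ, DifferentiableOn ℂ G D ∧ EqOn G g (D \ A) := by
  -- The extension is the punctured limit at every point, exceptional or not; where g is continuous
  -- this limit is its value.
  have hEq : ∀ t ∈ D \ A, limUnder (𝓝[≠] t) g = g t := fun t ht =>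
    ((hg t ht).continuousAt.tendsto.mono_left nhdsWithin_le_nhds).limUnder_eq
  refine ⟨fun t => limUnder (𝓝[≠] t) g, fun t ht => ?_, hEq⟩
  have h1 := hA t ht
  rw [eventually_nhdsWithin_iff] at h1
  obtain ⟨R, hR, hsub⟩ := nhds_basis_ball.mem_iff.1 (inter_mem (hD.mem_nhds ht) h1)
  have hsub' : ball t R \ {t} ⊆ D \ A := fun s hs => ⟨(hsub hs.1).1, (hsub hs.1).2 hs.2⟩
  have ho := isLittleO_of_lintegral_lt_top (ball_mem_nhds t hR) (fun z hz => hg z (hsub' hz))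
    (ne_top_of_le_ne_top hint (lintegral_mono_set hsub'))
  have hd := differentiableOn_update_limUnder_of_isLittleO (ball_mem_nhds t hR)
    (fun z hz => (hg z (hsub' hz)).differentiableAt.differentiableWithinAt) ho
  refine DifferentiableAt.differentiableWithinAt ?_
  refine (hd.differentiableAt (ball_mem_nhds t hR)).congr_of_eventuallyEq ?_
  filter_upwards [ball_mem_nhds t hR] with s hs
  rcases eq_or_ne s t with rfl | hst
  · simp
  · rw [Function.update_of_ne hst]
    exact hEq s (hsub' ⟨hs, hst⟩)

/-- Circle averages `z ↦ avg_θ h (z + r e^{iθ} v)` depend holomorphically on `z`. -/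
lemma analyticOnNhd_circleAverage {n : ℕ} {h : (Fin n → ℂ) → ℂ} {W O : Set (Fin n → ℂ)}
    (hW : IsOpen W) (hh : AnalyticOnNhd ℂ h O) {v : Fin n → ℂ} {r : ℝ}
    (hr : 0 ≤ r) (hmem : ∀ z ∈ W, ∀ t : ℂ, ‖t‖ = r → z + t • v ∈ O) :
    AnalyticOnNhd ℂ (fun z => Real.circleAverage (fun t => h (z + t • v)) 0 r) W := by
  refine analyticOnNhd_of_differentiableOn hW fun z₀ hz₀ => ?_
  obtain ⟨ε, hε, hεW⟩ := nhds_basis_closedBall.mem_iff.1 (hW.mem_nhds hz₀)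
  have hcn : ∀ θ, ‖circleMap 0 r θ‖ = r := fun θ => by simp [abs_of_nonneg hr]
  set K : Set (Fin n → ℂ) := (fun x : (Fin n → ℂ) × ℂ => x.1 + x.2 • v) ''
    (closedBall z₀ ε ×ˢ sphere (0 : ℂ) r)
  have hK : IsCompact K := ((isCompact_closedBall _ _).prod (isCompact_sphere _ _)).image
    (by fun_prop)
  have hKO : K ⊆ O := by
    rintro _ ⟨⟨z, t⟩, ⟨hz, ht⟩, rfl⟩
    exact hmem z (hεW hz) t (by simpa using ht)
  have hfd : ContinuousOn (fderiv ℂ h) O := hh.fderiv.continuousOn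
  obtain ⟨C, hC⟩ := hK.exists_bound_of_continuousOn (hfd.mono hKO)
  have hcont : ∀ z ∈ W, Continuous fun θ : ℝ => h (z + circleMap 0 r θ • v) := by
    intro z hz
    exact hh.continuousOn.comp_continuous (by fun_prop) fun θ => hmem z hz _ (hcn θ)
  have key := intervalIntegral.hasFDerivAt_integral_of_dominated_of_fderiv_le (𝕜 := ℂ)
    (μ := volume) (a := 0) (b := 2 * Real.pi) (bound := fun _ => C) (s := ball z₀ ε)
    (F := fun z θ => h (z + circleMap 0 r θ • v))
    (F' := fun z θ => fderiv ℂ h (z + circleMap 0 r θ • v)) (x₀ := z₀) (ball_mem_nhds _ hε)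
    (by
      filter_upwards [hW.mem_nhds hz₀] with z hz using (hcont z hz).aestronglyMeasurable)
    ((hcont z₀ hz₀).intervalIntegrable _ _)
    (Continuous.aestronglyMeasurable (hfd.comp_continuous (by fun_prop)
      fun θ => hmem z₀ hz₀ _ (hcn θ)))
    (ae_of_all _ fun θ _ z hz => hC _ ⟨(z, circleMap 0 r θ),
      ⟨ball_subset_closedBall hz, by simp [abs_of_nonneg hr]⟩, rfl⟩)
    (by simp)
    (ae_of_all _ fun θ _ z hz => by
      have h1 : DifferentiableAt ℂ h (z + circleMap 0 r θ • v) :=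
        (hh _ (hmem z (hεW (ball_subset_closedBall hz)) _ (hcn θ))).differentiableAt
      have h2 := h1.hasFDerivAt.comp z ((hasFDerivAt_id (𝕜 := ℂ) z).add_const (circleMap 0 r θ • v))
      rw [ContinuousLinearMap.comp_id] at h2
      exact h2)
  exact (key.differentiableAt.const_smul ((2 * Real.pi)⁻¹ : ℝ)).differentiableWithinAt

lemma measurable_indicator_of_continuousOn {α : Type*} [TopologicalSpace α] [MeasurableSpace α]
    [OpensMeasurableSpace α] {O : Set α} (hO : IsOpen O) {h : α → ℂ} (hh : ContinuousOn h O) :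
    Measurable (O.indicator h) := by
  classical
  rw [← Set.piecewise_eq_indicator]
  exact hh.measurable_piecewise continuousOn_const hO.measurableSet

/-- The extension is H z, the average of h over the circle z + r e^{iθ} v, which stays away from A;
it is holomorphic in z. By Fubini h is square integrable on almost every slice, so there the
one-variable result removes the isolated singularities and the mean value property gives H z = h z.
Continuity turns equality almost everywhere into equality off A. -/
lemma exists_analytic_extension_nhds {n : ℕ} {A Ω : Set (Fin n → ℂ)} (hΩA : IsOpen (Ω \ A))
    {p : Fin n → ℂ} (hΩp : Ω ∈ 𝓝 p) (hthin : IsThinIn A Ω) {h : (Fin n → ℂ) → ℂ}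
    (hh : AnalyticOnNhd ℂ h (Ω \ A))
    (hint : ∃ U ∈ 𝓝 p, ∫⁻ z in U ∩ (Ω \ A), ‖h z‖ₑ ^ 2 ≠ ⊤) :
    ∃ U ∈ 𝓝 p, ∃ H : (Fin n → ℂ) → ℂ, IsOpen U ∧ AnalyticOnNhd ℂ H U ∧
      EqOn H h (U ∩ (Ω \ A)) := by
  obtain ⟨f, hf, hne, hfA⟩ := hthin p (mem_of_mem_nhds hΩp)
  obtain ⟨U, hU, hintU⟩ := hint
  obtain ⟨ρ, hρ, hρs⟩ := nhds_basis_ball.mem_iff.1 (inter_mem (inter_mem hU hΩp) hfA)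
  set O : Set (Fin n → ℂ) := ball p ρ \ A with hOdef
  have hOsub : O ⊆ Ω \ A := fun z hz => ⟨(hρs hz.1).1.2, hz.2⟩
  have hO : IsOpen O := by
    have : O = ball p ρ ∩ (Ω \ A) := by
      ext z; exact ⟨fun hz => ⟨hz.1, hOsub hz⟩, fun hz => ⟨hz.1, hz.2.2⟩⟩
    rw [this]; exact isOpen_ball.inter hΩA
  have hhO := hh.mono hOsub
  have hintO : ∫⁻ z in O, ‖h z‖ₑ ^ 2 ≠ ⊤ := ne_top_of_le_ne_top hintU
    (lintegral_mono_set fun z hz => ⟨(hρs hz.1).1.1, hOsub hz⟩)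
  obtain ⟨v, r, δ, hr, hδ, h1, h2⟩ := exists_slice hf hne (ball_mem_nhds p hρ)
  have hcirc : ∀ z ∈ ball p δ, ∀ t : ℂ, ‖t‖ = r → z + t • v ∈ O := fun z hz t ht =>
    ⟨(h1 z hz t (by linarith)).1, fun hA => h2 z hz t ht ((hρs (h1 z hz t (by linarith)).1).2 hA)⟩
  set H : (Fin n → ℂ) → ℂ := fun z => Real.circleAverage (fun t => h (z + t • v)) 0 r with hH
  have hHa : AnalyticOnNhd ℂ H (ball p δ) :=
    analyticOnNhd_circleAverage isOpen_ball hhO hr.le hcirc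
  set h' := O.indicator h with hh'
  have hmeas : Measurable h' := measurable_indicator_of_continuousOn hO hhO.continuousOn
  have hint' : ∫⁻ z, ‖h' z‖ₑ ^ 2 ≠ ⊤ := by
    have : ∀ z, ‖h' z‖ₑ ^ 2 = O.indicator (fun z => ‖h z‖ₑ ^ 2) z := by
      intro z
      by_cases hz : z ∈ O <;> simp [hh', hz]
    simp only [this]
    rwa [lintegral_indicator hO.measurableSet]
  -- Tonelli: for fixed t the integral over z is translation invariant, hence independent of t, and
  -- t ranges over a disc of finite area.
  have hslice : ∀ᵐ z : Fin n → ℂ, ∫⁻ t in ball (0 : ℂ) (2 * r), ‖h' (z + t • v)‖ₑ ^ 2 ≠ ⊤ := by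
    have hm : Measurable fun x : (Fin n → ℂ) × ℂ => ‖h' (x.1 + x.2 • v)‖ₑ ^ 2 := by
      have : Measurable fun x : (Fin n → ℂ) × ℂ => h' (x.1 + x.2 • v) :=
        hmeas.comp (Continuous.measurable (by fun_prop))
      exact this.enorm.pow_const 2
    have hfin : ∫⁻ z : Fin n → ℂ, ∫⁻ t in ball (0 : ℂ) (2 * r), ‖h' (z + t • v)‖ₑ ^ 2 ≠ ⊤ := by
      rw [lintegral_lintegral_swap hm.aemeasurable]
      have : ∀ t : ℂ, ∫⁻ z : Fin n → ℂ, ‖h' (z + t • v)‖ₑ ^ 2 = ∫⁻ z, ‖h' z‖ₑ ^ 2 := fun t =>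
        lintegral_add_right_eq_self (fun z => ‖h' z‖ₑ ^ 2) (t • v)
      simp only [this, lintegral_const]
      refine ENNReal.mul_ne_top hint' ?_
      rw [Measure.restrict_apply_univ]
      exact measure_ball_lt_top.ne
    filter_upwards [ae_lt_top (hm.lintegral_prod_right' (ν := volume.restrict (ball (0 : ℂ) (2 * r)))) hfin] with z hz using hz.ne
  have hae : ∀ᵐ z ∂(volume.restrict (ball p δ ∩ O)), H z = h z := by
    filter_upwards [ae_restrict_of_ae hslice, ae_restrict_mem (isOpen_ball.inter hO).measurableSet]
      with z hz hzO
    set B : Set ℂ := {t | z + t • v ∈ A} with hB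
    have hDO : ∀ t ∈ ball (0 : ℂ) (2 * r) \ B, z + t • v ∈ O := fun t ht =>
      ⟨(h1 z hzO.1 t (mem_ball_zero_iff.1 ht.1).le).1, ht.2⟩
    obtain ⟨G, hG, hGe⟩ := exists_differentiableOn_extension (D := ball (0 : ℂ) (2 * r)) (A := B)
      (g := fun t => h (z + t • v)) isOpen_ball
      (by
        intro t ht
        have h3 := eventually_slice_ne_zero hr (fun t ht => (h1 z hzO.1 t ht).2)
          (h2 z hzO.1) (mem_ball_zero_iff.1 ht)
        filter_upwards [h3, nhdsWithin_le_nhds (isOpen_ball.mem_nhds ht)] with s hs hs2 hsB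
        exact hs ((hρs (h1 z hzO.1 s (mem_ball_zero_iff.1 hs2).le).1).2 hsB))
      (fun t ht => (hhO _ (hDO t ht)).comp_of_eq (f := fun t : ℂ => z + t • v) (by fun_prop) rfl)
      (by
        refine ne_top_of_le_ne_top hz ?_
        have hBm : IsOpen (ball (0 : ℂ) (2 * r) \ B) := by
          have : ball (0 : ℂ) (2 * r) \ B =
              ball (0 : ℂ) (2 * r) ∩ (fun t : ℂ => z + t • v) ⁻¹' O := by
            ext t
            exact ⟨fun ht => ⟨ht.1, hDO t ht⟩, fun ht => ⟨ht.1, ht.2.2⟩⟩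
          rw [this]
          exact isOpen_ball.inter (hO.preimage (by fun_prop))
        refine le_trans (le_of_eq ?_) (lintegral_mono_set (sdiff_subset (t := B)))
        refine setLIntegral_congr_fun hBm.measurableSet fun t ht => ?_
        simp only [hh', indicator_of_mem (hDO t ht)])
    have hr2 : closedBall (0 : ℂ) r ⊆ ball 0 (2 * r) := closedBall_subset_ball (by linarith)
    have hGc : Real.circleAverage G 0 r = G 0 := by
      have : DiffContOnCl ℂ G (ball 0 |r|) := by
        rw [abs_of_pos hr]
        exact (hG.mono (by rwa [closure_ball _ hr.ne'])).diffContOnCl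
      exact this.circleAverage
    have hH1 : H z = Real.circleAverage G 0 r := by
      refine Real.circleAverage_congr_sphere fun t ht => ?_
      rw [abs_of_pos hr] at ht
      have htn : ‖t‖ = r := by simpa using ht
      exact (hGe ⟨hr2 (sphere_subset_closedBall ht), (hcirc z hzO.1 t htn).2⟩).symm
    have h0 : G 0 = h z := by
      have := hGe (x := 0) ⟨by simpa using hr, by simpa [hB] using hzO.2.2⟩
      simpa using this
    rw [hH1, hGc, h0]
  have heq : EqOn H h (ball p δ ∩ O) := Measure.eqOn_open_of_ae_eq hae (isOpen_ball.inter hO)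
    (hHa.continuousOn.mono inter_subset_left) (hhO.continuousOn.mono inter_subset_right)
  refine ⟨ball p (min δ ρ), ball_mem_nhds _ (by positivity), H, isOpen_ball,
    hHa.mono (ball_subset_ball (min_le_left _ _)), fun z hz => heq ⟨?_, ?_, hz.2.2⟩⟩
  · exact ball_subset_ball (min_le_left _ _) hz.1
  · exact ball_subset_ball (min_le_right _ _) hz.1

/-- **Removable singularities**: a locally square integrable holomorphic function on the complement
of a closed thin set extends holomorphically. -/
theorem exists_analytic_extension {n : ℕ} {A Ω : Set (Fin n → ℂ)} (hΩ : IsOpen Ω)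
    (hΩA : IsOpen (Ω \ A)) (hthin : IsThinIn A Ω) {h : (Fin n → ℂ) → ℂ}
    (hh : AnalyticOnNhd ℂ h (Ω \ A))
    (hint : ∀ p ∈ Ω, ∃ U ∈ 𝓝 p, ∫⁻ z in U ∩ (Ω \ A), ‖h z‖ₑ ^ 2 ≠ ⊤) :
    ∃ H : (Fin n → ℂ) → ℂ, AnalyticOnNhd ℂ H Ω ∧ EqOn H h (Ω \ A) := by
  have hloc : ∀ p ∈ Ω, ∃ U ∈ 𝓝 p, ∃ H : (Fin n → ℂ) → ℂ, IsOpen U ∧ AnalyticOnNhd ℂ H U ∧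
      EqOn H h (U ∩ (Ω \ A)) := fun p hp =>
    exists_analytic_extension_nhds hΩA (hΩ.mem_nhds hp) hthin hh (hint p hp)
  choose! U hU H hUo hHa hHe using hloc
  refine ⟨fun p => H p p, fun p hp => ?_, fun p hp => hHe p hp.1 ⟨mem_of_mem_nhds (hU p hp.1), hp⟩⟩
  refine (hHa p hp p (mem_of_mem_nhds (hU p hp))).congr ?_
  filter_upwards [hU p hp, hΩ.mem_nhds hp] with q hqU hq
  have hc : ContinuousAt (fun z => H p z - H q z) q :=
    ((hHa p hp q hqU).continuousAt).sub (hHa q hq q (mem_of_mem_nhds (hU q hq))).continuousAt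
  -- Both local extensions equal h off A, and q is a limit of points off A.
  have hfr : ∃ᶠ z in 𝓝 q, H p z - H q z ∈ ({0} : Set ℂ) := by
    refine ((hthin.frequently_notMem hq).and_eventually (inter_mem (hΩ.mem_nhds hq)
      (inter_mem (hU q hq) ((hUo p hp).mem_nhds hqU)))).mono fun z hz => ?_
    obtain ⟨hzA, hzΩ, hzq, hzp⟩ := hz
    rw [hHe p hp ⟨hzp, hzΩ, hzA⟩, hHe q hq ⟨hzq, hzΩ, hzA⟩]
    simp
  have := isClosed_singleton.mem_of_frequently_of_tendsto hfr hc
  exact sub_eq_zero.1 this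

/-! ### The reproducing formula of the unit ball -/

/-- The squared Euclidean norm of `ℂⁿ`. -/
def nsq {n : ℕ} (z : Fin n → ℂ) : ℝ := ∑ i, ‖z i‖ ^ 2

/-- The Hermitian product `⟨w, z⟩ = ∑ wᵢ z̄ᵢ`. -/
def herm {n : ℕ} (w z : Fin n → ℂ) : ℂ := ∑ i, w i * (starRingEnd ℂ) (z i)

lemma nsq_nonneg {n : ℕ} (z : Fin n → ℂ) : 0 ≤ nsq z := Finset.sum_nonneg fun _ _ => by positivity

lemma mem_unitBall {n : ℕ} {z : Fin n → ℂ} : z ∈ unitBall n ↔ nsq z < 1 := Iff.rfl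

lemma continuous_nsq {n : ℕ} : Continuous (nsq : (Fin n → ℂ) → ℝ) := by
  unfold nsq; fun_prop

lemma continuous_herm {n : ℕ} (w : Fin n → ℂ) : Continuous (herm w) := by
  unfold herm; fun_prop

lemma isOpen_unitBall {n : ℕ} : IsOpen (unitBall n) :=
  isOpen_lt continuous_nsq continuous_const

lemma nsq_smul {n : ℕ} (t : ℂ) (z : Fin n → ℂ) : nsq (t • z) = ‖t‖ ^ 2 * nsq z := by
  simp [nsq, Finset.mul_sum, mul_pow]

lemma herm_smul_right {n : ℕ} (w : Fin n → ℂ) (t : ℂ) (z : Fin n → ℂ) :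
    herm w (t • z) = (starRingEnd ℂ) t * herm w z := by
  simp only [herm, Finset.mul_sum, Pi.smul_apply, smul_eq_mul, map_mul]
  exact Finset.sum_congr rfl fun _ _ => by ring

lemma norm_sq_le_nsq {n : ℕ} (z : Fin n → ℂ) : ‖z‖ ^ 2 ≤ nsq z := by
  have h : ‖z‖ ≤ Real.sqrt (nsq z) := by
    rw [pi_norm_le_iff_of_nonneg (Real.sqrt_nonneg _)]
    intro i
    refine Real.le_sqrt_of_sq_le ?_
    exact Finset.single_le_sum (f := fun i => ‖z i‖ ^ 2) (fun _ _ => by positivity)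
      (Finset.mem_univ i)
  calc ‖z‖ ^ 2 ≤ Real.sqrt (nsq z) ^ 2 := by gcongr
    _ = nsq z := Real.sq_sqrt (nsq_nonneg z)

lemma norm_herm_sq_le {n : ℕ} (w z : Fin n → ℂ) : ‖herm w z‖ ^ 2 ≤ nsq w * nsq z := by
  calc ‖herm w z‖ ^ 2 ≤ (∑ i, ‖w i‖ * ‖z i‖) ^ 2 := by
        gcongr
        refine (norm_sum_le _ _).trans (le_of_eq ?_)
        simp
    _ ≤ _ := Finset.sum_mul_sq_le_sq_mul_sq _ _ _

lemma norm_herm_lt_one {n : ℕ} {w z : Fin n → ℂ} (hw : w ∈ unitBall n) (hz : z ∈ unitBall n) :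
    ‖herm w z‖ < 1 := by
  have h := norm_herm_sq_le w z
  have hw' := mem_unitBall.1 hw
  have hz' := mem_unitBall.1 hz
  have : ‖herm w z‖ ^ 2 < 1 := h.trans_lt (by nlinarith [nsq_nonneg w, nsq_nonneg z])
  nlinarith [norm_nonneg (herm w z)]

lemma smul_mem_unitBall {n : ℕ} {t : ℂ} (ht : ‖t‖ ≤ 1) {z : Fin n → ℂ} (hz : z ∈ unitBall n) :
    t • z ∈ unitBall n := by
  rw [mem_unitBall, nsq_smul]
  have := mem_unitBall.1 hz
  have h1 : ‖t‖ ^ 2 ≤ 1 := pow_le_one₀ (norm_nonneg _) ht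
  nlinarith [nsq_nonneg z]

lemma unitBall_subset_closedBall {n : ℕ} : unitBall n ⊆ closedBall 0 1 := by
  intro z hz
  rw [mem_closedBall_zero_iff]
  have := (norm_sq_le_nsq z).trans (mem_unitBall.1 hz).le
  nlinarith [norm_nonneg z]

lemma volume_unitBall_lt_top {n : ℕ} : volume (unitBall n) < ⊤ :=
  (measure_mono unitBall_subset_closedBall).trans_lt measure_closedBall_lt_top

/-! #### Taylor coefficients as circle averages -/

/-- By uniqueness of power series, q is the Cauchy series of g for every radius below R: a radius
above 1 gives convergence at 1, the radius 1 gives the coefficients as averages over the unit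
circle. -/
lemma hasSum_and_circleAverage {g : ℂ → ℂ} {q : FormalMultilinearSeries ℂ ℂ ℂ}
    (hq : HasFPowerSeriesAt g q 0) {R : ℝ} (hR : 1 < R) (hg : DifferentiableOn ℂ g (ball 0 R)) :
    HasSum (fun d => q d fun _ => 1) (g 1) ∧
      ∀ d, Real.circleAverage (fun t => (t⁻¹) ^ d * g t) 0 1 = q d fun _ => 1 := by
  have key : ∀ r : NNReal, 0 < r → (r : ℝ) < R →
      HasFPowerSeriesOnBall g q 0 r ∧ cauchyPowerSeries g 0 r = q := by
    intro r hr hrR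
    have hd : DiffContOnCl ℂ g (ball 0 r) := by
      refine (hg.mono ?_).diffContOnCl
      rw [closure_ball _ (by exact_mod_cast hr.ne')]
      exact closedBall_subset_ball hrR
    have h1 := hd.hasFPowerSeriesOnBall hr
    have h2 := h1.hasFPowerSeriesAt.eq_formalMultilinearSeries hq
    exact ⟨h2 ▸ h1, h2⟩
  constructor
  · obtain ⟨r, hr1, hr2⟩ := exists_between hR
    lift r to NNReal using by linarith
    have hr1' : 1 < r := by exact_mod_cast hr1
    have := ((key r (by positivity) hr2).1.hasSum (y := 1) (by
      rw [mem_eball_zero_iff]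
      simpa using hr1'))
    simpa using this
  · intro d
    have h1 := (key 1 one_pos (by simpa using hR)).2
    have h2 := cauchyPowerSeries_apply g 0 1 d 1
    simp only [NNReal.coe_one] at h1
    rw [h1] at h2
    rw [h2, Real.circleAverage_eq_circleIntegral one_ne_zero]
    simp only [sub_zero, smul_eq_mul, one_div]
    congr 2
    ext t
    ring

lemma circleAverage_inv (f : ℂ → ℂ) :
    Real.circleAverage (fun t => f t⁻¹) 0 1 = Real.circleAverage f 0 1 := by
  simp only [Real.circleAverage_def]
  congr 1
  have h := intervalIntegral.integral_comp_sub_left (a := 0) (b := 2 * Real.pi)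
    (fun θ => f (circleMap 0 1 θ)) (2 * Real.pi)
  simp only [sub_self, sub_zero] at h
  rw [← h]
  congr 1
  ext θ
  congr 1
  simp only [circleMap, ofReal_one, one_mul, zero_add, ofReal_sub, sub_mul, exp_sub]
  simp [exp_two_pi_mul_I]

/-- After t ↦ t⁻¹ this extracts the d-th Taylor coefficient of t ↦ exp (t a). -/
lemma circleAverage_pow_mul_exp (a : ℂ) (d : ℕ) :
    Real.circleAverage (fun t => t ^ d * exp (t⁻¹ * a)) 0 1 = a ^ d / d.factorial := by
  have h0 : HasFPowerSeriesAt (NormedSpace.exp : ℂ → ℂ) (NormedSpace.expSeries ℂ ℂ)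
      ((a • ContinuousLinearMap.id ℂ ℂ : ℂ →L[ℂ] ℂ) 0) := by
    rw [map_zero]; exact NormedSpace.exp_hasFPowerSeriesAt_zero
  have h1 := h0.compContinuousLinearMap
  have h2 := (hasSum_and_circleAverage h1 (R := 2) one_lt_two (by
    rw [← Complex.exp_eq_exp_ℂ]
    refine Differentiable.differentiableOn (Differentiable.comp Complex.differentiable_exp ?_)
    exact (a • ContinuousLinearMap.id ℂ ℂ).differentiable)).2 d
  rw [← circleAverage_inv] at h2
  rw [← Complex.exp_eq_exp_ℂ, FormalMultilinearSeries.compContinuousLinearMap_apply] at h2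
  have h3 : ((a • ContinuousLinearMap.id ℂ ℂ : ℂ →L[ℂ] ℂ) ∘ fun _ : Fin d => (1 : ℂ)) =
      fun _ => a := by ext; simp
  rw [h3, NormedSpace.expSeries_apply_eq] at h2
  rw [div_eq_inv_mul, ← smul_eq_mul, ← h2]
  congr 1
  ext t
  simp [mul_comm]

/-! #### Gaussian integrals -/

lemma integrable_exp_neg_half_nsq {n : ℕ} :
    Integrable (fun z : Fin n → ℂ => Real.exp (-(nsq z / 2))) := by
  have h1 : Integrable (fun z : ℂ => Real.exp (-(1 / 2) * ‖z‖ ^ 2)) := by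
    -- A non-integrable function would have integral 0, whereas the Gaussian formula gives a
    -- positive value.
    by_contra hcon
    have h2 := GaussianFourier.integral_rexp_neg_mul_sq_norm (V := ℂ) (b := 1 / 2) (by norm_num)
    rw [integral_undef hcon] at h2
    have : 0 < (Real.pi / (1 / 2)) ^ ((Module.finrank ℝ ℂ : ℝ) / 2) := by positivity
    linarith
  have h3 := Integrable.fintype_prod (ι := Fin n) (μ := fun _ => (volume : Measure ℂ))
    (f := fun _ z => Real.exp (-(1 / 2) * ‖z‖ ^ 2)) fun _ => h1
  refine h3.congr (ae_of_all _ fun z => ?_)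
  simp only [← Real.exp_sum, nsq]
  congr 1
  rw [← Finset.mul_sum]
  ring

lemma integral_exp_neg_nsq {n : ℕ} :
    ∫ z : Fin n → ℂ, ((Real.exp (-nsq z) : ℝ) : ℂ) = (Real.pi : ℂ) ^ n := by
  have h2 := GaussianFourier.integral_rexp_neg_mul_sq_norm (V := ℂ) (b := 1) (by norm_num)
  simp only [Complex.finrank_real_complex, div_one] at h2
  have h3 := integral_fintype_prod_volume_eq_prod (ι := Fin n) (E := fun _ => ℂ)
    (f := fun _ z => Real.exp (-1 * ‖z‖ ^ 2))
  rw [h2] at h3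
  rw [integral_complex_ofReal]
  norm_cast
  have : ∀ z : Fin n → ℂ, Real.exp (-nsq z) = ∏ i, Real.exp (-1 * ‖z i‖ ^ 2) := by
    intro z
    rw [← Real.exp_sum, nsq]
    congr 1
    rw [← Finset.mul_sum]
    ring
  simp only [this, h3]
  simp

lemma integrable_mul_exp_neg_nsq {n : ℕ} {G : (Fin n → ℂ) → ℂ} (hG : Continuous G) {C c : ℝ}
    (hb : ∀ z, ‖G z‖ ≤ C * Real.exp (c * ‖z‖)) :
    Integrable (fun z => G z * ((Real.exp (-nsq z) : ℝ) : ℂ)) := by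
  -- From c‖z‖ ≤ c²/2 + ‖z‖²/2: half of the Gaussian exponent absorbs the exponential growth.
  refine Integrable.mono' ((integrable_exp_neg_half_nsq (n := n)).const_mul
    (C * Real.exp (c ^ 2 / 2))) ?_ (ae_of_all _ fun z => ?_)
  · refine Continuous.aestronglyMeasurable ?_
    exact hG.mul (continuous_ofReal.comp (Real.continuous_exp.comp continuous_nsq.neg))
  · have hC : 0 ≤ C := by
      have := (norm_nonneg _).trans (hb z)
      exact nonneg_of_mul_nonneg_left this (Real.exp_pos _)
    rw [norm_mul, Complex.norm_real, Real.norm_of_nonneg (Real.exp_pos _).le]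
    calc ‖G z‖ * Real.exp (-nsq z) ≤ C * Real.exp (c * ‖z‖) * Real.exp (-nsq z) := by
          gcongr; exact hb z
      _ = C * Real.exp (c * ‖z‖ - nsq z) := by rw [mul_assoc, ← Real.exp_add]; ring_nf
      _ ≤ C * Real.exp (c ^ 2 / 2 + -(nsq z / 2)) := by
          gcongr
          have := norm_sq_le_nsq z
          nlinarith [sq_nonneg (c - ‖z‖)]
      _ = _ := by rw [Real.exp_add]; ring

/-- The mean value property for the rotation invariant Gaussian weight, whose total mass is πⁿ. -/
lemma integral_mul_exp_neg_nsq {n : ℕ} {G : (Fin n → ℂ) → ℂ} (hG : AnalyticOnNhd ℂ G univ)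
    {C c : ℝ} (hb : ∀ z, ‖G z‖ ≤ C * Real.exp (c * ‖z‖)) :
    ∫ z, G z * ((Real.exp (-nsq z) : ℝ) : ℂ) = (Real.pi : ℂ) ^ n * G 0 := by
  have hc : Continuous G := by simpa using continuousOn_univ.1 hG.continuousOn
  rw [integral_eq_integral_circleAverage (fun u hu => measurePreserving_smul hu)
    (integrable_mul_exp_neg_nsq hc hb), ← integral_exp_neg_nsq, mul_comm, ← integral_const_mul]
  refine integral_congr_ae (ae_of_all _ fun z => ?_)
  have h1 : Real.circleAverage (fun t : ℂ => G (t • z) * ((Real.exp (-nsq (t • z)) : ℝ) : ℂ)) 0 1 =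
      Real.circleAverage (((Real.exp (-nsq z) : ℝ) : ℂ) • fun t : ℂ => G (t • z)) 0 1 := by
    refine Real.circleAverage_congr_sphere fun t ht => ?_
    have : ‖t‖ = 1 := by simpa using ht
    simp [nsq_smul, this, mul_comm]
  simp only [h1]
  rw [Real.circleAverage_smul, circleAverage_smul_eq fun t _ => hG _ (mem_univ _)]
  simp [mul_comm]

lemma herm_conj_symm {n : ℕ} (w z : Fin n → ℂ) : herm z w = (starRingEnd ℂ) (herm w z) := by
  simp [herm, mul_comm]

lemma nsq_sub {n : ℕ} (z w : Fin n → ℂ) :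
    ((nsq (z - w) : ℝ) : ℂ) = nsq z - herm z w - herm w z + nsq w := by
  simp only [nsq, herm, ofReal_sum, ← Finset.sum_sub_distrib, ← Finset.sum_add_distrib]
  refine Finset.sum_congr rfl fun i _ => ?_
  simp only [ofReal_pow, ← Complex.mul_conj', Pi.sub_apply, map_sub]
  ring

lemma norm_herm_le {n : ℕ} (w : Fin n → ℂ) : ∃ c : ℝ, 0 ≤ c ∧ ∀ z, ‖herm w z‖ ≤ c * ‖z‖ := by
  refine ⟨∑ i, ‖w i‖, by positivity, fun z => ?_⟩
  rw [Finset.sum_mul]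
  refine (norm_sum_le _ _).trans (Finset.sum_le_sum fun i _ => ?_)
  rw [norm_mul, RCLike.norm_conj]
  gcongr
  exact norm_le_pi_norm z i

/-- The reproducing property of the Fock space, for functions of polynomial growth. -/
lemma integral_mul_exp_herm {n : ℕ} {p : (Fin n → ℂ) → ℂ} (hp : AnalyticOnNhd ℂ p univ) {d : ℕ}
    {C : ℝ} (hC : 0 ≤ C) (hb : ∀ z, ‖p z‖ ≤ C * ‖z‖ ^ d) (w : Fin n → ℂ) :
    Integrable (fun z => p z * exp (herm w z) * ((Real.exp (-nsq z) : ℝ) : ℂ)) ∧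
    ∫ z, p z * exp (herm w z) * ((Real.exp (-nsq z) : ℝ) : ℂ) = (Real.pi : ℂ) ^ n * p w := by
  have hpc : Continuous p := continuousOn_univ.1 hp.continuousOn
  have hb' : ∀ z, ‖p z‖ ≤ C * d.factorial * Real.exp ‖z‖ := by
    intro z
    have := Real.pow_div_factorial_le_exp ‖z‖ (norm_nonneg z) d
    rw [div_le_iff₀ (by positivity)] at this
    calc ‖p z‖ ≤ C * ‖z‖ ^ d := hb z
      _ ≤ C * (Real.exp ‖z‖ * d.factorial) := by gcongr
      _ = _ := by ring
  obtain ⟨c, hc, hcb⟩ := norm_herm_le w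
  constructor
  · refine integrable_mul_exp_neg_nsq (C := C * d.factorial) (c := 1 + c)
      (hpc.mul (Complex.continuous_exp.comp (continuous_herm w))) fun z => ?_
    rw [norm_mul]
    calc ‖p z‖ * ‖exp (herm w z)‖ ≤ (C * d.factorial * Real.exp ‖z‖) * Real.exp (c * ‖z‖) := by
          gcongr
          · exact hb' z
          · rw [Complex.norm_exp]
            gcongr
            exact (Complex.re_le_norm _).trans (hcb z)
      _ = _ := by rw [mul_assoc, ← Real.exp_add]; ring_nf
  -- Completing the square: ⟨w, z+w⟩ - |z+w|² = -⟨z,w⟩ - |z|², so after translation by w the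
  -- integrand is a function holomorphic in z times the Gaussian, and its value at 0 is p w.
  · rw [← integral_add_right_eq_self _ w]
    have hG : AnalyticOnNhd ℂ (fun z => p (z + w) * exp (-herm z w)) univ := by
      intro z _
      have h1 : AnalyticAt ℂ (fun z => p (z + w)) z :=
        (hp (z + w) (mem_univ _)).comp_of_eq (f := fun z => z + w) (by fun_prop) rfl
      refine h1.mul (AnalyticAt.cexp (AnalyticAt.neg ?_))
      unfold herm
      refine Finset.analyticAt_fun_sum _ fun i _ => ?_
      exact ((ContinuousLinearMap.proj (R := ℂ) (φ := fun _ : Fin n => ℂ) i).analyticAt z).mul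
        analyticAt_const
    have h3 := integral_mul_exp_neg_nsq hG (C := C * d.factorial * Real.exp ‖w‖) (c := 1 + c)
      fun z => by
        rw [norm_mul]
        calc ‖p (z + w)‖ * ‖exp (-herm z w)‖ ≤
            (C * d.factorial * Real.exp (‖z‖ + ‖w‖)) * Real.exp (c * ‖z‖) := by
              gcongr
              · refine (hb' _).trans ?_
                gcongr
                exact norm_add_le _ _
              · rw [Complex.norm_exp]
                gcongr
                refine (Complex.re_le_norm _).trans ?_
                rw [norm_neg, herm_conj_symm w z, RCLike.norm_conj]
                exact hcb z
          _ = _ := by rw [Real.exp_add]; rw [add_mul, Real.exp_add]; ring_nf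
    have h0 : herm (0 : Fin n → ℂ) w = 0 := by simp [herm]
    simp only [zero_add, h0, neg_zero, exp_zero, mul_one] at h3
    rw [← h3]
    refine integral_congr_ae (ae_of_all _ fun z => ?_)
    simp only [ofReal_exp, mul_assoc, ← Complex.exp_add]
    congr 2
    have h4 := nsq_sub (z + w) w
    rw [add_sub_cancel_right] at h4
    have h5 : herm (z + w) w = herm z w + nsq w := by
      simp only [herm, nsq, Pi.add_apply, add_mul, Finset.sum_add_distrib, Complex.mul_conj', ofReal_sum,
        ofReal_pow]
    rw [ofReal_neg, ofReal_neg, h4, h5]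
    ring

/-- Averaging p(z) exp⟨w,z⟩ over rotations keeps only the term ⟨w,z⟩^d / d! of the exponential,
because p is homogeneous of degree d. -/
lemma integral_homogeneous_mul_herm_pow {n : ℕ} {p : (Fin n → ℂ) → ℂ}
    (hp : AnalyticOnNhd ℂ p univ) {d : ℕ} {C : ℝ} (hC : 0 ≤ C) (hb : ∀ z, ‖p z‖ ≤ C * ‖z‖ ^ d)
    (hhom : ∀ (t : ℂ) z, p (t • z) = t ^ d * p z) (w : Fin n → ℂ) :
    ∫ z, p z * herm w z ^ d * ((Real.exp (-nsq z) : ℝ) : ℂ) =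
      d.factorial * ((Real.pi : ℂ) ^ n * p w) := by
  obtain ⟨h1, h2⟩ := integral_mul_exp_herm hp hC hb w
  rw [← h2, integral_eq_integral_circleAverage (fun u hu => measurePreserving_smul hu) h1,
    ← integral_const_mul]
  refine integral_congr_ae (ae_of_all _ fun z => ?_)
  have h3 : Real.circleAverage (fun t : ℂ => p (t • z) * exp (herm w (t • z)) *
      ((Real.exp (-nsq (t • z)) : ℝ) : ℂ)) 0 1 =
      Real.circleAverage ((p z * ((Real.exp (-nsq z) : ℝ) : ℂ)) • fun t : ℂ =>
        t ^ d * exp (t⁻¹ * herm w z)) 0 1 := by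
    refine Real.circleAverage_congr_sphere fun t ht => ?_
    have ht1 : ‖t‖ = 1 := by simpa using ht
    have ht2 : (starRingEnd ℂ) t = t⁻¹ := by rw [Complex.inv_def, Complex.normSq_eq_norm_sq, ht1]; simp
    simp only [hhom, herm_smul_right, ht2, nsq_smul, ht1, Pi.smul_apply, smul_eq_mul]
    ring_nf
  simp only [h3]
  rw [Real.circleAverage_smul, circleAverage_pow_mul_exp]
  have : (d.factorial : ℂ) ≠ 0 := by exact_mod_cast d.factorial_ne_zero
  simp only [smul_eq_mul]
  field_simp

lemma integral_exp_neg_mul_pow (k : ℕ) :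
    ∫ s in Ioi (0 : ℝ), Real.exp (-s) * s ^ k = k.factorial := by
  have h := Real.Gamma_eq_integral (s := k + 1) (by positivity)
  rw [Real.Gamma_nat_eq_factorial] at h
  rw [h]
  refine setIntegral_congr_fun measurableSet_Ioi fun s _ => ?_
  simp

open scoped Pointwise in
-- Dilation by √s: the volume contributes sⁿ, since the real dimension is 2n, and the homogeneity
-- contributes s^d.
lemma setIntegral_nsq_lt {n : ℕ} {F : (Fin n → ℂ) → ℂ} {d : ℕ}
    (hF : ∀ (s : ℝ) z, 0 ≤ s → F (s • z) = (s : ℂ) ^ (2 * d) * F z) {s : ℝ} (hs : 0 < s) :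
    ∫ z in {z | nsq z < s}, F z = (s : ℂ) ^ (n + d) * ∫ z in unitBall n, F z := by
  have hr : 0 < Real.sqrt s := Real.sqrt_pos.2 hs
  have h1 := Measure.setIntegral_comp_smul_of_pos (volume : Measure (Fin n → ℂ)) F (unitBall n) hr
  have h2 : Real.sqrt s • unitBall n = {z : Fin n → ℂ | nsq z < s} := by
    ext z
    rw [mem_smul_set_iff_inv_smul_mem₀ hr.ne', mem_unitBall]
    have h3 : (Real.sqrt s)⁻¹ • z = (((Real.sqrt s)⁻¹ : ℝ) : ℂ) • z := by ext; simp
    rw [h3, nsq_smul, Complex.norm_real, Real.norm_of_nonneg (by positivity), inv_pow,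
      Real.sq_sqrt hs.le, inv_mul_lt_iff₀ hs, mul_one]
    rfl
  have h4 : Module.finrank ℝ (Fin n → ℂ) = 2 * n := by simp [Module.finrank_pi_fintype, mul_comm]
  have hsq : ((Real.sqrt s : ℝ) : ℂ) ^ 2 = s := by
    rw [← ofReal_pow, Real.sq_sqrt hs.le]
  rw [h2, h4] at h1
  simp only [fun z => hF (Real.sqrt s) z hr.le] at h1
  rw [integral_const_mul, pow_mul, hsq, pow_mul, Real.sq_sqrt hs.le] at h1
  rw [pow_add, mul_assoc, h1, Complex.real_smul, ofReal_inv, ofReal_pow, mul_inv_cancel_left₀]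
  exact pow_ne_zero _ (by exact_mod_cast hs.ne')

/-- Passage from Gaussian integrals to the ball: write e^{-|z|²} as the integral of e^{-s} over s >
|z|² and exchange. The integral over |z|² < s scales like s^{n+d}, which leaves the Gamma integral
(n+d)!. -/
lemma integral_homogeneous_eq {n : ℕ} {F : (Fin n → ℂ) → ℂ} {d : ℕ} (hFc : Continuous F)
    (hF : ∀ (s : ℝ) z, 0 ≤ s → F (s • z) = (s : ℂ) ^ (2 * d) * F z)
    (hint : Integrable (fun z => F z * ((Real.exp (-nsq z) : ℝ) : ℂ))) :
    ∫ z, F z * ((Real.exp (-nsq z) : ℝ) : ℂ) =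
      ((n + d).factorial : ℂ) * ∫ z in unitBall n, F z := by
  set Φ : (Fin n → ℂ) × ℝ → ℂ := fun x =>
    {x : (Fin n → ℂ) × ℝ | nsq x.1 < x.2}.indicator
      (fun x => F x.1 * ((Real.exp (-x.2) : ℝ) : ℂ)) x with hΦ
  have hinner : ∀ z : Fin n → ℂ, ∀ f : ℝ → ℂ, (fun s => Φ (z, s)) =
      (Ioi (nsq z)).indicator (fun s => F z * ((Real.exp (-s) : ℝ) : ℂ)) := by
    intro z _
    ext s
    by_cases h : nsq z < s <;> simp [hΦ, h]
  have hexp : ∀ a : ℝ, IntegrableOn (fun s => ((Real.exp (-s) : ℝ) : ℂ)) (Ioi a) := fun a =>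
    (integrableOn_exp_neg_Ioi a).ofReal
  have hmeas : AEStronglyMeasurable Φ (volume.prod volume) := by
    refine (Measurable.indicator ?_ ?_).aestronglyMeasurable
    · refine (Continuous.measurable ?_)
      fun_prop
    · exact measurableSet_lt (continuous_nsq.comp continuous_fst).measurable measurable_snd
  have hΦint : Integrable Φ (volume.prod volume) := by
    rw [integrable_prod_iff hmeas]
    refine ⟨ae_of_all _ fun z => ?_, ?_⟩
    · rw [hinner z fun _ => 0]
      exact (integrable_indicator_iff measurableSet_Ioi).2 ((hexp _).const_mul _)
    · refine hint.norm.congr (ae_of_all _ fun z => ?_)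
      have : (fun s => ‖Φ (z, s)‖) =
          (Ioi (nsq z)).indicator (fun s => ‖F z‖ * Real.exp (-s)) := by
        ext s
        by_cases h : nsq z < s <;> simp [hΦ, h, Complex.norm_exp]
      simp only [this]
      rw [integral_indicator measurableSet_Ioi, integral_const_mul, integral_exp_neg_Ioi, norm_mul,
        Complex.norm_real, Real.norm_of_nonneg (Real.exp_pos _).le]
  have h1 : ∫ z, F z * ((Real.exp (-nsq z) : ℝ) : ℂ) = ∫ z, ∫ s, Φ (z, s) := by
    refine integral_congr_ae (ae_of_all _ fun z => ?_)
    simp only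
    rw [hinner z fun _ => 0, integral_indicator measurableSet_Ioi, integral_const_mul,
      integral_complex_ofReal, integral_exp_neg_Ioi]
  have h2 : ∀ s : ℝ, ∫ z, Φ (z, s) =
      (Ioi (0 : ℝ)).indicator (fun s => ((Real.exp (-s) * s ^ (n + d) : ℝ) : ℂ) *
        ∫ z in unitBall n, F z) s := by
    intro s
    have h3 : (fun z => Φ (z, s)) =
        {z | nsq z < s}.indicator (fun z => F z * ((Real.exp (-s) : ℝ) : ℂ)) := by
      ext z
      by_cases h : nsq z < s <;> simp [hΦ, h]
    rw [h3, integral_indicator (measurableSet_lt continuous_nsq.measurable measurable_const),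
      integral_mul_const]
    rcases le_or_gt s 0 with hs | hs
    · have : {z : Fin n → ℂ | nsq z < s} = ∅ := by
        ext z; simpa using hs.trans (nsq_nonneg z)
      simp [this, hs]
    · rw [indicator_of_mem (mem_Ioi.2 hs), setIntegral_nsq_lt hF hs]
      push_cast
      ring
  rw [h1, integral_integral_swap hΦint]
  simp only [h2]
  rw [integral_indicator measurableSet_Ioi, integral_mul_const, integral_complex_ofReal,
    integral_exp_neg_mul_pow]
  simp

lemma integrable_of_lintegral_enorm_sq {α : Type*} [MeasurableSpace α] {μ : Measure α}
    [IsFiniteMeasure μ] {h : α → ℂ} (hm : AEStronglyMeasurable h μ)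
    (hint : ∫⁻ z, ‖h z‖ₑ ^ 2 ∂μ < ⊤) : Integrable h μ := by
  have : MemLp h 2 μ := by
    refine ⟨hm, ?_⟩
    rw [eLpNorm_lt_top_iff_lintegral_rpow_enorm_lt_top (by norm_num) (by norm_num)]
    simpa using hint
  exact this.integrable (by norm_num)

lemma factorial_identity (n d : ℕ) (c : ℂ) :
    ((d + n).choose n : ℂ) * (((n + d).factorial : ℂ)⁻¹ * (d.factorial * c)) =
      (n.factorial : ℂ)⁻¹ * c := by
  have h := Nat.add_choose_mul_factorial_mul_factorial d n
  have h1 : ((d + n).choose n : ℂ) * d.factorial * n.factorial = (n + d).factorial := by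
    rw [add_comm n d, ← h, ← Nat.choose_symm_add]
    push_cast
    ring
  have h2 : ((n + d).factorial : ℂ) ≠ 0 := by exact_mod_cast (n + d).factorial_ne_zero
  have h3 : (n.factorial : ℂ) ≠ 0 := by exact_mod_cast n.factorial_ne_zero
  field_simp
  rw [← h1]
  ring

/-- The reproducing formula of the Bergman space of the unit ball. -/
theorem integral_mul_ballKernel {n : ℕ} {h : (Fin n → ℂ) → ℂ}
    (hh : AnalyticOnNhd ℂ h (unitBall n)) (hint : ∫⁻ z in unitBall n, ‖h z‖ₑ ^ 2 < ⊤)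
    {w : Fin n → ℂ} (hw : w ∈ unitBall n) :
    ∫ z in unitBall n, h z * (1 / (1 - herm w z) ^ (n + 1)) =
      (Real.pi : ℂ) ^ n / n.factorial * h w := by
  have h0 : (0 : Fin n → ℂ) ∈ unitBall n := by simp [mem_unitBall, nsq]
  obtain ⟨p, hp⟩ := hh 0 h0
  set P : ℕ → (Fin n → ℂ) → ℂ := fun d z => p d fun _ => z with hP
  have hPhom : ∀ d (t : ℂ) z, P d (t • z) = t ^ d * P d z := by
    intro d t z
    simp only [hP]
    rw [(p d).map_smul_univ (fun _ => t) (fun _ => z)]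
    simp
  have hPb : ∀ d z, ‖P d z‖ ≤ ‖p d‖ * ‖z‖ ^ d := fun d z => by
    have := (p d).le_opNorm fun _ => z
    simpa using this
  have hPa : ∀ d, AnalyticOnNhd ℂ (P d) univ := by
    intro d
    refine analyticOnNhd_of_differentiableOn isOpen_univ fun z _ => ?_
    have h1 : DifferentiableAt ℂ (p d) fun _ => z := ((p d).contDiff (n := 1)).differentiable (by simp) _
    have h2 : Differentiable ℂ (fun (z : Fin n → ℂ) (_ : Fin d) => z) := by fun_prop
    exact (DifferentiableAt.comp z h1 (h2 z)).differentiableWithinAt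
  -- On the complex line through z the series of homogeneous parts is the one-variable Taylor series
  -- of t ↦ h (t z), which converges past t = 1 because the ball is open.
  have hslice : ∀ z ∈ unitBall n, HasSum (fun d => P d z) (h z) ∧
      ∀ d, Real.circleAverage (fun t : ℂ => (t⁻¹) ^ d * h (t • z)) 0 1 = P d z := by
    intro z hz
    have hz1 := mem_unitBall.1 hz
    obtain ⟨R, hR, hRz⟩ : ∃ R : ℝ, 1 < R ∧ ∀ t : ℂ, ‖t‖ < R → t • z ∈ unitBall n := by
      have hcont : ContinuousAt (fun r : ℝ => r ^ 2 * nsq z) 1 := by fun_prop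
      have hev : ∀ᶠ r in 𝓝 (1 : ℝ), r ^ 2 * nsq z < 1 :=
        hcont.eventually (gt_mem_nhds (by simpa using hz1))
      obtain ⟨ε, hε, hεs⟩ := Metric.eventually_nhds_iff_ball.1 hev
      refine ⟨1 + ε / 2, by linarith, fun t ht => ?_⟩
      rw [mem_unitBall, nsq_smul]
      refine lt_of_le_of_lt ?_ (hεs (1 + ε / 2) (by simp [dist_eq_norm, abs_of_pos hε]; linarith))
      gcongr
      exact nsq_nonneg z
    have hq : HasFPowerSeriesAt h p ((ContinuousLinearMap.toSpanSingleton ℂ z : ℂ →L[ℂ] _) 0) := by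
      rw [map_zero]; exact hp
    have hq1 := hq.compContinuousLinearMap
    have h1 := hasSum_and_circleAverage hq1 hR (by
      intro t ht
      have h2 : DifferentiableAt ℂ h (t • z) :=
        (hh _ (hRz t (by simpa using ht))).differentiableAt
      exact (DifferentiableAt.comp t (f := fun t : ℂ => t • z) h2 (by fun_prop)).differentiableWithinAt)
    have h3 : ∀ d, (p.compContinuousLinearMap (ContinuousLinearMap.toSpanSingleton ℂ z) d)
        (fun _ => 1) = P d z := by
      intro d
      rw [FormalMultilinearSeries.compContinuousLinearMap_apply]
      simp only [hP]
      congr 1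
      ext; simp
    simp only [h3] at h1
    simpa using h1
  set ν : Measure (Fin n → ℂ) := volume.restrict (unitBall n) with hν
  have : IsFiniteMeasure ν := ⟨by simpa [hν] using volume_unitBall_lt_top⟩
  have hmball : MeasurableSet (unitBall n) := isOpen_unitBall.measurableSet
  have hhm : AEStronglyMeasurable h ν := hh.continuousOn.aestronglyMeasurable hmball
  have hhi : Integrable h ν := integrable_of_lintegral_enorm_sq hhm hint
  obtain ⟨ρ, hρ0, hρ1, hρ⟩ : ∃ ρ : ℝ, 0 ≤ ρ ∧ ρ < 1 ∧ ∀ z ∈ unitBall n, ‖herm w z‖ ≤ ρ := by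
    refine ⟨Real.sqrt (nsq w), Real.sqrt_nonneg _, ?_, fun z hz => ?_⟩
    · rw [Real.sqrt_lt' one_pos]; simpa using mem_unitBall.1 hw
    · refine Real.le_sqrt_of_sq_le ((norm_herm_sq_le w z).trans ?_)
      have := mem_unitBall.1 hz
      nlinarith [nsq_nonneg w]
  have hterm : ∀ d, Integrable (fun z => h z * herm w z ^ d) ν := by
    intro d
    refine hhi.mul_bdd (c := ρ ^ d) ((continuous_herm w).pow d).aestronglyMeasurable ?_
    filter_upwards [ae_restrict_mem hmball] with z hz
    rw [norm_pow]
    exact pow_le_pow_left₀ (norm_nonneg _) (hρ z hz) _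
  have hsumm : Summable fun d : ℕ => ((d + n).choose n : ℝ) * ρ ^ d :=
    (hasSum_choose_mul_geometric_of_norm_lt_one n (r := ρ) (by
      rwa [Real.norm_of_nonneg hρ0])).summable
  -- The kernel is expanded as Σ C(d+n, n) ⟨w,z⟩^d; the bound |⟨w,z⟩| ≤ ρ < 1, uniform in z, makes
  -- the series dominated.
  have hS := hasSum_integral_of_dominated_convergence (μ := ν)
    (F := fun d z => h z * (((d + n).choose n : ℂ) * herm w z ^ d))
    (f := fun z => h z * (1 / (1 - herm w z) ^ (n + 1)))
    (fun d z => ((d + n).choose n : ℝ) * ρ ^ d * ‖h z‖)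
    (fun d => hhm.mul (continuous_const.mul ((continuous_herm w).pow d)).aestronglyMeasurable)
    (fun d => by
      filter_upwards [ae_restrict_mem hmball] with z hz
      rw [norm_mul, norm_mul, norm_pow, mul_comm, Complex.norm_natCast]
      gcongr
      exact hρ z hz)
    (ae_of_all _ fun z => hsumm.mul_right _)
    (by simp only [tsum_mul_right]; exact hhi.norm.const_mul _)
    (by
      filter_upwards [ae_restrict_mem hmball] with z hz
      exact (hasSum_choose_mul_geometric_of_norm_lt_one n (norm_herm_lt_one hw hz)).mul_left _)
  have hval : ∀ d, ∫ z, h z * (((d + n).choose n : ℂ) * herm w z ^ d) ∂ν =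
      (n.factorial : ℂ)⁻¹ * ((Real.pi : ℂ) ^ n * P d w) := by
    intro d
    -- Against ⟨w,z⟩^d only the part of h homogeneous of degree d survives rotation averaging.
    have e1 : ∫ z, h z * herm w z ^ d ∂ν = ∫ z, P d z * herm w z ^ d ∂ν := by
      rw [integral_eq_integral_circleAverage (fun u hu => measurePreserving_smul_restrict
        (fun u hu z hz => smul_mem_unitBall hu.le hz) u hu hmball) (hterm d)]
      refine integral_congr_ae ?_
      filter_upwards [ae_restrict_mem hmball] with z hz
      have h3 : Real.circleAverage (fun t : ℂ => h (t • z) * herm w (t • z) ^ d) 0 1 =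
          Real.circleAverage ((herm w z ^ d) • fun t : ℂ => (t⁻¹) ^ d * h (t • z)) 0 1 := by
        refine Real.circleAverage_congr_sphere fun t ht => ?_
        have ht1 : ‖t‖ = 1 := by simpa using ht
        have ht2 : (starRingEnd ℂ) t = t⁻¹ := by
          rw [Complex.inv_def, Complex.normSq_eq_norm_sq, ht1]; simp
        simp only [herm_smul_right, ht2, Pi.smul_apply, smul_eq_mul]
        ring
      rw [h3, Real.circleAverage_smul, (hslice z hz).2 d, smul_eq_mul, mul_comm]
    have hFc : Continuous fun z => P d z * herm w z ^ d :=
      (continuousOn_univ.1 (hPa d).continuousOn).mul ((continuous_herm w).pow d)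
    obtain ⟨c, hc, hcb⟩ := norm_herm_le w
    -- The integral over the ball is traded for the Gaussian one, which the Fock space computation
    -- evaluates; the factorials then cancel the binomial coefficient down to 1/n!.
    have e2 := integral_homogeneous_eq (d := d) hFc (by
      intro s z hs
      have : s • z = (s : ℂ) • z := by ext; simp
      rw [this, hPhom, herm_smul_right, Complex.conj_ofReal]
      ring) (integrable_mul_exp_neg_nsq (C := ‖p d‖ * c ^ d * (2 * d).factorial) (c := 1) hFc
        fun z => by
          have h5 := Real.pow_div_factorial_le_exp ‖z‖ (norm_nonneg z) (2 * d)
          rw [div_le_iff₀ (by positivity)] at h5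
          rw [norm_mul, norm_pow, one_mul]
          calc ‖P d z‖ * ‖herm w z‖ ^ d ≤ (‖p d‖ * ‖z‖ ^ d) * (c * ‖z‖) ^ d := by
                gcongr
                · exact hPb d z
                · exact hcb z
            _ = ‖p d‖ * c ^ d * ‖z‖ ^ (2 * d) := by ring
            _ ≤ ‖p d‖ * c ^ d * (Real.exp ‖z‖ * (2 * d).factorial) := by gcongr
            _ = _ := by ring)
    rw [integral_homogeneous_mul_herm_pow (hPa d) (norm_nonneg _) (hPb d) (hPhom d) w] at e2
    have h2 : ((n + d).factorial : ℂ) ≠ 0 := by exact_mod_cast (n + d).factorial_ne_zero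
    have e3 : ∫ z, P d z * herm w z ^ d ∂ν =
        ((n + d).factorial : ℂ)⁻¹ * (d.factorial * ((Real.pi : ℂ) ^ n * P d w)) := by
      rw [e2, inv_mul_cancel_left₀ h2]
    rw [← factorial_identity n d, ← e3, ← e1, ← integral_const_mul]
    congr 1
    ext z
    ring
  simp only [hval] at hS
  have hS2 := ((hslice w hw).1.mul_left ((Real.pi : ℂ) ^ n)).mul_left ((n.factorial : ℂ)⁻¹)
  rw [hS.unique hS2]
  ring

/-! ### Derivations and algebraic elements -/

/-- Apply δ to p(f) = 0 with p of minimal degree: 0 = e + p'(f) δf, where e comes from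
differentiating the coefficients and is algebraic by `hδ`, and p'(f) ≠ 0 by minimality in
characteristic zero. The derivation need not be K-linear, as K will be the polynomials and δ a
directional derivative. -/
theorem isAlgebraic_derivation {K R : Type*} [CommRing K] [IsDomain K] [CommRing R] [IsDomain R]
    [Algebra K R] [FaithfulSMul K R] [CharZero R] {k : Type*} [CommRing k] [Algebra k R]
    (δ : Derivation k R R) (hδ : ∀ a : K, IsAlgebraic K (δ (algebraMap K R a))) {f : R}
    (hf : IsAlgebraic K f) : IsAlgebraic K (δ f) := by
  classical
  have key : ∀ p : Polynomial K, ∃ e : R, IsAlgebraic K e ∧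
      δ (Polynomial.aeval f p) = e + Polynomial.aeval f p.derivative * δ f := by
    intro p
    induction p using Polynomial.induction_on' with
    | add p q hp hq =>
      obtain ⟨e, he, h1⟩ := hp
      obtain ⟨e', he', h2⟩ := hq
      exact ⟨e + e', he.add he', by simp only [map_add, h1, h2]; ring⟩
    | monomial d a =>
      refine ⟨f ^ d * δ (algebraMap K R a), (hf.pow d).mul (hδ a), ?_⟩
      simp only [Polynomial.aeval_monomial, Polynomial.derivative_monomial, Derivation.leibniz,
        Derivation.leibniz_pow, smul_eq_mul, nsmul_eq_mul, map_mul, map_natCast]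
      ring
  have hex : ∃ d : ℕ, ∃ p : Polynomial K, p ≠ 0 ∧ Polynomial.aeval f p = 0 ∧ p.natDegree = d :=
    let ⟨p, hp, h0⟩ := hf; ⟨_, p, hp, h0, rfl⟩
  obtain ⟨p, hp, h0, hdeg⟩ := Nat.find_spec hex
  have hmin : ∀ q : Polynomial K, q ≠ 0 → Polynomial.aeval f q = 0 → p.natDegree ≤ q.natDegree :=
    fun q hq hq0 => hdeg ▸ Nat.find_min' hex ⟨q, hq, hq0, rfl⟩
  have hinj := FaithfulSMul.algebraMap_injective K R
  have : CharZero K := ⟨fun a b hab => by simpa using congrArg (algebraMap K R) hab⟩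
  have hpos : p.natDegree ≠ 0 := by
    intro h
    obtain ⟨c, rfl⟩ := Polynomial.natDegree_eq_zero.1 h
    simp only [Polynomial.aeval_C] at h0
    exact hp (by rw [(map_eq_zero_iff _ hinj).1 h0, map_zero])
  have hd0 : p.derivative ≠ 0 := fun h => hpos (Polynomial.derivative_eq_zero.1 h)
  have hne : Polynomial.aeval f p.derivative ≠ 0 := fun h =>
    absurd (hmin _ hd0 h) (not_le.2 (Polynomial.natDegree_derivative_lt hpos))
  obtain ⟨e, he, h1⟩ := key p
  rw [h0, map_zero] at h1
  have h2 : Polynomial.aeval f p.derivative * δ f = -e := by linear_combination -h1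
  refine IsAlgebraic.of_mul (mem_nonZeroDivisors_of_ne_zero hne) ?_ (h2 ▸ he.neg)
  have : Polynomial.aeval f p.derivative ∈ Subalgebra.algebraicClosure K R :=
    (Algebra.adjoin_le (S := Subalgebra.algebraicClosure K R) (singleton_subset_iff.2 hf))
      (Polynomial.aeval_mem_adjoin_singleton K f)
  exact this

/-- Transitivity of algebraicity, for a coefficient ring that is not comparable with K but maps into
its algebraic closure in R: here complex polynomials against real ones. -/
theorem isAlgebraic_of_eval₂_eq_zero {K R B : Type*} [CommRing K] [IsDomain K] [CommRing R]
    [IsDomain R] [Algebra K R] [CommRing B] (ψ : B →+* R)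
    (hψ : Function.Injective ψ) (halg : ∀ b, IsAlgebraic K (ψ b)) {f : R} {Q : Polynomial B}
    (hQ : Q ≠ 0) (hQ0 : Q.eval₂ ψ f = 0) : IsAlgebraic K f := by
  let A := Subalgebra.algebraicClosure K R
  let ψ' : B →+* A := ψ.codRestrict A halg
  have hψ' : Function.Injective ψ' := fun a b h => hψ (congrArg Subtype.val h)
  have hA : IsAlgebraic A f := by
    refine ⟨Q.map ψ', (Polynomial.map_ne_zero_iff hψ').2 hQ, ?_⟩
    rw [Polynomial.aeval_def, Polynomial.eval₂_map]
    exact hQ0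
  exact hA.restrictScalars K

/-! ### Real-algebraic functions -/

/-- The ring of complex-valued real analytic functions on `D`. -/
def analyticAlgebra {n : ℕ} (D : Set (Fin n → ℂ)) : Subalgebra ℝ (D → ℂ) where
  carrier := {f | ∃ g : (Fin n → ℂ) → ℂ, AnalyticOnNhd ℝ g D ∧ ∀ x : D, f x = g x}
  mul_mem' := by
    rintro _ _ ⟨g, hg, h1⟩ ⟨g', hg', h2⟩
    exact ⟨g * g', hg.mul hg', fun x => by simp [h1, h2]⟩
  add_mem' := by
    rintro _ _ ⟨g, hg, h1⟩ ⟨g', hg', h2⟩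
    exact ⟨g + g', hg.add hg', fun x => by simp [h1, h2]⟩
  algebraMap_mem' r := ⟨fun _ => (r : ℂ), analyticOnNhd_const, fun _ => rfl⟩

/-- The element of `analyticAlgebra D` given by a function that is real analytic on `D`. -/
def toAnalytic {n : ℕ} {D : Set (Fin n → ℂ)} {f : (Fin n → ℂ) → ℂ} (hf : AnalyticOnNhd ℝ f D) :
    analyticAlgebra D :=
  ⟨fun x => f x, f, hf, fun _ => rfl⟩

lemma toAnalytic_eq_zero_iff {n : ℕ} {D : Set (Fin n → ℂ)} {f : (Fin n → ℂ) → ℂ}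
    (hf : AnalyticOnNhd ℝ f D) : toAnalytic hf = 0 ↔ ∀ x ∈ D, f x = 0 := by
  rw [Subtype.ext_iff, funext_iff]
  simp [toAnalytic]

lemma exists_toAnalytic {n : ℕ} {D : Set (Fin n → ℂ)} (e : analyticAlgebra D) :
    ∃ (f : (Fin n → ℂ) → ℂ) (hf : AnalyticOnNhd ℝ f D), e = toAnalytic hf := by
  obtain ⟨e, g, hg, h⟩ := e
  exact ⟨g, hg, Subtype.ext (funext h)⟩

/-- Identity theorem: if f g = 0 and f is nonzero at a point, then g vanishes near it and so on all
of the connected set D. -/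
instance {n : ℕ} {D : Set (Fin n → ℂ)} [hD : Fact (IsOpen D ∧ IsConnected D)] :
    IsDomain (analyticAlgebra D) := by
  obtain ⟨x₀, hx₀⟩ := hD.out.2.nonempty
  have : Nontrivial (analyticAlgebra D) := by
    refine ⟨0, 1, fun h => ?_⟩
    have := congrFun (Subtype.ext_iff.1 h) ⟨x₀, hx₀⟩
    simp at this
  have : NoZeroDivisors (analyticAlgebra D) := by
    refine ⟨fun {a b} hab => ?_⟩
    obtain ⟨f, hf, rfl⟩ := exists_toAnalytic a
    obtain ⟨g, hg, rfl⟩ := exists_toAnalytic b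
    have h0 : ∀ x ∈ D, f x * g x = 0 := fun x hx => congrFun (Subtype.ext_iff.1 hab) ⟨x, hx⟩
    by_contra! hcon
    rw [Ne, toAnalytic_eq_zero_iff, Ne, toAnalytic_eq_zero_iff] at hcon
    push Not at hcon
    obtain ⟨⟨x, hx, hfx⟩, y, hy, hgy⟩ := hcon
    refine hgy (hg.eqOn_zero_of_preconnected_of_eventuallyEq_zero hD.out.2.isPreconnected hx ?_ hy)
    filter_upwards [(hf x hx).continuousAt.eventually_ne hfx, hD.out.1.mem_nhds hx] with z hz hzD
    exact (mul_eq_zero.1 (h0 z hzD)).resolve_left hz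
  exact {}

instance {n : ℕ} {D : Set (Fin n → ℂ)} [hD : Fact (IsOpen D ∧ IsConnected D)] :
    FaithfulSMul ℝ (analyticAlgebra D) :=
  (faithfulSMul_iff_algebraMap_injective ℝ (analyticAlgebra D)).2
    (algebraMap ℝ (analyticAlgebra D)).injective

instance {n : ℕ} {D : Set (Fin n → ℂ)} [hD : Fact (IsOpen D ∧ IsConnected D)] :
    CharZero (analyticAlgebra D) :=
  charZero_of_injective_algebraMap (algebraMap ℝ (analyticAlgebra D)).injective

lemma analyticOnNhd_realCoord {n : ℕ} (D : Set (Fin n → ℂ)) (i : Fin n ⊕ Fin n) :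
    AnalyticOnNhd ℝ (fun z : Fin n → ℂ => ((realCoord z i : ℝ) : ℂ)) D := by
  have : ∃ L : (Fin n → ℂ) →L[ℝ] ℂ, ∀ z, ((realCoord z i : ℝ) : ℂ) = L z := by
    rcases i with i | i
    · exact ⟨Complex.ofRealCLM.comp (Complex.reCLM.comp (ContinuousLinearMap.proj i)),
        fun z => rfl⟩
    · exact ⟨Complex.ofRealCLM.comp (Complex.imCLM.comp (ContinuousLinearMap.proj i)),
        fun z => rfl⟩
  obtain ⟨L, hL⟩ := this
  simp only [hL]
  exact L.analyticOnNhd D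

/-- The real coordinates, as elements of `analyticAlgebra D`. -/
def coordElem {n : ℕ} (D : Set (Fin n → ℂ)) (i : Fin n ⊕ Fin n) : analyticAlgebra D :=
  toAnalytic (analyticOnNhd_realCoord D i)

/-- The ring of real polynomial functions on `D`. -/
abbrev coordAlgebra {n : ℕ} (D : Set (Fin n → ℂ)) : Subalgebra ℝ (analyticAlgebra D) :=
  Algebra.adjoin ℝ (range (coordElem D))

/-- `f` is real analytic on `D` and algebraic over the real polynomials. -/
def IsAlgFun {n : ℕ} (D : Set (Fin n → ℂ)) (f : (Fin n → ℂ) → ℂ) : Prop :=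
  ∃ hf : AnalyticOnNhd ℝ f D, IsAlgebraic (coordAlgebra D) (toAnalytic hf)

namespace IsAlgFun

variable {n : ℕ} {D : Set (Fin n → ℂ)} {f g : (Fin n → ℂ) → ℂ}

theorem congr (hD : IsOpen D) (hf : IsAlgFun D f) (h : EqOn f g D) : IsAlgFun D g := by
  obtain ⟨h1, h2⟩ := hf
  refine ⟨h1.congr hD h, ?_⟩
  rwa [show toAnalytic (h1.congr hD h) = toAnalytic h1 from
    Subtype.ext (funext fun x => (h x.2).symm)]

theorem neg (hf : IsAlgFun D f) : IsAlgFun D (fun z => - f z) :=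
  ⟨hf.1.neg, hf.2.neg⟩

/-- Conjugation is a ring endomorphism of the analytic functions that fixes the real polynomials, so
f̄ is a root of the same polynomial as f. -/
theorem conj (hf : IsAlgFun D f) : IsAlgFun D (fun z => (starRingEnd ℂ) (f z)) := by
  have key : ∀ e : analyticAlgebra D,
      (fun x : D => (starRingEnd ℂ) (e.1 x)) ∈ analyticAlgebra D := by
    rintro ⟨_, g, hg, h⟩
    exact ⟨fun z => (starRingEnd ℂ) (g z),
      fun z hz => (Complex.conjCLE.toContinuousLinearMap.analyticAt _).comp (hg z hz),
      fun x => congrArg _ (h x)⟩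
  let c : analyticAlgebra D →+* analyticAlgebra D :=
    { toFun := fun e => ⟨_, key e⟩
      map_one' := Subtype.ext (funext fun x => map_one (starRingEnd ℂ))
      map_mul' := fun a b => Subtype.ext (funext fun x => map_mul (starRingEnd ℂ) _ _)
      map_zero' := Subtype.ext (funext fun x => map_zero (starRingEnd ℂ))
      map_add' := fun a b => Subtype.ext (funext fun x => map_add (starRingEnd ℂ) _ _) }
  obtain ⟨h1, p, hp, h0⟩ := hf
  refine ⟨(key (toAnalytic h1)).elim fun _ _ => fun z hz =>
    (Complex.conjCLE.toContinuousLinearMap.analyticAt _).comp (h1 z hz), p, hp, ?_⟩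
  have hc : c.comp (algebraMap (coordAlgebra D) (analyticAlgebra D)) = algebraMap _ _ := by
    ext1 ⟨a, ha⟩
    change c a = a
    induction ha using Algebra.adjoin_induction with
    | mem x hx =>
      obtain ⟨i, rfl⟩ := hx
      exact Subtype.ext (funext fun x => Complex.conj_ofReal _)
    | algebraMap r => exact Subtype.ext (funext fun x => Complex.conj_ofReal _)
    | add x y _ _ hx hy => rw [map_add, hx, hy]
    | mul x y _ _ hx hy => rw [map_mul, hx, hy]
  have := congrArg c h0
  rwa [Polynomial.aeval_def, Polynomial.hom_eval₂, hc, map_zero] at this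

variable [hD : Fact (IsOpen D ∧ IsConnected D)]

theorem add (hf : IsAlgFun D f) (hg : IsAlgFun D g) : IsAlgFun D (fun z => f z + g z) :=
  ⟨hf.1.add hg.1, hf.2.add hg.2⟩

theorem mul (hf : IsAlgFun D f) (hg : IsAlgFun D g) : IsAlgFun D (fun z => f z * g z) :=
  ⟨hf.1.mul hg.1, hf.2.mul hg.2⟩

/-- Complex constants are algebraic over ℝ, hence over the larger ring of real polynomials. -/
theorem const (c : ℂ) : IsAlgFun D (fun _ => c) := by
  refine ⟨analyticOnNhd_const, ?_⟩
  let φ : ℂ →ₐ[ℝ] analyticAlgebra D :=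
    AlgHom.codRestrict (Pi.constAlgHom ℝ D ℂ) (analyticAlgebra D)
      fun c => ⟨fun _ => c, analyticOnNhd_const, fun _ => rfl⟩
  have h : IsAlgebraic ℝ (φ c) := (Algebra.IsAlgebraic.isAlgebraic (R := ℝ) c).algHom φ
  have : IsScalarTower ℝ (coordAlgebra D) (analyticAlgebra D) :=
    IsScalarTower.of_algebraMap_eq fun _ => rfl
  exact h.extendScalars (algebraMap ℝ (coordAlgebra D)).injective

theorem sum {ι : Type*} (s : Finset ι) {f : ι → (Fin n → ℂ) → ℂ}
    (hf : ∀ i ∈ s, IsAlgFun D (f i)) : IsAlgFun D (fun z => ∑ i ∈ s, f i z) := by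
  classical
  induction s using Finset.induction_on with
  | empty => simpa using const (D := D) 0
  | insert i s hi ih =>
    simp only [Finset.sum_insert hi]
    exact (hf i (by simp)).add (ih fun j hj => hf j (by simp [hj]))

theorem prod {ι : Type*} (s : Finset ι) {f : ι → (Fin n → ℂ) → ℂ}
    (hf : ∀ i ∈ s, IsAlgFun D (f i)) : IsAlgFun D (fun z => ∏ i ∈ s, f i z) := by
  classical
  induction s using Finset.induction_on with
  | empty => simpa using const (D := D) 1
  | insert i s hi ih =>
    simp only [Finset.prod_insert hi]
    exact (hf i (by simp)).mul (ih fun j hj => hf j (by simp [hj]))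

theorem pow (hf : IsAlgFun D f) (k : ℕ) : IsAlgFun D (fun z => f z ^ k) := by
  simpa using prod (Finset.range k) (f := fun _ => f) fun _ _ => hf

theorem realCoord (i : Fin n ⊕ Fin n) :
    IsAlgFun D (fun z => ((AlgBergman.realCoord z i : ℝ) : ℂ)) :=
  ⟨analyticOnNhd_realCoord D i,
    isAlgebraic_algebraMap (⟨coordElem D i, Algebra.subset_adjoin ⟨i, rfl⟩⟩ : coordAlgebra D)⟩

theorem coord (i : Fin n) : IsAlgFun D (fun z => z i) :=
  ((realCoord (Sum.inl i)).add ((realCoord (Sum.inr i)).mul (const I))).congr hD.out.1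
    fun z _ => Complex.re_add_im (z i)

/-- Cancellation of a nontrivial algebraic factor. -/
theorem of_mul (hf : IsAlgFun D f) (hne : ∃ z ∈ D, f z ≠ 0) (hg : AnalyticOnNhd ℝ g D)
    (hfg : IsAlgFun D (fun z => f z * g z)) : IsAlgFun D g := by
  refine ⟨hg, IsAlgebraic.of_mul (y := toAnalytic hf.1) (mem_nonZeroDivisors_of_ne_zero ?_)
    hf.2 hfg.2⟩
  rw [Ne, toAnalytic_eq_zero_iff]
  push Not
  exact hne

/-- Directional derivatives of algebraic functions are algebraic. -/
theorem fderiv (hf : IsAlgFun D f) (v : Fin n → ℂ) :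
    IsAlgFun D (fun z => _root_.fderiv ℝ f z v) := by
  have han : ∀ {g : (Fin n → ℂ) → ℂ}, AnalyticOnNhd ℝ g D →
      AnalyticOnNhd ℝ (fun z => _root_.fderiv ℝ g z v) D := fun {g} hg =>
    (ContinuousLinearMap.apply ℝ ℂ v).comp_analyticOnNhd (f := _root_.fderiv ℝ g) hg.fderiv
  -- Elements of the algebra are functions on the subtype D; to differentiate, each gets an analytic
  -- representative on ℂⁿ. The derivative on D does not depend on it, since D is open.
  choose rep hrep hrep' using fun e : analyticAlgebra D => exists_toAnalytic e
  let d : analyticAlgebra D → analyticAlgebra D := fun e => toAnalytic (han (hrep e))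
  have hd : ∀ (e : analyticAlgebra D) (g : (Fin n → ℂ) → ℂ) (hg : AnalyticOnNhd ℝ g D),
      e = toAnalytic hg → d e = toAnalytic (han hg) := by
    intro e g hg he
    refine Subtype.ext (funext fun x => ?_)
    have : rep e =ᶠ[𝓝 x.1] g := by
      filter_upwards [hD.out.1.mem_nhds x.2] with z hz
      exact congrFun (Subtype.ext_iff.1 ((hrep' e).symm.trans he)) ⟨z, hz⟩
    exact congrArg (fun L : (Fin n → ℂ) →L[ℝ] ℂ => L v) (this.fderiv_eq (𝕜 := ℝ))
  let δ : Derivation ℝ (analyticAlgebra D) (analyticAlgebra D) := Derivation.mk'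
    { toFun := d
      map_add' := fun a b => by
        rw [hd (a + b) (fun z => rep a z + rep b z) ((hrep a).add (hrep b))
          (by nth_rw 1 [hrep' a, hrep' b]; rfl)]
        refine Subtype.ext (funext fun x => ?_)
        exact congrArg (· v) (fderiv_fun_add (hrep a x x.2).differentiableAt
          (hrep b x x.2).differentiableAt)
      map_smul' := fun r a => by
        rw [hd (r • a) (fun z => r • rep a z) (fun z hz => (analyticAt_const (v := r)).fun_smul (hrep a z hz))
          (by nth_rw 1 [hrep' a]; rfl)]
        refine Subtype.ext (funext fun x => ?_)
        exact congrArg (· v) (fderiv_fun_const_smul (hrep a x x.2).differentiableAt r) }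
    (fun a b => by
      change d (a * b) = a • d b + b • d a
      rw [hd (a * b) (fun z => rep a z * rep b z) ((hrep a).mul (hrep b))
        (by nth_rw 1 [hrep' a, hrep' b]; rfl)]
      refine Subtype.ext (funext fun x => ?_)
      refine (congrArg (· v) (fderiv_fun_mul (hrep a x x.2).differentiableAt
        (hrep b x x.2).differentiableAt)).trans ?_
      have ha : a.1 x = rep a x := congrFun (Subtype.ext_iff.1 (hrep' a)) x
      have hb : b.1 x = rep b x := congrFun (Subtype.ext_iff.1 (hrep' b)) x
      change rep a x * _root_.fderiv ℝ (rep b) x v + rep b x * _root_.fderiv ℝ (rep a) x v =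
        a.1 x * _root_.fderiv ℝ (rep b) x v + b.1 x * _root_.fderiv ℝ (rep a) x v
      rw [ha, hb])
  -- The derivative of a coordinate is constant, so polynomials are sent to algebraic functions.
  have hδ : ∀ a : coordAlgebra D, IsAlgebraic (coordAlgebra D)
      (δ (algebraMap (coordAlgebra D) (analyticAlgebra D) a)) := by
    rintro ⟨a, ha⟩
    change IsAlgebraic (coordAlgebra D) (δ a)
    induction ha using Algebra.adjoin_induction with
    | mem x hx =>
      obtain ⟨i, rfl⟩ := hx
      have : δ (coordElem D i) = toAnalytic (analyticOnNhd_const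
          (v := ((AlgBergman.realCoord v i : ℝ) : ℂ))) := by
        refine (hd _ _ (analyticOnNhd_realCoord D i) rfl).trans
          (Subtype.ext (funext fun x => ?_))
        have : ∃ L : (Fin n → ℂ) →L[ℝ] ℂ, ∀ z, ((AlgBergman.realCoord z i : ℝ) : ℂ) = L z := by
          rcases i with i | i
          · exact ⟨Complex.ofRealCLM.comp (Complex.reCLM.comp (ContinuousLinearMap.proj i)),
              fun z => rfl⟩
          · exact ⟨Complex.ofRealCLM.comp (Complex.imCLM.comp (ContinuousLinearMap.proj i)),
              fun z => rfl⟩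
        obtain ⟨L, hL⟩ := this
        simp only [toAnalytic, hL, ContinuousLinearMap.fderiv]
      rw [this]
      exact (const _).2
    | algebraMap r => rw [Derivation.map_algebraMap]; exact isAlgebraic_zero
    | add x y _ _ hx hy => rw [map_add]; exact hx.add hy
    | mul x y hx' hy' hx hy =>
      rw [Derivation.leibniz]
      exact ((isAlgebraic_algebraMap (⟨x, hx'⟩ : coordAlgebra D)).mul hy).add
        ((isAlgebraic_algebraMap (⟨y, hy'⟩ : coordAlgebra D)).mul hx)
  refine ⟨han hf.1, ?_⟩
  rw [← hd _ f hf.1 rfl]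
  exact isAlgebraic_derivation δ hδ hf.2

/-- Complex-algebraic functions are algebraic over the real polynomials. -/
theorem of_isComplexAlgebraicOn {Ω : Set (Fin n → ℂ)} (hf : IsComplexAlgebraicOn f Ω)
    (hDΩ : D ⊆ Ω) : IsAlgFun D f := by
  obtain ⟨hfan, P, hP, hP0⟩ := hf
  have hfD : AnalyticOnNhd ℝ f D := (hfan.mono hDΩ).restrictScalars
  refine ⟨hfD, ?_⟩
  let φ : ℂ →+* analyticAlgebra D :=
    { toFun := fun c => toAnalytic (analyticOnNhd_const (v := c))
      map_one' := rfl
      map_mul' := fun a b => rfl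
      map_zero' := rfl
      map_add' := fun a b => rfl }
  let ψ : MvPolynomial (Fin n) ℂ →+* analyticAlgebra D :=
    MvPolynomial.eval₂Hom φ fun i => toAnalytic (coord i).1
  let ev : D → analyticAlgebra D →+* ℂ := fun z =>
    (Pi.evalRingHom (fun _ : D => ℂ) z).comp (analyticAlgebra D).val.toRingHom
  have hψ : ∀ z : D, (ev z).comp ψ = MvPolynomial.eval z.1 := fun z =>
    MvPolynomial.ringHom_ext
      (fun r => by
        rw [RingHom.comp_apply, MvPolynomial.eval₂Hom_C, MvPolynomial.eval_C]; rfl)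
      (fun i => by
        rw [RingHom.comp_apply, MvPolynomial.eval₂Hom_X', MvPolynomial.eval_X]; rfl)
  -- A complex polynomial vanishing on a product of discs inside D is zero.
  have hψi : Function.Injective ψ := by
    rw [injective_iff_map_eq_zero]
    intro p hp
    obtain ⟨x, hx⟩ := hD.out.2.nonempty
    obtain ⟨ε, hε, hball⟩ := Metric.isOpen_iff.1 hD.out.1 x hx
    refine MvPolynomial.funext_set (fun i => Metric.ball (x i) ε)
      (fun i => infinite_of_mem_nhds (x i) (Metric.ball_mem_nhds _ hε)) fun z hz => ?_
    have hzD : z ∈ D := hball (by rw [ball_pi _ hε]; exact hz)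
    rw [map_zero, ← hψ ⟨z, hzD⟩, RingHom.comp_apply, hp, map_zero]
  -- P is read as a polynomial in the value variable with coefficients in ℂ[z].
  refine isAlgebraic_of_eval₂_eq_zero ψ hψi (fun p => ?_)
    (Q := MvPolynomial.optionEquivLeft ℂ (Fin n) P) (by simpa using hP) ?_
  · induction p using MvPolynomial.induction_on with
    | C a => rw [MvPolynomial.eval₂Hom_C]; exact (const a).2
    | add p q hp hq => rw [map_add]; exact hp.add hq
    | mul_X p i hp => rw [map_mul, MvPolynomial.eval₂Hom_X']; exact hp.mul (coord i).2
  · refine Subtype.ext (funext fun z => ?_)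
    change ev z _ = 0
    rw [Polynomial.hom_eval₂, hψ, ← Polynomial.eval_map, ← hP0 z (hDΩ z.2),
      MvPolynomial.optionEquivLeft_elim_eval]
    rfl

end IsAlgFun

/-- More than `2n` functions algebraic over the real polynomials satisfy a polynomial relation. -/
theorem exists_mvPolynomial_of_isAlgFun {n : ℕ} {D : Set (Fin n → ℂ)}
    [hD : Fact (IsOpen D ∧ IsConnected D)] {ι : Type} [Fintype ι] (hι : 2 * n < Fintype.card ι)
    {y : ι → (Fin n → ℂ) → ℝ} (hy : ∀ i, IsAlgFun D (fun z => (y i z : ℂ))) :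
    ∃ P : MvPolynomial ι ℝ, P ≠ 0 ∧ ∀ z ∈ D, MvPolynomial.eval (fun i => y i z) P = 0 := by
  let Y : ι → analyticAlgebra D := fun i => toAnalytic (hy i).1
  have hdep : ¬ AlgebraicIndependent ℝ Y := by
    intro hY
    have hinj := hY.injective
    -- In the matroid of algebraic independence, an independent set in the closure of the 2n
    -- coordinates has at most 2n elements.
    let M := AlgebraicIndependent.matroid ℝ (analyticAlgebra D)
    have h1 : M.Indep (range Y) := AlgebraicIndependent.matroid_indep_iff.2 hY.to_subtype_range
    have h2 : range Y ⊆ M.closure (range (coordElem D)) := by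
      rw [AlgebraicIndependent.matroid_closure_eq]
      rintro _ ⟨i, rfl⟩
      exact (hy i).2
    have h3 : (range Y).encard ≤ (range (coordElem D)).encard :=
      (h1.encard_le_eRk_of_subset h2).trans ((M.eRk_closure_eq _).le.trans (M.eRk_le_encard _))
    have h4 : (range Y).encard = Fintype.card ι := by
      rw [← image_univ, hinj.encard_image, encard_univ]
      simp
    have h5 : (range (coordElem D)).encard ≤ (2 * n : ℕ) := by
      rw [← image_univ]
      refine (encard_image_le _ _).trans ?_
      rw [encard_univ]
      simp [two_mul]
    have := (h4 ▸ h3).trans h5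
    exact absurd (by exact_mod_cast this) (not_le.2 hι)
  rw [algebraicIndependent_iff] at hdep
  push Not at hdep
  obtain ⟨P, hP0, hP⟩ := hdep
  refine ⟨P, hP, fun z hz => ?_⟩
  have key : ∀ Q : MvPolynomial ι ℝ, (MvPolynomial.aeval Y Q).1 ⟨z, hz⟩ =
      ((MvPolynomial.eval (fun i => y i z) Q : ℝ) : ℂ) := by
    intro Q
    induction Q using MvPolynomial.induction_on with
    | C a => simp only [MvPolynomial.aeval_C, MvPolynomial.eval_C]; rfl
    | add p q hp hq => rw [map_add, map_add, ofReal_add, ← hp, ← hq]; rfl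
    | mul_X p i hp =>
      rw [map_mul, map_mul, ofReal_mul, ← hp, MvPolynomial.eval_X, MvPolynomial.aeval_X]
      rfl
  have := key P
  rw [hP0] at this
  exact Complex.ofReal_injective this.symm

/-! ### Charts together with their inverses -/

/-- `φ : Ω → M ∩ U` is a parametrization with holomorphic inverse `ρ`. -/
structure IsChartWith {N : ℕ} (d : ℕ) (M : Set (Fin N → ℂ)) (Ω : Set (Fin d → ℂ))
    (φ : (Fin d → ℂ) → (Fin N → ℂ)) (U : Set (Fin N → ℂ)) (ρ : (Fin N → ℂ) → (Fin d → ℂ)) :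
    Prop where
  isOpen : IsOpen Ω
  analytic : AnalyticOnNhd ℂ φ Ω
  isOpen_target : IsOpen U
  image_eq : φ '' Ω = M ∩ U
  analytic_inv : AnalyticOnNhd ℂ ρ U
  left_inv : ∀ z ∈ Ω, ρ (φ z) = z

section Charts

variable {N d d' : ℕ} {M : Set (Fin N → ℂ)} {Ω : Set (Fin d → ℂ)} {Ω' : Set (Fin d' → ℂ)}
  {φ : (Fin d → ℂ) → (Fin N → ℂ)} {φ' : (Fin d' → ℂ) → (Fin N → ℂ)} {U U' : Set (Fin N → ℂ)}
  {ρ : (Fin N → ℂ) → (Fin d → ℂ)} {ρ' : (Fin N → ℂ) → (Fin d' → ℂ)}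

theorem IsChart.exists_isChartWith (h : IsChart d M Ω φ) : ∃ U ρ, IsChartWith d M Ω φ U ρ := by
  obtain ⟨h1, h2, U, h3, h4, ρ, h5, h6⟩ := h
  exact ⟨U, ρ, h1, h2, h3, h4, h5, h6⟩

namespace IsChartWith

theorem isChart (h : IsChartWith d M Ω φ U ρ) : IsChart d M Ω φ :=
  ⟨h.isOpen, h.analytic, U, h.isOpen_target, h.image_eq, ρ, h.analytic_inv, h.left_inv⟩

theorem mem (h : IsChartWith d M Ω φ U ρ) {z : Fin d → ℂ} (hz : z ∈ Ω) : φ z ∈ M ∩ U :=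
  h.image_eq ▸ mem_image_of_mem φ hz

theorem inv_mem (h : IsChartWith d M Ω φ U ρ) {x : Fin N → ℂ} (hx : x ∈ M ∩ U) :
    ρ x ∈ Ω ∧ φ (ρ x) = x := by
  obtain ⟨z, hz, rfl⟩ := h.image_eq ▸ hx
  rw [h.left_inv z hz]
  exact ⟨hz, rfl⟩

/-- A holomorphic map into `M`, read in a chart. -/
theorem comp_analytic (h : IsChartWith d M Ω φ U ρ) {R : Set (Fin d' → ℂ)}
    {f : (Fin d' → ℂ) → (Fin N → ℂ)} (hf : AnalyticOnNhd ℂ f R) (hfR : MapsTo f R (M ∩ U)) :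
    AnalyticOnNhd ℂ (fun z => ρ (f z)) R :=
  h.analytic_inv.comp hf fun _ hz => (hfR hz).2

theorem fderiv_comp (h : IsChartWith d M Ω φ U ρ) {R : Set (Fin d' → ℂ)} (hR : IsOpen R)
    {f : (Fin d' → ℂ) → (Fin N → ℂ)} (hf : AnalyticOnNhd ℂ f R) (hfR : MapsTo f R (M ∩ U))
    {z : Fin d' → ℂ} (hz : z ∈ R) :
    fderiv ℂ f z = (fderiv ℂ φ (ρ (f z))).comp (fderiv ℂ (fun z => ρ (f z)) z) := by
  have h1 : f =ᶠ[𝓝 z] φ ∘ (fun z => ρ (f z)) := by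
    filter_upwards [hR.mem_nhds hz] with w hw
    exact (h.inv_mem (hfR hw)).2.symm
  rw [h1.fderiv_eq]
  exact _root_.fderiv_comp z (h.analytic _ (h.inv_mem (hfR hz)).1).differentiableAt
    (h.comp_analytic hf hfR z hz).differentiableAt

theorem fderiv_inv_comp (h : IsChartWith d M Ω φ U ρ) {z : Fin d → ℂ} (hz : z ∈ Ω) :
    (fderiv ℂ ρ (φ z)).comp (fderiv ℂ φ z) = ContinuousLinearMap.id ℂ _ := by
  have h1 : (fun w => ρ (φ w)) =ᶠ[𝓝 z] id := by
    filter_upwards [h.isOpen.mem_nhds hz] with w hw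
    exact h.left_inv w hw
  rw [← fderiv_id (𝕜 := ℂ) (x := z), ← h1.fderiv_eq]
  exact (_root_.fderiv_comp z (h.analytic_inv _ (h.mem hz).2).differentiableAt
    (h.analytic z hz).differentiableAt).symm

theorem fderiv_injective (h : IsChartWith d M Ω φ U ρ) {z : Fin d → ℂ} (hz : z ∈ Ω) :
    Function.Injective (fderiv ℂ φ z) := fun a b hab => by
  have := congrArg (fderiv ℂ ρ (φ z)) hab
  rwa [← ContinuousLinearMap.comp_apply, ← ContinuousLinearMap.comp_apply,
    h.fderiv_inv_comp hz] at this

/-- The domain of the transition map `ρ' ∘ φ`. -/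
theorem isOpen_inter_preimage (h : IsChartWith d M Ω φ U ρ) (hU' : IsOpen U') :
    IsOpen (Ω ∩ φ ⁻¹' U') :=
  h.analytic.continuousOn.isOpen_inter_preimage h.isOpen hU'

/-- Chain rule for φ = φ' ∘ (ρ' ∘ φ) near the point. Both the invariance of dimension and the
independence of the tangent space from the chart follow. -/
theorem range_fderiv_le (h : IsChartWith d M Ω φ U ρ) (h' : IsChartWith d' M Ω' φ' U' ρ')
    {z : Fin d → ℂ} {z' : Fin d' → ℂ} (hz : z ∈ Ω) (hz' : z' ∈ Ω') (he : φ z = φ' z') :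
    range (fderiv ℂ φ z) ⊆ range (fderiv ℂ φ' z') := by
  have hR := h.isOpen_inter_preimage h'.isOpen_target
  have hzR : z ∈ Ω ∩ φ ⁻¹' U' := ⟨hz, by rw [mem_preimage, he]; exact (h'.mem hz').2⟩
  have := h'.fderiv_comp hR (h.analytic.mono inter_subset_left)
    (fun w hw => ⟨(h.mem hw.1).1, hw.2⟩) hzR
  rw [he, h'.left_inv z' hz'] at this
  rintro _ ⟨v, rfl⟩
  rw [this]
  exact ⟨_, rfl⟩

theorem dim_le (h : IsChartWith d M Ω φ U ρ) (h' : IsChartWith d' M Ω' φ' U' ρ')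
    {z : Fin d → ℂ} {z' : Fin d' → ℂ} (hz : z ∈ Ω) (hz' : z' ∈ Ω') (he : φ z = φ' z') :
    d ≤ d' := by
  have h1 := h.range_fderiv_le h' hz hz' he
  have h2 : LinearMap.range (fderiv ℂ φ z : (Fin d → ℂ) →ₗ[ℂ] (Fin N → ℂ)) ≤
    LinearMap.range (fderiv ℂ φ' z' : (Fin d' → ℂ) →ₗ[ℂ] (Fin N → ℂ)) := fun x hx => h1 hx
  have h3 := Submodule.finrank_mono h2
  rw [LinearMap.finrank_range_of_inj (h.fderiv_injective hz),
    LinearMap.finrank_range_of_inj (h'.fderiv_injective hz')] at h3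
  simpa using h3

theorem tangentVectors_eq (h : IsChartWith d M Ω φ U ρ) {z : Fin d → ℂ} (hz : z ∈ Ω) :
    tangentVectors M (φ z) = range (fderiv ℂ φ z) := by
  ext v
  constructor
  · rintro ⟨d', Ω', φ', z', w, hφ', hz', he, rfl⟩
    obtain ⟨U', ρ', h'⟩ := hφ'.exists_isChartWith
    exact h'.range_fderiv_le h hz' hz he ⟨w, rfl⟩
  · rintro ⟨w, rfl⟩
    exact ⟨d, Ω, φ, z, w, h.isChart, hz, rfl, rfl⟩

end IsChartWith

theorem regularPart_subset {X : Set (Fin N → ℂ)} : regularPart X ⊆ X := by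
  rintro p ⟨d, Ω, φ, ⟨-, -, U, -, h, -⟩, hp⟩
  exact (h ▸ hp : p ∈ X ∩ U).1

theorem IsChartWith.regularPart {X : Set (Fin N → ℂ)} (h : IsChartWith d X Ω φ U ρ) :
    IsChartWith d (regularPart X) Ω φ U ρ where
  isOpen := h.isOpen
  analytic := h.analytic
  isOpen_target := h.isOpen_target
  image_eq := by
    refine Subset.antisymm (fun x hx => ⟨⟨d, Ω, φ, h.isChart, hx⟩, (h.image_eq ▸ hx : _).2⟩) ?_
    rw [h.image_eq]
    exact inter_subset_inter_left _ regularPart_subset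
  analytic_inv := h.analytic_inv
  left_inv := h.left_inv

/-! ### Coefficients of forms -/

theorem alternating_comp_eq_det_mul {n : ℕ} (f : (Fin n → ℂ) [⋀^Fin n]→ₗ[ℂ] ℂ)
    (A : (Fin n → ℂ) →ₗ[ℂ] (Fin n → ℂ)) :
    f (fun j => A (Pi.single j 1)) = f (fun j => Pi.single j 1) * LinearMap.det A := by
  have h := f.eq_smul_basis_det (Pi.basisFun ℂ (Fin n))
  have h1 : ∀ v, f v = f (Pi.basisFun ℂ (Fin n)) * (Pi.basisFun ℂ (Fin n)).det v := by
    intro v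
    conv_lhs => rw [h]
    rfl
  have h2 : (fun j => Pi.single j 1 : Fin n → Fin n → ℂ) = Pi.basisFun ℂ (Fin n) := by
    ext1 j; simp
  rw [h1 (fun j => A (Pi.single j 1)), h2]
  have h3 := (Pi.basisFun ℂ (Fin n)).det_comp A (Pi.basisFun ℂ (Fin n))
  rw [Module.Basis.det_self, mul_one] at h3
  rw [← h3]
  congr 2
  ext1 j; simp

/-- The transformation rule of (n,0)-forms, asked only of the derivatives at one point so that it
serves chart changes, the covering and the group action alike. -/
theorem coeff_eq_of_fderiv_eq {n : ℕ} (ω : NForm N n) {f φ : (Fin n → ℂ) → (Fin N → ℂ)}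
    {z w : Fin n → ℂ} (h : f z = φ w) {A : (Fin n → ℂ) →L[ℂ] (Fin n → ℂ)}
    (hA : fderiv ℂ f z = (fderiv ℂ φ w).comp A) :
    coeff ω f z = coeff ω φ w * LinearMap.det (A : (Fin n → ℂ) →ₗ[ℂ] (Fin n → ℂ)) := by
  have := alternating_comp_eq_det_mul
    ((ω (φ w)).compLinearMap (fderiv ℂ φ w : (Fin n → ℂ) →ₗ[ℂ] (Fin N → ℂ)))
    (A : (Fin n → ℂ) →ₗ[ℂ] (Fin n → ℂ))
  unfold coeff
  rw [h, hA]
  exact this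

/-- The Jacobian determinant of `f`. -/
def jac {n : ℕ} (f : (Fin n → ℂ) → (Fin n → ℂ)) (z : Fin n → ℂ) : ℂ :=
  LinearMap.det (fderiv ℂ f z : (Fin n → ℂ) →ₗ[ℂ] (Fin n → ℂ))

/-- The Leibniz expansion makes the Jacobian a polynomial in partial derivatives, from which its
analyticity and later its algebraicity are read off. -/
theorem jac_eq {n : ℕ} (f : (Fin n → ℂ) → (Fin n → ℂ)) (z : Fin n → ℂ) :
    jac f z = ∑ σ : Equiv.Perm (Fin n), ((Equiv.Perm.sign σ : ℤ) : ℂ) *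
      ∏ i, fderiv ℂ f z (Pi.single i 1) (σ i) := by
  rw [jac, ← LinearMap.det_toMatrix (Pi.basisFun ℂ (Fin n)), Matrix.det_apply']
  simp

theorem analyticOnNhd_jac {n : ℕ} {f : (Fin n → ℂ) → (Fin n → ℂ)} {R : Set (Fin n → ℂ)}
    (hf : AnalyticOnNhd ℂ f R) : AnalyticOnNhd ℂ (jac f) R := by
  rw [funext (jac_eq f)]
  refine Finset.analyticOnNhd_fun_sum _ fun σ _ => analyticOnNhd_const.mul
    (Finset.analyticOnNhd_fun_prod _ fun i _ => ?_)
  exact ((ContinuousLinearMap.proj (σ i)).comp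
    (ContinuousLinearMap.apply ℂ (Fin n → ℂ) (Pi.single i 1))).comp_analyticOnNhd hf.fderiv

end Charts

/-! ### Thinness of analytic subvarieties -/

lemma analyticOnNhd_eq_zero_of_open {n : ℕ} {f : (Fin n → ℂ) → ℂ} {D S : Set (Fin n → ℂ)}
    (hf : AnalyticOnNhd ℂ f D) (hD : IsPreconnected D) (hS : IsOpen S) (hSD : (S ∩ D).Nonempty)
    (h0 : ∀ z ∈ S, f z = 0) : ∀ z ∈ D, f z = 0 := by
  obtain ⟨x, hxS, hxD⟩ := hSD
  refine hf.eqOn_zero_of_preconnected_of_eventuallyEq_zero hD hxD ?_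
  filter_upwards [hS.mem_nhds hxS] with z hz
  exact h0 z hz

/-- The interior is relatively closed in Ω: near a limit point the defining functions vanish on an
open part of a ball, hence on the ball. By connectedness a nonempty interior would be all of Ω. -/
theorem IsAnalyticSubvariety.interior_eq_empty {n : ℕ} {V Ω : Set (Fin n → ℂ)}
    (hV : IsAnalyticSubvariety V Ω) (hΩ : IsOpen Ω) (hc : IsPreconnected Ω) (hne : V ≠ Ω) :
    interior V = ∅ := by
  by_contra hcon
  have hint : (interior V).Nonempty := nonempty_iff_ne_empty.2 hcon
  refine hne (Subset.antisymm hV.1 (Subset.trans (hc.subset_of_closure_inter_subset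
    isOpen_interior ?_ ?_) interior_subset))
  · obtain ⟨x, hx⟩ := hint
    exact ⟨x, hV.1 (interior_subset hx), hx⟩
  · rintro p ⟨hp, hpΩ⟩
    obtain ⟨U, hU, hpU, k, f, hf, hVU⟩ := hV.2 p hpΩ
    obtain ⟨ε, hε, hball⟩ := Metric.isOpen_iff.1 (hU.inter hΩ) p ⟨hpU, hpΩ⟩
    refine mem_interior.2 ⟨ball p ε, fun z hz => ?_, isOpen_ball, mem_ball_self hε⟩
    have hz' := hball hz
    refine (hVU.symm ▸ (⟨⟨hz'.2, hz'.1⟩, fun i => ?_⟩ : z ∈ {x | x ∈ Ω ∩ U ∧ ∀ i, f i x = 0}) :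
      z ∈ V ∩ U).1
    refine analyticOnNhd_eq_zero_of_open (S := interior V ∩ ball p ε)
      ((hf i).mono fun w hw => (hball hw).1) (convex_ball p ε).isPreconnected
      (isOpen_interior.inter isOpen_ball) ?_ ?_ z hz
    · obtain ⟨y, hy, hyV⟩ := mem_closure_iff.1 hp (ball p ε) isOpen_ball (mem_ball_self hε)
      exact ⟨y, ⟨hyV, hy⟩, hy⟩
    · rintro y ⟨hyV, hy⟩
      exact (hVU.subset ⟨interior_subset hyV, (hball hy).1⟩).2 i

/-- If every defining function vanished near p, then p would be interior to V; so one of them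
witnesses thinness. -/
theorem IsAnalyticSubvariety.isThinIn {n : ℕ} {V Ω : Set (Fin n → ℂ)}
    (hV : IsAnalyticSubvariety V Ω) (hΩ : IsOpen Ω) (hc : IsPreconnected Ω) (hne : V ≠ Ω) :
    IsThinIn V Ω := by
  intro p hp
  obtain ⟨U, hU, hpU, k, f, hf, hVU⟩ := hV.2 p hp
  by_contra hcon
  have hall : ∀ i, ∀ᶠ z in 𝓝 p, f i z = 0 := by
    intro i
    by_contra hi
    refine hcon ⟨f i, hf i p hpU, hi, ?_⟩
    filter_upwards [hU.mem_nhds hpU] with z hz hzV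
    exact (hVU.subset ⟨hzV, hz⟩).2 i
  have : p ∈ interior V := by
    rw [mem_interior_iff_mem_nhds]
    filter_upwards [hU.mem_nhds hpU, hΩ.mem_nhds hp, eventually_all.2 hall] with z hz hzΩ h0
    exact (hVU.symm ▸ (⟨⟨hzΩ, hz⟩, h0⟩ : z ∈ {x | x ∈ Ω ∩ U ∧ ∀ i, f i x = 0}) : z ∈ V ∩ U).1
  rw [hV.interior_eq_empty hΩ hc hne] at this
  exact this

/-- The complement of an analytic subvariety is relatively open. -/
theorem IsAnalyticSubvariety.exists_isOpen_diff_eq {N : ℕ} {V G : Set (Fin N → ℂ)}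
    (hV : IsAnalyticSubvariety V G) : ∃ O, IsOpen O ∧ G \ V = G ∩ O := by
  refine ⟨⋃₀ {O | IsOpen O ∧ G ∩ O ⊆ G \ V}, isOpen_sUnion fun O hO => hO.1,
    Subset.antisymm (fun x hx => ⟨hx.1, ?_⟩) ?_⟩
  · obtain ⟨U, hU, hxU, k, f, hf, hVU⟩ := hV.2 x hx.1
    have hex : ∃ i, f i x ≠ 0 := by
      by_contra! h0
      exact hx.2 (hVU.symm ▸ (⟨⟨hx.1, hxU⟩, h0⟩ : x ∈ {x | x ∈ G ∩ U ∧ ∀ i, f i x = 0}) :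
        x ∈ V ∩ U).1
    obtain ⟨i, hi⟩ := hex
    refine ⟨U ∩ f i ⁻¹' {0}ᶜ, ⟨(hf i).continuousOn.isOpen_inter_preimage hU
      isOpen_compl_singleton, ?_⟩, hxU, hi⟩
    rintro y ⟨hyG, hyU, hyi⟩
    exact ⟨hyG, fun hyV => hyi ((hVU.subset ⟨hyV, hyU⟩).2 i)⟩
  · rintro x ⟨hxG, O, hO, hxO⟩
    exact hO.2 ⟨hxG, hxO⟩

theorem isPreconnected_unitBall (n : ℕ) : IsPreconnected (unitBall n) := by
  have h0 : (0 : Fin n → ℂ) ∈ unitBall n := by simp [mem_unitBall, nsq]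
  have : StarConvex ℝ 0 (unitBall n) := starConvex_zero_iff.2 fun z hz a ha ha1 => by
    have h := smul_mem_unitBall (t := (a : ℂ)) (by simpa [abs_of_nonneg ha] using ha1) hz
    simpa using h
  exact (this.isPathConnected h0).isConnected.isPreconnected

/-! ### Quotients of the ball -/

/-- `F : B → M₂ ⊆ M` is an `m`-sheeted covering, invariant under the group `Γ` of order `m`;
`B` and `M₂` have thin complements in the ball and in the `n`-dimensional manifold `M`. -/
structure IsBallQuotient {n N : ℕ} (m : ℕ) (Γ : Subgroup (Matrix.unitaryGroup (Fin n) ℂ))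
    (F : (Fin n → ℂ) → (Fin N → ℂ)) (B : Set (Fin n → ℂ)) (M M₂ : Set (Fin N → ℂ)) : Prop where
  finite : Finite Γ
  card : Nat.card Γ = m
  isOpen : IsOpen B
  subset_ball : B ⊆ unitBall n
  thin : IsThinIn (unitBall n \ B) (unitBall n)
  analytic : AnalyticOnNhd ℂ F B
  mapsTo : MapsTo F B M₂
  act_mem : ∀ γ ∈ Γ, ∀ z ∈ B, act γ z ∈ B ∧ F (act γ z) = F z
  subset : M₂ ⊆ M
  exists_isOpen : ∃ O, IsOpen O ∧ M₂ = M ∩ O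
  thin_preimage : ∀ Ω φ, IsChart n M Ω φ → IsThinIn (Ω \ φ ⁻¹' M₂) Ω
  exists_chart : ∀ p ∈ M, ∃ Ω φ U ρ, IsChartWith n M Ω φ U ρ ∧ p ∈ φ '' Ω
  sheets : ∀ q ∈ M₂, ∃ W : Set (Fin N → ℂ), IsOpen W ∧ q ∈ W ∧ M ∩ W ⊆ M₂ ∧
    ∃ U : Fin m → Set (Fin n → ℂ), Pairwise (fun i j => Disjoint (U i) (U j)) ∧
      (⋃ i, U i) = B ∩ F ⁻¹' W ∧ ∀ i, ∃ g, IsChartWith n M (U i) F W g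

/-- The sheets provide charts of dimension n on G \ V₂. Density of G \ V₂ carries the dimension to
every regular point and makes the preimage of V₂ in any chart thin. -/
theorem isBallQuotient_of_covering {n N m : ℕ} {G : Set (Fin N → ℂ)}
    {Γ : Subgroup (Matrix.unitaryGroup (Fin n) ℂ)} (hfin : Finite Γ) (hm : Nat.card Γ = m)
    {V₁ : Set (Fin n → ℂ)} (hV₁ : IsAnalyticSubvariety V₁ (unitBall n))
    (hV₁_proper : V₁ ≠ unitBall n)
    {V₂ : Set (Fin N → ℂ)} (hV₂ : IsAnalyticSubvariety V₂ G)
    (hV₂_proper : G ⊆ closure (G \ V₂))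
    {F : (Fin n → ℂ) → (Fin N → ℂ)}
    (hF : IsHolomorphicCovering m F (unitBall n \ V₁) (G \ V₂))
    (hdeck : HasDeckGroup F (unitBall n \ V₁) Γ) :
    IsBallQuotient m Γ F (unitBall n \ V₁) (regularPart G) (G \ V₂) := by
  obtain ⟨O₂, hO₂, hGO⟩ := hV₂.exists_isOpen_diff_eq
  have hmpos : 0 < m := hm ▸ Nat.card_pos
  have hthin := hV₁.isThinIn isOpen_unitBall (isPreconnected_unitBall n) hV₁_proper
  have hUO : IsOpen (unitBall n \ V₁) := by
    obtain ⟨O, hO, h⟩ := hV₁.exists_isOpen_diff_eq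
    exact h ▸ isOpen_unitBall.inter hO
  have hsheet : ∀ q ∈ G \ V₂, ∃ W : Set (Fin N → ℂ), IsOpen W ∧ q ∈ W ∧ G ∩ W ⊆ G \ V₂ ∧
      ∃ U : Fin m → Set (Fin n → ℂ), Pairwise (fun i j => Disjoint (U i) (U j)) ∧
      (⋃ i, U i) = (unitBall n \ V₁) ∩ F ⁻¹' W ∧ ∀ i, ∃ g, IsChartWith n G (U i) F W g := by
    intro q hq
    obtain ⟨W, hW, hqW, U, hU, hdisj, hun, hg⟩ := hF.2.2 q hq
    -- Shrinking by O₂ makes the neighbourhood miss V₂, so that each sheet parametrizes an open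
    -- piece of G itself.
    refine ⟨W ∩ O₂, hW.inter hO₂, ⟨hqW, (hGO ▸ hq : q ∈ G ∩ O₂).2⟩, ?_, U, hdisj, ?_, ?_⟩
    · rw [hGO]
      exact fun x hx => ⟨hx.1, hx.2.2⟩
    · rw [hun]
      refine Subset.antisymm (fun z hz => ⟨hz.1, hz.2, ?_⟩) fun z hz => ⟨hz.1, hz.2.1⟩
      exact (hGO ▸ hF.1 hz.1 : F z ∈ G ∩ O₂).2
    · intro i
      obtain ⟨g, hgan, hg1, hg2⟩ := hg i
      have hUi : ∀ z ∈ U i, z ∈ (unitBall n \ V₁) ∩ F ⁻¹' W := fun z hz =>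
        hun ▸ mem_iUnion_of_mem i hz
      refine ⟨g, hU i, hF.2.1.mono fun z hz => (hUi z hz).1, hW.inter hO₂, ?_,
        hgan.mono inter_subset_left, hg2⟩
      refine Subset.antisymm ?_ ?_
      · rintro _ ⟨z, hz, rfl⟩
        have h1 : F z ∈ G ∩ O₂ := hGO ▸ hF.1 (hUi z hz).1
        exact ⟨h1.1, (hUi z hz).2, h1.2⟩
      · rintro y ⟨hyG, hyW, hyO⟩
        have := hg1 y ⟨hyW, hGO ▸ ⟨hyG, hyO⟩⟩
        exact ⟨g y, this.1, this.2⟩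
  have hchart : ∀ q ∈ G \ V₂, ∃ (Ω : Set (Fin n → ℂ)) (φ : (Fin n → ℂ) → (Fin N → ℂ)) (U : _)
      (ρ : _), IsChartWith n G Ω φ U ρ ∧ q ∈ φ '' Ω := by
    intro q hq
    obtain ⟨W, -, hqW, -, U, -, -, hg⟩ := hsheet q hq
    obtain ⟨g, hg⟩ := hg ⟨0, hmpos⟩
    exact ⟨_, _, _, _, hg, hg.image_eq.symm ▸ ⟨hq.1, hqW⟩⟩
  have hsub : G \ V₂ ⊆ regularPart G := fun q hq => by
    obtain ⟨Ω, φ, U, ρ, h, hq'⟩ := hchart q hq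
    exact ⟨n, Ω, φ, h.isChart, hq'⟩
  refine ⟨hfin, hm, hUO, sdiff_subset, ?_, hF.2.1, hF.1, hdeck.1, hsub, ⟨O₂, hO₂, ?_⟩, ?_, ?_, ?_⟩
  · rwa [sdiff_sdiff_cancel_left hV₁.1]
  · refine Subset.antisymm (fun x hx => ⟨hsub hx, (hGO ▸ hx : x ∈ G ∩ O₂).2⟩) ?_
    rw [hGO]
    exact inter_subset_inter_left _ regularPart_subset
  · intro Ω φ hφ z₀ hz₀
    obtain ⟨Uφ, ρ, h⟩ := hφ.exists_isChartWith
    have hx := h.mem hz₀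
    have hxG := regularPart_subset hx.1
    obtain ⟨U, hU, hxU, k, f, hf, hVU⟩ := hV₂.2 _ hxG
    have hfan : ∀ i, AnalyticAt ℂ (fun z => f i (φ z)) z₀ := fun i =>
      (hf i _ hxU).comp (h.analytic z₀ hz₀)
    have hφU : ∀ᶠ z in 𝓝 z₀, φ z ∈ U :=
      (h.analytic z₀ hz₀).continuousAt.eventually_mem (hU.mem_nhds hxU)
    by_contra hcon
    have hall : ∀ i, ∀ᶠ z in 𝓝 z₀, f i (φ z) = 0 := by
      intro i
      by_contra hi
      refine hcon ⟨_, hfan i, hi, ?_⟩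
      filter_upwards [hφU] with z hz hzA
      have hzV : φ z ∈ V₂ := by
        by_contra hcon
        exact hzA.2 ⟨regularPart_subset (h.mem hzA.1).1, hcon⟩
      exact (hVU.subset ⟨hzV, hz⟩).2 i
    have hev : ∀ᶠ z in 𝓝 z₀, z ∈ Ω ∧ φ z ∈ V₂ := by
      filter_upwards [h.isOpen.mem_nhds hz₀, hφU, eventually_all.2 hall] with z hz hzU h0
      exact ⟨hz, (hVU.symm ▸ (⟨⟨regularPart_subset (h.mem hz).1, hzU⟩, h0⟩ :
        φ z ∈ {x | x ∈ G ∩ U ∧ ∀ i, f i x = 0}) : φ z ∈ V₂ ∩ U).1⟩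
    -- The density hypothesis concerns the closure in ℂᴺ, so the neighbourhood of z₀ is transported
    -- by ρ to an ambient one. A point of G \ V₂ in it satisfies φ (ρ x) = x and would lie in V₂.
    have hev' : ∀ᶠ x in 𝓝 (φ z₀), x ∈ Uφ ∧ φ (ρ x) ∈ V₂ := by
      have hc := (h.analytic_inv _ hx.2).continuousAt
      rw [ContinuousAt, h.left_inv z₀ hz₀] at hc
      filter_upwards [h.isOpen_target.mem_nhds hx.2, hc hev] with x h1 h2
      exact ⟨h1, h2.2⟩
    obtain ⟨x, ⟨hxU, hxV⟩, hxGV⟩ := mem_closure_iff_nhds.1 (hV₂_proper hxG) _ hev'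
    rw [(h.inv_mem ⟨hsub hxGV, hxU⟩).2] at hxV
    exact hxGV.2 hxV
  · rintro p ⟨d, Ω, φ, hφ, hp⟩
    obtain ⟨U, ρ, h⟩ := hφ.exists_isChartWith
    have hpGU := h.image_eq ▸ hp
    -- The chart meets G \ V₂, where an n-dimensional chart is available for comparing dimensions.
    obtain ⟨y, hyU, hy⟩ := mem_closure_iff.1 (hV₂_proper hpGU.1) U h.isOpen_target hpGU.2
    obtain ⟨Ω', φ', U', ρ', h', z', hz', rfl⟩ := hchart y hy
    obtain ⟨z, hz, hzz⟩ := (h.image_eq.symm ▸ ⟨hy.1, hyU⟩ : φ' z' ∈ φ '' Ω)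
    obtain rfl : d = n := le_antisymm (h.dim_le h' hz hz' hzz) (h'.dim_le h hz' hz hzz.symm)
    exact ⟨Ω, φ, U, ρ, h.regularPart, hp⟩
  · intro q hq
    obtain ⟨W, hW, hqW, hGW, U, h1, h2, h3⟩ := hsheet q hq
    refine ⟨W, hW, hqW, (inter_subset_inter_left _ regularPart_subset).trans hGW, U, h1, h2,
      fun i => ?_⟩
    obtain ⟨g, hg⟩ := h3 i
    exact ⟨g, hg.regularPart⟩

/-! ### Change of variables along the covering. -/

lemma measurableSet_inter_preimage {X Y : Type*} [TopologicalSpace X] [MeasurableSpace X]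
    [BorelSpace X] [TopologicalSpace Y] [MeasurableSpace Y] [BorelSpace Y] {R : Set X}
    {q : X → Y} (hR : IsOpen R) (hq : ContinuousOn q R) {E : Set Y} (hE : MeasurableSet E) :
    MeasurableSet (R ∩ q ⁻¹' E) := by
  have h := hR.measurableSet.subtype_image
    ((continuousOn_iff_continuous_domRestrict.1 hq).measurable hE)
  convert h using 1
  ext x
  simp [and_comm]

/-- The real Jacobian of a holomorphic map is the squared modulus of the complex one. -/
lemma lintegral_enorm_jac_sq {n : ℕ} {q : (Fin n → ℂ) → (Fin n → ℂ)} {A R : Set (Fin n → ℂ)}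
    (hq : AnalyticOnNhd ℂ q R) (hAR : A ⊆ R) (hA : MeasurableSet A)
    (hinj : InjOn q A) : ∫⁻ z in A, ‖jac q z‖ₑ ^ 2 = volume (q '' A) := by
  have h := lintegral_abs_det_fderiv_eq_addHaar_image (volume : Measure (Fin n → ℂ)) hA
    (f := q) (f' := fun z => (fderiv ℂ q z).restrictScalars ℝ)
    (fun x hx => ((hq x (hAR hx)).differentiableAt.hasFDerivAt.restrictScalars ℝ).hasFDerivWithinAt)
    hinj
  rw [← h]
  refine lintegral_congr fun z => ?_
  have h1 := abs_det_restrictScalars (fderiv ℂ q z : (Fin n → ℂ) →ₗ[ℂ] (Fin n → ℂ))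
  have h2 : ((fderiv ℂ q z).restrictScalars ℝ).det =
    LinearMap.det ((fderiv ℂ q z : (Fin n → ℂ) →ₗ[ℂ] (Fin n → ℂ)).restrictScalars ℝ) := rfl
  rw [h2, h1, ENNReal.ofReal_pow (norm_nonneg _), ofReal_norm]
  rfl

namespace IsBallQuotient

variable {n N m : ℕ} {Γ : Subgroup (Matrix.unitaryGroup (Fin n) ℂ)}
  {F : (Fin n → ℂ) → (Fin N → ℂ)} {B : Set (Fin n → ℂ)} {M M₂ : Set (Fin N → ℂ)}
  {Ω : Set (Fin n → ℂ)} {φ : (Fin n → ℂ) → (Fin N → ℂ)} {U : Set (Fin N → ℂ)}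
  {ρ : (Fin N → ℂ) → (Fin n → ℂ)}

theorem pos (hQ : IsBallQuotient m Γ F B M M₂) : 0 < m := by
  have := hQ.finite
  exact hQ.card ▸ Nat.card_pos

theorem isOpen_preimage (hQ : IsBallQuotient m Γ F B M M₂) (hU : IsOpen U) :
    IsOpen (B ∩ F ⁻¹' U) :=
  hQ.analytic.continuousOn.isOpen_inter_preimage hQ.isOpen hU

theorem analytic_chart (hQ : IsBallQuotient m Γ F B M M₂) (h : IsChartWith n M Ω φ U ρ) :
    AnalyticOnNhd ℂ (fun z => ρ (F z)) (B ∩ F ⁻¹' U) :=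
  h.comp_analytic (hQ.analytic.mono inter_subset_left)
    fun _ hz => ⟨hQ.subset (hQ.mapsTo hz.1), hz.2⟩

theorem chart_mem (hQ : IsBallQuotient m Γ F B M M₂) (h : IsChartWith n M Ω φ U ρ)
    {z : Fin n → ℂ} (hz : z ∈ B ∩ F ⁻¹' U) :
    ρ (F z) ∈ Ω ∧ φ (ρ (F z)) = F z ∧ ρ (F z) ∈ Ω ∩ φ ⁻¹' M₂ := by
  obtain ⟨h1, h2⟩ := h.inv_mem ⟨hQ.subset (hQ.mapsTo hz.1), hz.2⟩
  exact ⟨h1, h2, h1, by rw [mem_preimage, h2]; exact hQ.mapsTo hz.1⟩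

/-- The part of a chart domain lying over the base of the covering is open. -/
theorem isOpen_chart_inter (hQ : IsBallQuotient m Γ F B M M₂) (h : IsChartWith n M Ω φ U ρ) :
    IsOpen (Ω ∩ φ ⁻¹' M₂) := by
  obtain ⟨O, hO, rfl⟩ := hQ.exists_isOpen
  convert h.isOpen_inter_preimage hO using 1
  ext z
  exact ⟨fun hz => ⟨hz.1, hz.2.2⟩, fun hz => ⟨hz.1, (h.mem hz.1).1, hz.2⟩⟩

theorem coeff_eq (hQ : IsBallQuotient m Γ F B M M₂) (h : IsChartWith n M Ω φ U ρ)
    (ω : NForm N n) {z : Fin n → ℂ} (hz : z ∈ B ∩ F ⁻¹' U) :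
    coeff ω F z = coeff ω φ (ρ (F z)) * jac (fun z => ρ (F z)) z :=
  coeff_eq_of_fderiv_eq ω (hQ.chart_mem h hz).2.1.symm
    (h.fderiv_comp (hQ.isOpen_preimage h.isOpen_target) (hQ.analytic.mono inter_subset_left)
      (fun _ hw => ⟨hQ.subset (hQ.mapsTo hw.1), hw.2⟩) hz)

/-- Over an evenly covered W the preimage of E splits into m sheets, and ρ ∘ F maps each part
bijectively onto E; the change of variables contributes the volume of E once per sheet. -/
theorem lintegral_sheet (hQ : IsBallQuotient m Γ F B M M₂) (h : IsChartWith n M Ω φ U ρ)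
    {q₀ : Fin N → ℂ} (hq₀ : q₀ ∈ M₂) : ∃ W, IsOpen W ∧ q₀ ∈ W ∧ ∀ E ⊆ Ω ∩ φ ⁻¹' W,
      MeasurableSet E → ∫⁻ z in (B ∩ F ⁻¹' U) ∩ (fun z => ρ (F z)) ⁻¹' E,
        ‖jac (fun z => ρ (F z)) z‖ₑ ^ 2 = m * volume E := by
  obtain ⟨W, hW, hqW, hMW, S, hdisj, hun, hg⟩ := hQ.sheets q₀ hq₀
  refine ⟨W, hW, hqW, fun E hEW hE => ?_⟩
  choose g hg using hg
  have hR := hQ.isOpen_preimage h.isOpen_target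
  have hqan := hQ.analytic_chart h
  set q : (Fin n → ℂ) → (Fin n → ℂ) := fun z => ρ (F z)
  set R := B ∩ F ⁻¹' U
  have hSB : ∀ i, ∀ z ∈ S i, z ∈ B ∩ F ⁻¹' W := fun i z hz => hun ▸ mem_iUnion_of_mem i hz
  have hdec : R ∩ q ⁻¹' E = ⋃ i, (S i ∩ (R ∩ q ⁻¹' E)) := by
    rw [← iUnion_inter, hun, eq_comm, inter_eq_right]
    intro z hz
    refine ⟨hz.1.1, ?_⟩
    rw [mem_preimage, ← (hQ.chart_mem h hz.1).2.1]
    exact (hEW hz.2).2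
  have hmeas : ∀ i, MeasurableSet (S i ∩ (R ∩ q ⁻¹' E)) := fun i =>
    (hg i).isOpen.measurableSet.inter (measurableSet_inter_preimage hR hqan.continuousOn hE)
  have hone : ∀ i, ∫⁻ z in S i ∩ (R ∩ q ⁻¹' E), ‖jac q z‖ₑ ^ 2 = volume E := by
    intro i
    rw [lintegral_enorm_jac_sq hqan (inter_subset_right.trans inter_subset_left) (hmeas i)]
    · congr 1
      refine Subset.antisymm ?_ fun y hy => ?_
      · rintro _ ⟨z, hz, rfl⟩
        exact hz.2.2
      · have hy' := hEW hy
        have hφy := h.mem hy'.1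
        obtain ⟨h1, h2⟩ := (hg i).inv_mem ⟨hφy.1, hy'.2⟩
        have h3 : q (g i (φ y)) = y := by
          change ρ (F _) = y
          rw [h2, h.left_inv y hy'.1]
        refine ⟨g i (φ y), ⟨h1, ⟨(hSB i _ h1).1, ?_⟩, ?_⟩, h3⟩
        · rw [mem_preimage, h2]
          exact hφy.2
        · rw [mem_preimage, h3]
          exact hy
    · intro a ha b hb hab
      have h1 : F a = F b := by
        rw [← (hQ.chart_mem h ha.2.1).2.1, ← (hQ.chart_mem h hb.2.1).2.1]
        exact congrArg φ hab
      rw [← (hg i).left_inv a ha.1, ← (hg i).left_inv b hb.1, h1]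
  rw [hdec, lintegral_iUnion hmeas
    (fun i j hij => (hdisj hij).mono inter_subset_left inter_subset_left)]
  simp [hone]

/-- In a chart of `M`, the covering has `m` sheets. -/
theorem map_chart (hQ : IsBallQuotient m Γ F B M M₂) (h : IsChartWith n M Ω φ U ρ)
    {P : Set (Fin n → ℂ)} (hP : MeasurableSet P) :
    Measure.map (fun z => ρ (F z)) ((volume.restrict
      (B ∩ F ⁻¹' U ∩ (fun z => ρ (F z)) ⁻¹' P)).withDensity
        fun z => ‖jac (fun z => ρ (F z)) z‖ₑ ^ 2) =
      (m : ENNReal) • volume.restrict (Ω ∩ φ ⁻¹' M₂ ∩ P) := by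
  have hR := hQ.isOpen_preimage h.isOpen_target
  have hqan := hQ.analytic_chart h
  have hΩ₂ := hQ.isOpen_chart_inter h
  have hmem : ∀ z ∈ B ∩ F ⁻¹' U, ρ (F z) ∈ Ω ∩ φ ⁻¹' M₂ := fun z hz => (hQ.chart_mem h hz).2.2
  choose! W hW hqW hWE using fun q₀ (hq₀ : q₀ ∈ M₂) => hQ.lintegral_sheet h hq₀
  set q : (Fin n → ℂ) → (Fin n → ℂ) := fun z => ρ (F z)
  set R := B ∩ F ⁻¹' U
  have haem : ∀ A ⊆ R, AEMeasurable q (volume.restrict A) := fun A hA =>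
    (hqan.continuousOn.aemeasurable hR.measurableSet).mono_measure (Measure.restrict_mono_set _ hA)
  have hval : ∀ A ⊆ R, MeasurableSet A → ∀ E, MeasurableSet E →
      Measure.map q ((volume.restrict A).withDensity fun z => ‖jac q z‖ₑ ^ 2) E =
        ∫⁻ z in q ⁻¹' E ∩ A, ‖jac q z‖ₑ ^ 2 := by
    intro A hA hAm E hE
    rw [Measure.map_apply_of_aemeasurable
      ((haem A hA).mono_ac (withDensity_absolutelyContinuous _ _)) hE, withDensity_apply',
      Measure.restrict_restrict' hAm]
  have key : ∀ E, MeasurableSet E →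
      ∫⁻ z in R ∩ q ⁻¹' E, ‖jac q z‖ₑ ^ 2 = m * volume (Ω ∩ φ ⁻¹' M₂ ∩ E) := by
    -- Countably many evenly covered sets suffice; two measures that agree on each of them agree on
    -- their union.
    obtain ⟨t, htM, htc, hcov⟩ := TopologicalSpace.countable_cover_nhdsWithin (s := M₂) (f := W)
      fun x hx => mem_nhdsWithin_of_mem_nhds ((hW x hx).mem_nhds (hqW x hx))
    have := htc.to_subtype
    intro E hE
    have h1 : R ∩ q ⁻¹' E = R ∩ q ⁻¹' (Ω ∩ φ ⁻¹' M₂ ∩ E) := by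
      ext z
      exact ⟨fun hz => ⟨hz.1, hmem z hz.1, hz.2⟩, fun hz => ⟨hz.1, hz.2.2⟩⟩
    have h2 : (Measure.map q ((volume.restrict R).withDensity fun z => ‖jac q z‖ₑ ^ 2)).restrict
        (⋃ x : t, Ω ∩ φ ⁻¹' W x) =
        ((m : ENNReal) • (volume : Measure (Fin n → ℂ))).restrict (⋃ x : t, Ω ∩ φ ⁻¹' W x) := by
      rw [Measure.restrict_iUnion_congr]
      intro x
      have hS := (h.isOpen_inter_preimage (hW x (htM x.2))).measurableSet
      ext E' hE'
      rw [Measure.restrict_apply hE', Measure.restrict_apply hE',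
        hval R subset_rfl hR.measurableSet _ (hE'.inter hS), inter_comm,
        hWE x (htM x.2) _ inter_subset_right (hE'.inter hS)]
      rfl
    have h3 : Ω ∩ φ ⁻¹' M₂ ∩ E ⊆ ⋃ x : t, Ω ∩ φ ⁻¹' W x := by
      intro z hz
      obtain ⟨x, hx, hzx⟩ := mem_iUnion₂.1 (hcov hz.1.2)
      exact mem_iUnion.2 ⟨⟨x, hx⟩, hz.1.1, hzx⟩
    have hE' : MeasurableSet (Ω ∩ φ ⁻¹' M₂ ∩ E) := hΩ₂.measurableSet.inter hE
    have h4 := congrArg (fun μ => μ (Ω ∩ φ ⁻¹' M₂ ∩ E)) h2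
    simp only [Measure.restrict_apply hE', inter_eq_left.2 h3] at h4
    rw [hval R subset_rfl hR.measurableSet _ hE', inter_comm, ← h1] at h4
    exact h4
  ext E hE
  rw [hval _ inter_subset_left
    (measurableSet_inter_preimage hR hqan.continuousOn hP) E hE, Measure.smul_apply, Measure.restrict_apply hE, smul_eq_mul]
  have := key (E ∩ P) (hE.inter hP)
  rw [show R ∩ q ⁻¹' (E ∩ P) = q ⁻¹' E ∩ (R ∩ q ⁻¹' P) by ext z; simp; tauto] at this
  rw [this]
  congr 2
  ext z; simp; tauto

theorem aemeasurable_chart (hQ : IsBallQuotient m Γ F B M M₂) (h : IsChartWith n M Ω φ U ρ)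
    {A : Set (Fin n → ℂ)} (hA : A ⊆ B ∩ F ⁻¹' U) :
    AEMeasurable (fun z => ρ (F z)) (volume.restrict A) ∧
      AEMeasurable (fun z => ‖jac (fun z => ρ (F z)) z‖₊ ^ 2) (volume.restrict A) := by
  have hR := (hQ.isOpen_preimage h.isOpen_target).measurableSet
  have hqan := hQ.analytic_chart h
  exact ⟨(hqan.continuousOn.aemeasurable hR).mono_measure (Measure.restrict_mono_set _ hA),
    (((analyticOnNhd_jac hqan).continuousOn.aemeasurable hR).mono_measure
      (Measure.restrict_mono_set _ hA)).nnnorm.pow_const 2⟩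

theorem lintegral_chart (hQ : IsBallQuotient m Γ F B M M₂) (h : IsChartWith n M Ω φ U ρ)
    {P : Set (Fin n → ℂ)} (hP : MeasurableSet P) {f : (Fin n → ℂ) → ENNReal}
    (hf : AEMeasurable f (volume.restrict (Ω ∩ φ ⁻¹' M₂ ∩ P))) :
    ∫⁻ z in B ∩ F ⁻¹' U ∩ (fun z => ρ (F z)) ⁻¹' P,
      ‖jac (fun z => ρ (F z)) z‖ₑ ^ 2 * f (ρ (F z)) = m * ∫⁻ w in Ω ∩ φ ⁻¹' M₂ ∩ P, f w := by
  obtain ⟨h1, h2⟩ := hQ.aemeasurable_chart h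
    (A := B ∩ F ⁻¹' U ∩ (fun z => ρ (F z)) ⁻¹' P) inter_subset_left
  have h1' := h1.mono_ac (withDensity_absolutelyContinuous _
    fun z => ‖jac (fun z => ρ (F z)) z‖ₑ ^ 2)
  have hmap := hQ.map_chart h hP
  have hf' := hf.smul_measure (m : ENNReal)
  rw [← hmap] at hf'
  have key := lintegral_map' hf' h1'
  rw [hmap, lintegral_smul_measure] at key
  rw [← smul_eq_mul, key]
  exact (lintegral_withDensity_eq_lintegral_mul₀' (by
    simpa [enorm_eq_nnnorm] using h2.coe_nnreal_ennreal)
    (hf'.comp_aemeasurable h1')).symm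

theorem integral_chart (hQ : IsBallQuotient m Γ F B M M₂) (h : IsChartWith n M Ω φ U ρ)
    {P : Set (Fin n → ℂ)} (hP : MeasurableSet P) {f : (Fin n → ℂ) → ℂ}
    (hf : AEStronglyMeasurable f (volume.restrict (Ω ∩ φ ⁻¹' M₂ ∩ P))) :
    ∫ z in B ∩ F ⁻¹' U ∩ (fun z => ρ (F z)) ⁻¹' P,
      (‖jac (fun z => ρ (F z)) z‖ : ℂ) ^ 2 * f (ρ (F z)) =
        m * ∫ w in Ω ∩ φ ⁻¹' M₂ ∩ P, f w := by
  obtain ⟨h1, h2⟩ := hQ.aemeasurable_chart h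
    (A := B ∩ F ⁻¹' U ∩ (fun z => ρ (F z)) ⁻¹' P) inter_subset_left
  have h1' := h1.mono_ac (withDensity_absolutelyContinuous _
    fun z => ‖jac (fun z => ρ (F z)) z‖ₑ ^ 2)
  have hmap := hQ.map_chart h hP
  have hf' := hf.smul_measure (m : ENNReal)
  rw [← hmap] at hf'
  have key := integral_map h1' hf'
  have h3 := integral_withDensity_eq_integral_smul₀ h2 fun z => f (ρ (F z))
  rw [hmap, integral_smul_measure] at key
  have h4 : (m : ℂ) * ∫ w in Ω ∩ φ ⁻¹' M₂ ∩ P, f w =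
      (m : ENNReal).toReal • ∫ w in Ω ∩ φ ⁻¹' M₂ ∩ P, f w := by simp
  rw [h4, key]
  refine Eq.trans (integral_congr_ae (Eventually.of_forall fun z => ?_)) (h3.symm.trans ?_)
  · simp [NNReal.smul_def]
  · congr 2

end IsBallQuotient

/-! ### The unitary action, orbits of Γ, and descent of invariant functions. -/

/-- The linear action as a continuous linear map. -/
def actL {n : ℕ} (γ : Matrix.unitaryGroup (Fin n) ℂ) : (Fin n → ℂ) →L[ℂ] (Fin n → ℂ) :=
  LinearMap.toContinuousLinearMap (Matrix.toLin' (γ : Matrix (Fin n) (Fin n) ℂ))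

lemma actL_apply {n : ℕ} (γ : Matrix.unitaryGroup (Fin n) ℂ) (z : Fin n → ℂ) :
    actL γ z = act γ z := rfl

/-- The determinant of a unitary matrix. -/
def udet {n : ℕ} (γ : Matrix.unitaryGroup (Fin n) ℂ) : ℂ :=
  (γ : Matrix (Fin n) (Fin n) ℂ).det

lemma norm_udet {n : ℕ} (γ : Matrix.unitaryGroup (Fin n) ℂ) : ‖udet γ‖ = 1 :=
  CStarRing.norm_of_mem_unitary (Matrix.det_of_mem_unitary γ.2)

lemma udet_mul {n : ℕ} (γ δ : Matrix.unitaryGroup (Fin n) ℂ) : udet (γ * δ) = udet γ * udet δ :=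
  Matrix.det_mul _ _

lemma det_actL {n : ℕ} (γ : Matrix.unitaryGroup (Fin n) ℂ) :
    LinearMap.det (actL γ : (Fin n → ℂ) →ₗ[ℂ] (Fin n → ℂ)) = udet γ :=
  LinearMap.det_toLin' _

lemma act_mul {n : ℕ} (γ δ : Matrix.unitaryGroup (Fin n) ℂ) (z : Fin n → ℂ) :
    act (γ * δ) z = act γ (act δ z) := by
  simp [act, Matrix.mulVec_mulVec]

lemma act_one {n : ℕ} (z : Fin n → ℂ) : act 1 z = z := by
  simp [act]

lemma act_injective {n : ℕ} (γ : Matrix.unitaryGroup (Fin n) ℂ) : Function.Injective (act γ) :=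
  fun a b hab => by
    rw [← act_one a, ← act_one b, ← inv_mul_cancel γ, act_mul, act_mul, hab]

lemma eq_one_of_eventually_act_eq {n : ℕ} {γ : Matrix.unitaryGroup (Fin n) ℂ} {z : Fin n → ℂ}
    (h : ∀ᶠ w in 𝓝 z, act γ w = w) : γ = 1 := by
  have h1 : (fun w => actL γ w) =ᶠ[𝓝 z] id := h
  have h2 := h1.fderiv_eq (𝕜 := ℂ)
  rw [ContinuousLinearMap.fderiv, fderiv_id] at h2
  refine Subtype.ext (Matrix.toLin'.injective (LinearMap.ext fun v => ?_))
  exact (congrArg (fun L : (Fin n → ℂ) →L[ℂ] (Fin n → ℂ) => L v) h2).trans (by simp)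

/-- Square integrable holomorphic functions `h` on `B` for which the form `h dz₁ ∧ ⋯ ∧ dzₙ` is
invariant under `Γ`. -/
structure IsInvariant {n : ℕ} (Γ : Subgroup (Matrix.unitaryGroup (Fin n) ℂ))
    (B : Set (Fin n → ℂ)) (h : (Fin n → ℂ) → ℂ) : Prop where
  analytic : AnalyticOnNhd ℂ h B
  invariant : ∀ γ ∈ Γ, ∀ z ∈ B, h (act γ z) * udet γ = h z
  finite : ∫⁻ z in B, ‖h z‖ₑ ^ 2 < ⊤

/-- Continuous functions agreeing off a thin set agree. -/
lemma IsThinIn.eqOn {n : ℕ} {A Ω O : Set (Fin n → ℂ)} (hA : IsThinIn A Ω) (hO : IsOpen O)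
    (hOΩ : O ⊆ Ω) {f g : (Fin n → ℂ) → ℂ} (hf : ContinuousOn f O) (hg : ContinuousOn g O)
    (h : ∀ z ∈ O \ A, f z = g z) : EqOn f g O := by
  intro p hp
  by_contra hne
  have h1 : ∀ᶠ z in 𝓝 p, f z ≠ g z := by
    have := ((hf.continuousAt (hO.mem_nhds hp)).prodMk (hg.continuousAt (hO.mem_nhds hp)))
    exact this.eventually (isClosed_diagonal.isOpen_compl.mem_nhds (by simpa using hne))
  obtain ⟨z, hz, hzn, hzO⟩ := ((hA.frequently_notMem (hOΩ hp)).and_eventually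
    (h1.and (hO.mem_nhds hp))).exists
  exact hzn (h z ⟨hzO, hz⟩)

namespace IsBallQuotient

variable {n N m : ℕ} {Γ : Subgroup (Matrix.unitaryGroup (Fin n) ℂ)}
  {F : (Fin n → ℂ) → (Fin N → ℂ)} {B : Set (Fin n → ℂ)} {M M₂ : Set (Fin N → ℂ)}
  {Ω : Set (Fin n → ℂ)} {φ : (Fin n → ℂ) → (Fin N → ℂ)} {U : Set (Fin N → ℂ)}
  {ρ : (Fin N → ℂ) → (Fin n → ℂ)}

theorem exists_sheet (hQ : IsBallQuotient m Γ F B M M₂) {q : Fin N → ℂ} (hq : q ∈ M₂) :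
    ∃ W S g, IsChartWith n M S F W g ∧ S ⊆ B ∧ q ∈ W := by
  obtain ⟨W, -, hqW, -, S, -, hun, hg⟩ := hQ.sheets q hq
  obtain ⟨g, hg⟩ := hg ⟨0, hQ.pos⟩
  exact ⟨W, _, g, hg, fun z hz => (hun ▸ mem_iUnion_of_mem _ hz : z ∈ B ∩ F ⁻¹' W).1, hqW⟩

theorem exists_sheet_at (hQ : IsBallQuotient m Γ F B M M₂) {z : Fin n → ℂ} (hz : z ∈ B) :
    ∃ W S g, IsChartWith n M S F W g ∧ z ∈ S := by
  obtain ⟨W, -, hqW, -, S, -, hun, hg⟩ := hQ.sheets _ (hQ.mapsTo hz)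
  obtain ⟨i, hi⟩ := mem_iUnion.1 (hun.symm ▸ (⟨hz, hqW⟩ : z ∈ B ∩ F ⁻¹' W) : z ∈ ⋃ i, S i)
  obtain ⟨g, hg⟩ := hg i
  exact ⟨W, S i, g, hg, hi⟩

theorem exists_preimage (hQ : IsBallQuotient m Γ F B M M₂) {q : Fin N → ℂ} (hq : q ∈ M₂) :
    ∃ z ∈ B, F z = q := by
  obtain ⟨W, S, g, hg, hS, hqW⟩ := hQ.exists_sheet hq
  obtain ⟨h1, h2⟩ := hg.inv_mem ⟨hQ.subset hq, hqW⟩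
  exact ⟨_, hS h1, h2⟩

/-- If γ fixes z, it maps points near z into the sheet through z without changing F. As F is
injective on the sheet, γ is the identity near z, hence everywhere by linearity. -/
theorem free (hQ : IsBallQuotient m Γ F B M M₂) {γ : Matrix.unitaryGroup (Fin n) ℂ} (hγ : γ ∈ Γ)
    {z : Fin n → ℂ} (hz : z ∈ B) (h : act γ z = z) : γ = 1 := by
  obtain ⟨W, S, g, hg, hzS⟩ := hQ.exists_sheet_at hz
  refine eq_one_of_eventually_act_eq (z := z) ?_
  have hc : ContinuousAt (act γ) z := (actL γ).continuous.continuousAt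
  have h1 : ∀ᶠ w in 𝓝 z, act γ w ∈ S :=
    hc.eventually_mem (by rw [h]; exact hg.isOpen.mem_nhds hzS)
  filter_upwards [h1, hg.isOpen.mem_nhds hzS, hQ.isOpen.mem_nhds hz] with w hw hwS hwB
  rw [← hg.left_inv _ hw, (hQ.act_mem γ hγ w hwB).2, hg.left_inv w hwS]

/-- The fibres of the covering are the orbits of the group. -/
theorem exists_act_eq (hQ : IsBallQuotient m Γ F B M M₂) {z z' : Fin n → ℂ} (hz : z ∈ B)
    (hz' : z' ∈ B) (h : F z = F z') : ∃ γ ∈ Γ, act γ z = z' := by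
  have := hQ.finite
  obtain ⟨W, -, hqW, -, S, -, hun, hg⟩ := hQ.sheets _ (hQ.mapsTo hz)
  choose g hg using hg
  have hsub : {w | w ∈ B ∧ F w = F z} ⊆ range fun i => g i (F z) := by
    rintro w ⟨hw, hwz⟩
    obtain ⟨i, hi⟩ := mem_iUnion.1
      (hun.symm ▸ (⟨hw, by rw [mem_preimage, hwz]; exact hqW⟩ : w ∈ B ∩ F ⁻¹' W) : w ∈ ⋃ i, S i)
    exact ⟨i, by rw [← (hg i).left_inv w hi, hwz]⟩
  have hfin := (finite_range fun i => g i (F z)).subset hsub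
  have hcard : {w | w ∈ B ∧ F w = F z}.ncard ≤ m := by
    refine (ncard_le_ncard hsub (finite_range _)).trans ?_
    rw [← image_univ]
    refine (ncard_image_le finite_univ).trans ?_
    simp
  have hsub' : (range fun γ : Γ => act γ.1 z) ⊆ {w | w ∈ B ∧ F w = F z} := by
    rintro _ ⟨γ, rfl⟩
    exact hQ.act_mem γ.1 γ.2 z hz
  have hinj : Function.Injective fun γ : Γ => act γ.1 z := by
    intro γ δ hγδ
    have h1 : act (γ⁻¹ * δ).1 z = z := by
      change act (γ.1⁻¹ * δ.1) z = z
      rw [act_mul, ← show act γ.1 z = act δ.1 z from hγδ, ← act_mul, inv_mul_cancel, act_one]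
    have h2 := hQ.free (γ⁻¹ * δ).2 hz h1
    exact (inv_mul_eq_one.1 (Subtype.ext h2 : γ⁻¹ * δ = 1))
  -- The orbit has exactly m points by freeness and lies in the fibre, which has at most m points,
  -- one per sheet.
  have heq := eq_of_subset_of_ncard_le hsub' (by
    rw [← image_univ, ncard_image_of_injective _ hinj, ncard_univ, hQ.card]
    exact hcard) hfin
  obtain ⟨γ, hγ⟩ := heq.symm.subset (⟨hz', h.symm⟩ : z' ∈ {w | w ∈ B ∧ F w = F z})
  exact ⟨γ.1, γ.2, hγ⟩

/-- F ∘ γ = F makes the pulled back form Γ-invariant, and γ multiplies dz₁ ∧ ⋯ ∧ dzₙ by its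
determinant. -/
theorem coeff_act (hQ : IsBallQuotient m Γ F B M M₂) (ω : NForm N n)
    {γ : Matrix.unitaryGroup (Fin n) ℂ} (hγ : γ ∈ Γ) {z : Fin n → ℂ} (hz : z ∈ B) :
    coeff ω F (act γ z) * udet γ = coeff ω F z := by
  have h1 : F =ᶠ[𝓝 z] fun w => F (actL γ w) := by
    filter_upwards [hQ.isOpen.mem_nhds hz] with w hw
    exact (hQ.act_mem γ hγ w hw).2.symm
  have hA : fderiv ℂ F z = (fderiv ℂ F (act γ z)).comp (actL γ) := by
    have hd : DifferentiableAt ℂ F (actL γ z) :=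
      (hQ.analytic _ (hQ.act_mem γ hγ z hz).1).differentiableAt
    rw [h1.fderiv_eq, fderiv_fun_comp (g := F) z hd (actL γ).differentiableAt,
      ContinuousLinearMap.fderiv]
    rfl
  rw [coeff_eq_of_fderiv_eq ω (hQ.act_mem γ hγ z hz).2.symm hA, det_actL]

theorem jac_act (hQ : IsBallQuotient m Γ F B M M₂) (h : IsChartWith n M Ω φ U ρ)
    {γ : Matrix.unitaryGroup (Fin n) ℂ} (hγ : γ ∈ Γ) {z : Fin n → ℂ} (hz : z ∈ B ∩ F ⁻¹' U) :
    jac (fun z => ρ (F z)) (act γ z) * udet γ = jac (fun z => ρ (F z)) z := by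
  have hγz := hQ.act_mem γ hγ z hz.1
  have h1 : (fun z => ρ (F z)) =ᶠ[𝓝 z] fun w => ρ (F (actL γ w)) := by
    filter_upwards [hQ.isOpen.mem_nhds hz.1] with w hw
    rw [actL_apply, (hQ.act_mem γ hγ w hw).2]
  have hd : DifferentiableAt ℂ (fun z => ρ (F z)) (actL γ z) :=
    (hQ.analytic_chart h _ ⟨hγz.1, by rw [mem_preimage, hγz.2]; exact hz.2⟩).differentiableAt
  have hA : fderiv ℂ (fun z => ρ (F z)) z =
      (fderiv ℂ (fun z => ρ (F z)) (act γ z)).comp (actL γ) := by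
    rw [h1.fderiv_eq, fderiv_fun_comp (g := fun z => ρ (F z)) z hd (actL γ).differentiableAt,
      ContinuousLinearMap.fderiv]
    rfl
  rw [jac, jac, hA, ← det_actL, ← LinearMap.det_comp]
  rfl

/-- F restricted to a sheet is a chart, so its derivative is injective, and it factors through the
derivative of ρ ∘ F. -/
theorem jac_ne_zero (hQ : IsBallQuotient m Γ F B M M₂) (h : IsChartWith n M Ω φ U ρ)
    {z : Fin n → ℂ} (hz : z ∈ B ∩ F ⁻¹' U) : jac (fun z => ρ (F z)) z ≠ 0 := by
  obtain ⟨W, S, g, hg, hzS⟩ := hQ.exists_sheet_at hz.1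
  have h1 := h.fderiv_comp (hQ.isOpen_preimage h.isOpen_target)
    (hQ.analytic.mono inter_subset_left)
      (fun _ hw => ⟨hQ.subset (hQ.mapsTo hw.1), hw.2⟩) hz
  have hinj : Function.Injective (fderiv ℂ (fun z => ρ (F z)) z) := by
    intro a b hab
    refine hg.fderiv_injective hzS ?_
    rw [h1, ContinuousLinearMap.comp_apply, ContinuousLinearMap.comp_apply, hab]
  have h2 : LinearMap.ker (fderiv ℂ (fun z => ρ (F z)) z : (Fin n → ℂ) →ₗ[ℂ] (Fin n → ℂ)) = ⊥ :=
    LinearMap.ker_eq_bot.2 hinj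
  intro h0
  exact (LinearMap.bot_lt_ker_of_det_eq_zero h0).ne' h2

/-- An invariant function descends to every chart of `M`. -/
theorem exists_descent (hQ : IsBallQuotient m Γ F B M M₂) (h : IsChartWith n M Ω φ U ρ)
    {f : (Fin n → ℂ) → ℂ} (hf : IsInvariant Γ B f) :
    ∃ H : (Fin n → ℂ) → ℂ, AnalyticOnNhd ℂ H Ω ∧
      ∀ z ∈ B ∩ F ⁻¹' U, f z = H (ρ (F z)) * jac (fun z => ρ (F z)) z := by
  choose! lift hliftB hlift using fun q (hq : q ∈ M₂) => hQ.exists_preimage hq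
  set q : (Fin n → ℂ) → (Fin n → ℂ) := fun z => ρ (F z)
  have hqan := hQ.analytic_chart h
  -- The quotient at an arbitrarily chosen preimage; the choice is immaterial because f and the
  -- Jacobian change by the same factor under Γ.
  let H₀ : (Fin n → ℂ) → ℂ := fun w => f (lift (φ w)) / jac q (lift (φ w))
  have hH₀ : ∀ z ∈ B ∩ F ⁻¹' U, f z = H₀ (q z) * jac q z := by
    intro z hz
    have hφq : φ (q z) = F z := (hQ.chart_mem h hz).2.1
    have hM : F z ∈ M₂ := hQ.mapsTo hz.1
    obtain ⟨γ, hγ, hγz⟩ := hQ.exists_act_eq hz.1 (hliftB _ hM) (hlift _ hM).symm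
    have h0 : jac q (act γ z) ≠ 0 := hQ.jac_ne_zero h
      ⟨hγz ▸ hliftB _ hM, by rw [mem_preimage, (hQ.act_mem γ hγ z hz.1).2]; exact hz.2⟩
    simp only [H₀, hφq, ← hγz]
    rw [← hQ.jac_act h hγ hz, ← hf.invariant γ hγ z hz.1]
    field_simp
    rfl
  have han : AnalyticOnNhd ℂ H₀ (Ω ∩ φ ⁻¹' M₂) := by
    intro w hw
    obtain ⟨W, S, g, hg, hS, hwW⟩ := hQ.exists_sheet hw.2
    have hev : ∀ᶠ w' in 𝓝 w, w' ∈ Ω ∩ φ ⁻¹' W :=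
      (h.isOpen_inter_preimage hg.isOpen_target).mem_nhds ⟨hw.1, hwW⟩
    have hgm : ∀ w' ∈ Ω ∩ φ ⁻¹' W, g (φ w') ∈ B ∩ F ⁻¹' U ∧ q (g (φ w')) = w' := by
      intro w' hw'
      have hm := h.mem hw'.1
      obtain ⟨h1, h2⟩ := hg.inv_mem ⟨hm.1, hw'.2⟩
      refine ⟨⟨hS h1, by rw [mem_preimage, h2]; exact hm.2⟩, ?_⟩
      change ρ (F _) = w'
      rw [h2, h.left_inv w' hw'.1]
    have hgan : AnalyticAt ℂ (fun w => g (φ w)) w :=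
      (hg.analytic_inv _ hwW).comp (h.analytic w hw.1)
    have hm := (hgm w ⟨hw.1, hwW⟩).1
    have h2 : AnalyticAt ℂ (fun w => f (g (φ w)) / jac q (g (φ w))) w :=
      (AnalyticAt.comp (g := f) (f := fun w => g (φ w)) (hf.analytic _ hm.1) hgan).div
        (AnalyticAt.comp (g := jac q) (f := fun w => g (φ w)) (analyticOnNhd_jac hqan _ hm) hgan)
        (hQ.jac_ne_zero h hm)
    refine h2.congr ?_
    filter_upwards [hev] with w' hw'
    obtain ⟨h3, h4⟩ := hgm w' hw'
    rw [hH₀ _ h3, h4, mul_div_cancel_right₀ _ (hQ.jac_ne_zero h h3)]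
  have hΩ₂ := hQ.isOpen_chart_inter h
  have hsd : Ω \ (Ω \ φ ⁻¹' M₂) = Ω ∩ φ ⁻¹' M₂ := by ext; simp
  -- By the m-sheeted change of variables, m times this integral is at most the norm of f on B.
  -- Square integrability then extends H₀ over the part of the chart outside M₂.
  have hint : ∫⁻ w in Ω ∩ φ ⁻¹' M₂, ‖H₀ w‖ₑ ^ 2 ≠ ⊤ := by
    have h1 := hQ.lintegral_chart h MeasurableSet.univ (f := fun w => ‖H₀ w‖ₑ ^ 2) (by
      rw [inter_univ]
      exact (han.continuousOn.aemeasurable hΩ₂.measurableSet).enorm.pow_const 2)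
    simp only [preimage_univ, inter_univ] at h1
    intro htop
    rw [htop, ENNReal.mul_top (by exact_mod_cast hQ.pos.ne')] at h1
    refine absurd h1 (ne_of_lt (lt_of_le_of_lt ?_ hf.finite))
    refine (setLIntegral_mono' (hQ.isOpen_preimage h.isOpen_target).measurableSet
      (g := fun z => ‖f z‖ₑ ^ 2) fun z hz => le_of_eq ?_).trans
      (lintegral_mono_set inter_subset_left)
    rw [hH₀ z hz, enorm_mul, mul_pow, mul_comm]
  obtain ⟨H, hH, hHeq⟩ := exists_analytic_extension h.isOpen (A := Ω \ φ ⁻¹' M₂)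
    (by rwa [hsd]) (hQ.thin_preimage Ω φ h.isChart) (by rwa [hsd])
    fun p _ => ⟨univ, univ_mem, by rwa [hsd, univ_inter]⟩
  refine ⟨H, hH, fun z hz => ?_⟩
  rw [hH₀ z hz, hHeq (hsd ▸ (hQ.chart_mem h hz).2.2)]

end IsBallQuotient

/-! ### Forms on M and invariant functions on B. -/

/-- The standard `n`-form `dz₁ ∧ ⋯ ∧ dzₙ` on `ℂⁿ`. -/
def stdForm (n : ℕ) : (Fin n → ℂ) [⋀^Fin n]→ₗ[ℂ] ℂ := (Pi.basisFun ℂ (Fin n)).det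

lemma stdForm_single {n : ℕ} : stdForm n (fun j => Pi.single j 1) = 1 := by
  have h2 : (fun j => Pi.single j 1 : Fin n → Fin n → ℂ) = Pi.basisFun ℂ (Fin n) := by
    ext1 j; simp
  rw [h2, stdForm, Module.Basis.det_self]

theorem IsInvariant.memLp {n : ℕ} {Γ : Subgroup (Matrix.unitaryGroup (Fin n) ℂ)}
    {B : Set (Fin n → ℂ)} {h : (Fin n → ℂ) → ℂ} (hh : IsInvariant Γ B h) (hB : IsOpen B) :
    MemLp h 2 (volume.restrict B) := by
  refine ⟨hh.analytic.continuousOn.aestronglyMeasurable hB.measurableSet, ?_⟩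
  rw [eLpNorm_lt_top_iff_lintegral_rpow_enorm_lt_top two_ne_zero ENNReal.ofNat_ne_top]
  simpa using hh.finite

namespace CountableAtlas

variable {n N : ℕ} {M : Set (Fin N → ℂ)} (𝒜 : CountableAtlas n M)

theorem measurableSet_piece (k : ℕ) : MeasurableSet (𝒜.piece k) := by
  obtain ⟨U, ρ, h⟩ := (𝒜.isChart k).exists_isChartWith
  choose V σ hV using fun j => (𝒜.isChart j).exists_isChartWith
  have : 𝒜.piece k = 𝒜.dom k \ ⋃ j ∈ Iio k, 𝒜.dom k ∩ 𝒜.param k ⁻¹' V j := by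
    ext z
    simp only [piece, mem_ofPred_eq, Set.mem_sdiff, mem_iUnion, not_exists, mem_inter_iff, mem_Iio]
    refine and_congr_right fun hz => forall₂_congr fun j _ => ?_
    rw [(hV j).image_eq, not_and, mem_inter_iff, not_and]
    exact ⟨fun h' _ => h' (h.mem hz).1, fun h' _ => h' hz⟩
  rw [this]
  exact h.isOpen.measurableSet.diff (MeasurableSet.biUnion (to_countable _)
    fun j _ => (h.isOpen_inter_preimage (hV j).isOpen_target).measurableSet)

end CountableAtlas

namespace IsBallQuotient

variable {n N m : ℕ} {Γ : Subgroup (Matrix.unitaryGroup (Fin n) ℂ)}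
  {F : (Fin n → ℂ) → (Fin N → ℂ)} {B : Set (Fin n → ℂ)} {M M₂ : Set (Fin N → ℂ)}
  {Ω : Set (Fin n → ℂ)} {φ : (Fin n → ℂ) → (Fin N → ℂ)} {U : Set (Fin N → ℂ)}
  {ρ : (Fin N → ℂ) → (Fin n → ℂ)}

/-- Continuous functions on a chart domain are determined over the base of the covering. -/
theorem eqOn_chart (hQ : IsBallQuotient m Γ F B M M₂) (h : IsChartWith n M Ω φ U ρ)
    {O : Set (Fin n → ℂ)} (hO : IsOpen O) (hOΩ : O ⊆ Ω) {f g : (Fin n → ℂ) → ℂ}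
    (hf : ContinuousOn f O) (hg : ContinuousOn g O)
    (hfg : ∀ z ∈ B ∩ F ⁻¹' U, ρ (F z) ∈ O → f (ρ (F z)) = g (ρ (F z))) : EqOn f g O := by
  refine (hQ.thin_preimage Ω φ h.isChart).eqOn hO hOΩ hf hg fun w hw => ?_
  have hwM : φ w ∈ M₂ := by
    by_contra hc
    exact hw.2 ⟨hOΩ hw.1, hc⟩
  obtain ⟨z, hz, hFz⟩ := hQ.exists_preimage hwM
  have h1 : ρ (F z) = w := by rw [hFz, h.left_inv w (hOΩ hw.1)]
  have := hfg z ⟨hz, by rw [mem_preimage, hFz]; exact (h.mem (hOΩ hw.1)).2⟩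
  rw [h1] at this
  exact this hw.1

/-- Makes the local descents of f fit together as coefficients of one form: over M₂ the rule follows
by cancelling the nonzero Jacobian, elsewhere by continuity. -/
theorem descent_unique (hQ : IsBallQuotient m Γ F B M M₂) (h : IsChartWith n M Ω φ U ρ)
    {Ω' : Set (Fin n → ℂ)} {φ' : (Fin n → ℂ) → (Fin N → ℂ)} {U' : Set (Fin N → ℂ)}
    {ρ' : (Fin N → ℂ) → (Fin n → ℂ)} (h' : IsChartWith n M Ω' φ' U' ρ') {f H H' : (Fin n → ℂ) → ℂ}
    (hH : AnalyticOnNhd ℂ H Ω) (hH' : AnalyticOnNhd ℂ H' Ω')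
    (hHf : ∀ z ∈ B ∩ F ⁻¹' U, f z = H (ρ (F z)) * jac (fun z => ρ (F z)) z)
    (hHf' : ∀ z ∈ B ∩ F ⁻¹' U', f z = H' (ρ' (F z)) * jac (fun z => ρ' (F z)) z) :
    ∀ w ∈ Ω ∩ φ ⁻¹' U', H w = H' (ρ' (φ w)) * jac (fun w => ρ' (φ w)) w := by
  have hO := h.isOpen_inter_preimage h'.isOpen_target
  have hτ : AnalyticOnNhd ℂ (fun w => ρ' (φ w)) (Ω ∩ φ ⁻¹' U') :=
    h'.comp_analytic (h.analytic.mono inter_subset_left) fun w hw => ⟨(h.mem hw.1).1, hw.2⟩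
  refine hQ.eqOn_chart h hO inter_subset_left (hH.mono inter_subset_left).continuousOn ?_ ?_
  · refine AnalyticOnNhd.continuousOn (𝕜 := ℂ) ((AnalyticOnNhd.comp (t := Ω') hH' hτ ?_).mul
      (analyticOnNhd_jac hτ))
    exact fun w hw => (h'.inv_mem ⟨(h.mem hw.1).1, hw.2⟩).1
  · intro z hz hzO
    have h1 := (hQ.chart_mem h hz).2.1
    have hz' : z ∈ B ∩ F ⁻¹' U' := ⟨hz.1, by rw [mem_preimage, ← h1]; exact hzO.2⟩
    have h2 := (hHf z hz).symm.trans (hHf' z hz')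
    have h3 : jac (fun z => ρ' (F z)) z =
        jac (fun w => ρ' (φ w)) (ρ (F z)) * jac (fun z => ρ (F z)) z := by
      have hev : (fun z => ρ' (F z)) =ᶠ[𝓝 z] fun z => ρ' (φ (ρ (F z))) := by
        filter_upwards [(hQ.isOpen_preimage h.isOpen_target).mem_nhds hz] with y hy
        rw [(hQ.chart_mem h hy).2.1]
      rw [jac, hev.fderiv_eq, fderiv_fun_comp (g := fun w => ρ' (φ w)) z
        (hτ _ hzO).differentiableAt (hQ.analytic_chart h z hz).differentiableAt]
      exact LinearMap.det_comp _ _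
    rw [h3, ← mul_assoc] at h2
    rw [mul_right_cancel₀ (hQ.jac_ne_zero h hz) h2, h1]

/-- Every invariant function comes from a holomorphic form on `M`. -/
theorem exists_form (hQ : IsBallQuotient m Γ F B M M₂) {f : (Fin n → ℂ) → ℂ}
    (hf : IsInvariant Γ B f) :
    ∃ ω : NForm N n, IsHolomorphicForm M ω ∧ ∀ z ∈ B, coeff ω F z = f z := by
  classical
  choose! Ωc φc Uc ρc hc hpc using hQ.exists_chart
  choose! H hH hHf using fun p (hp : p ∈ M) => hQ.exists_descent (hc p hp) hf
  -- At x the chart chosen for x itself is used. The choice varies without any regularity, but by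
  -- `descent_unique` the coefficient in a fixed chart does not see it.
  let ω : NForm N n := fun x => H x (ρc x x) •
    (stdForm n).compLinearMap (fderiv ℂ (ρc x) x : (Fin N → ℂ) →ₗ[ℂ] (Fin n → ℂ))
  have hω : ∀ (Ω : Set (Fin n → ℂ)) φ U ρ (h : IsChartWith n M Ω φ U ρ) (H' : (Fin n → ℂ) → ℂ),
      AnalyticOnNhd ℂ H' Ω → (∀ z ∈ B ∩ F ⁻¹' U, f z = H' (ρ (F z)) * jac (fun z => ρ (F z)) z) →
      ∀ w ∈ Ω, coeff ω φ w = H' w := by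
    intro Ω φ U ρ h H' hH' hHf' w hw
    have hwM := (h.mem hw).1
    have hwU : φ w ∈ Uc (φ w) := by
      have := hpc _ hwM
      rw [(hc _ hwM).image_eq] at this
      exact this.2
    rw [hQ.descent_unique h (hc _ hwM) hH' (hH _ hwM) hHf' (hHf _ hwM) w ⟨hw, hwU⟩]
    have h1 : fderiv ℂ (fun w' => ρc (φ w) (φ w')) w =
        (fderiv ℂ (ρc (φ w)) (φ w)).comp (fderiv ℂ φ w) :=
      fderiv_fun_comp (g := ρc (φ w)) w ((hc _ hwM).analytic_inv _ hwU).differentiableAt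
        (h.analytic w hw).differentiableAt
    have h2 := alternating_comp_eq_det_mul (stdForm n)
      (fderiv ℂ (fun w' => ρc (φ w) (φ w')) w : (Fin n → ℂ) →ₗ[ℂ] (Fin n → ℂ))
    rw [stdForm_single, one_mul] at h2
    rw [jac, ← h2, h1]
    rfl
  refine ⟨ω, fun Ω φ hφ => ?_, fun z hz => ?_⟩
  · obtain ⟨U, ρ, h⟩ := hφ.exists_isChartWith
    obtain ⟨H', hH', hHf'⟩ := hQ.exists_descent h hf
    exact hH'.congr h.isOpen fun w hw => (hω Ω φ U ρ h H' hH' hHf' w hw).symm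
  · have hM := hQ.subset (hQ.mapsTo hz)
    have h := hc _ hM
    have hzU : z ∈ B ∩ F ⁻¹' Uc (F z) := ⟨hz, ((h.image_eq ▸ hpc _ hM : F z ∈ M ∩ Uc (F z))).2⟩
    rw [hQ.coeff_eq h ω hzU, hω _ _ _ _ h _ (hH _ hM) (hHf _ hM) _ (hQ.chart_mem h hzU).1]
    exact (hHf _ hM z hzU).symm

theorem analytic_coeff (hQ : IsBallQuotient m Γ F B M M₂) {ω : NForm N n}
    (hω : IsHolomorphicForm M ω) : AnalyticOnNhd ℂ (coeff ω F) B := by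
  intro z hz
  obtain ⟨W, S, g, hg, hzS⟩ := hQ.exists_sheet_at hz
  exact hω S F hg.isChart z hzS

theorem vanishesOn (hQ : IsBallQuotient m Γ F B M M₂) {ω : NForm N n}
    (hω : IsHolomorphicForm M ω) (h0 : ∀ z ∈ B, coeff ω F z = 0) : VanishesOn M ω := by
  intro Ω φ hφ
  obtain ⟨U, ρ, h⟩ := hφ.exists_isChartWith
  refine hQ.eqOn_chart h h.isOpen subset_rfl (g := fun _ => 0) (hω Ω φ hφ).continuousOn
    continuousOn_const fun z hz _ => ?_
  have := h0 z hz.1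
  rw [hQ.coeff_eq h ω hz] at this
  exact (mul_eq_zero.1 this).resolve_right (hQ.jac_ne_zero h hz)

/-- The decomposition of `B` induced by the pieces of an atlas. -/
theorem atlas_decomposition (hQ : IsBallQuotient m Γ F B M M₂) (𝒜 : CountableAtlas n M)
    {V : ℕ → Set (Fin N → ℂ)} {σ : ℕ → (Fin N → ℂ) → (Fin n → ℂ)}
    (h : ∀ k, IsChartWith n M (𝒜.dom k) (𝒜.param k) (V k) (σ k)) :
    (⋃ k, B ∩ F ⁻¹' V k ∩ (fun z => σ k (F z)) ⁻¹' 𝒜.piece k) = B ∧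
    Pairwise (fun k l => Disjoint (B ∩ F ⁻¹' V k ∩ (fun z => σ k (F z)) ⁻¹' 𝒜.piece k)
      (B ∩ F ⁻¹' V l ∩ (fun z => σ l (F z)) ⁻¹' 𝒜.piece l)) ∧
    ∀ k, MeasurableSet (B ∩ F ⁻¹' V k ∩ (fun z => σ k (F z)) ⁻¹' 𝒜.piece k) := by
  classical
  refine ⟨Subset.antisymm (iUnion_subset fun k z hz => hz.1.1) fun z hz => ?_, ?_, fun k =>
    measurableSet_inter_preimage (hQ.isOpen_preimage (h k).isOpen_target)
      (hQ.analytic_chart (h k)).continuousOn (𝒜.measurableSet_piece k)⟩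
  · have hex : ∃ k, F z ∈ 𝒜.param k '' 𝒜.dom k := by
      have := hQ.subset (hQ.mapsTo hz)
      rw [𝒜.covers] at this
      exact mem_iUnion.1 this
    have hk := Nat.find_spec hex
    have hkV : z ∈ B ∩ F ⁻¹' V (Nat.find hex) := ⟨hz, ((h _).image_eq ▸ hk : _).2⟩
    refine mem_iUnion.2 ⟨Nat.find hex, hkV, (hQ.chart_mem (h _) hkV).1, fun j hj => ?_⟩
    rw [(hQ.chart_mem (h _) hkV).2.1]
    exact Nat.find_min hex hj
  · have key : ∀ k l, k < l → Disjoint (B ∩ F ⁻¹' V k ∩ (fun z => σ k (F z)) ⁻¹' 𝒜.piece k)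
      (B ∩ F ⁻¹' V l ∩ (fun z => σ l (F z)) ⁻¹' 𝒜.piece l) := by
      intro k l hkl
      refine Set.disjoint_left.2 fun z hzk hzl => hzl.2.2 k hkl ?_
      rw [(hQ.chart_mem (h l) hzl.1).2.1, ← (hQ.chart_mem (h k) hzk.1).2.1]
      exact mem_image_of_mem _ hzk.2.1
    intro k l hkl
    rcases lt_or_gt_of_ne hkl with hlt | hlt
    · exact key k l hlt
    · exact (key l k hlt).symm

theorem restrict_piece (hQ : IsBallQuotient m Γ F B M M₂) (𝒜 : CountableAtlas n M) (k : ℕ) :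
    (volume.restrict (𝒜.dom k ∩ 𝒜.param k ⁻¹' M₂ ∩ 𝒜.piece k) : Measure (Fin n → ℂ)) =
      volume.restrict (𝒜.piece k) := by
  refine Measure.restrict_congr_set ?_
  have h0 := (hQ.thin_preimage _ _ (𝒜.isChart k)).volume_eq_zero sdiff_subset
  have h1 : ∀ᵐ z : Fin n → ℂ, z ∉ 𝒜.dom k \ 𝒜.param k ⁻¹' M₂ := measure_eq_zero_iff_ae_notMem.1 h0
  filter_upwards [h1] with z hz
  refine propext ⟨fun h => h.2, fun h => ⟨⟨h.1, ?_⟩, h⟩⟩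
  by_contra hc
  exact hz ⟨h.1, hc⟩

/-- The change of variables is applied to each piece of the atlas; the preimages of the pieces
partition B, and the part of M outside M₂ is null in charts. -/
theorem lintegral_coeff (hQ : IsBallQuotient m Γ F B M M₂) (𝒜 : CountableAtlas n M)
    {ω : NForm N n} (hω : IsHolomorphicForm M ω) :
    (m : ENNReal) * ∑' k, (2 : ENNReal) ^ n * ∫⁻ z in 𝒜.piece k, ‖coeff ω (𝒜.param k) z‖ₑ ^ 2 =
      2 ^ n * ∫⁻ z in B, ‖coeff ω F z‖ₑ ^ 2 := by
  choose V σ h using fun k => (𝒜.isChart k).exists_isChartWith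
  obtain ⟨h1, h2, h3⟩ := hQ.atlas_decomposition 𝒜 h
  conv_rhs => rw [← h1]
  rw [lintegral_iUnion h3 h2, ENNReal.tsum_mul_left, mul_left_comm, ← ENNReal.tsum_mul_left]
  congr 2
  ext k
  have hae : AEMeasurable (fun z => ‖coeff ω (𝒜.param k) z‖ₑ ^ 2)
      (volume.restrict (𝒜.dom k ∩ 𝒜.param k ⁻¹' M₂ ∩ 𝒜.piece k)) := by
    have := ((hω _ _ (𝒜.isChart k)).continuousOn.aemeasurable (h k).isOpen.measurableSet
      (μ := volume)).mono_measure (Measure.restrict_mono_set volume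
        ((inter_subset_left.trans inter_subset_left :
          𝒜.dom k ∩ 𝒜.param k ⁻¹' M₂ ∩ 𝒜.piece k ⊆ 𝒜.dom k)))
    exact this.enorm.pow_const 2
  rw [← hQ.restrict_piece 𝒜 k, ← hQ.lintegral_chart (h k) (𝒜.measurableSet_piece k) hae]
  refine setLIntegral_congr_fun (h3 k) fun z hz => ?_
  rw [hQ.coeff_eq (h k) ω hz.1, enorm_mul, mul_pow, mul_comm]

theorem isInvariant_coeff (hQ : IsBallQuotient m Γ F B M M₂) (𝒜 : CountableAtlas n M)
    {ω : NForm N n} (hω : MemBergmanSpace 𝒜 ω) : IsInvariant Γ B (coeff ω F) := by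
  refine ⟨hQ.analytic_coeff hω.1, fun γ hγ z hz => hQ.coeff_act ω hγ hz, ?_⟩
  have h1 := hQ.lintegral_coeff 𝒜 hω.1
  have h2 : (2 : ENNReal) ^ n * ∫⁻ z in B, ‖coeff ω F z‖ₑ ^ 2 < ⊤ := by
    rw [← h1]
    exact ENNReal.mul_lt_top (ENNReal.natCast_lt_top m) hω.2
  exact ENNReal.lt_top_of_mul_ne_top_right h2.ne (pow_ne_zero _ two_ne_zero)

theorem memBergmanSpace (hQ : IsBallQuotient m Γ F B M M₂) (𝒜 : CountableAtlas n M)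
    {ω : NForm N n} (hω : IsHolomorphicForm M ω) (hfin : ∫⁻ z in B, ‖coeff ω F z‖ₑ ^ 2 < ⊤) :
    MemBergmanSpace 𝒜 ω := by
  refine ⟨hω, ENNReal.lt_top_of_mul_ne_top_right (a := (m : ENNReal)) ?_
    (by exact_mod_cast hQ.pos.ne')⟩
  rw [hQ.lintegral_coeff 𝒜 hω]
  exact (ENNReal.mul_lt_top (ENNReal.pow_lt_top (by simp)) hfin).ne

/-- The inner product of two square integrable forms, computed on the ball. -/
theorem l2Inner_eq (hQ : IsBallQuotient m Γ F B M M₂) (𝒜 : CountableAtlas n M)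
    {ω η : NForm N n} (hω : MemBergmanSpace 𝒜 ω) (hη : MemBergmanSpace 𝒜 η) :
    l2Inner 𝒜 ω η =
      (2 : ℂ) ^ n / m * ∫ z in B, coeff ω F z * (starRingEnd ℂ) (coeff η F z) := by
  choose V σ h using fun k => (𝒜.isChart k).exists_isChartWith
  obtain ⟨h1, h2, h3⟩ := hQ.atlas_decomposition 𝒜 h
  have hm : (m : ℂ) ≠ 0 := by exact_mod_cast hQ.pos.ne'
  have hint : IntegrableOn (fun z => coeff ω F z * (starRingEnd ℂ) (coeff η F z)) B :=
    ((hQ.isInvariant_coeff 𝒜 hη).memLp hQ.isOpen).star.integrable_mul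
      ((hQ.isInvariant_coeff 𝒜 hω).memLp hQ.isOpen) |>.congr
        (Eventually.of_forall fun z => mul_comm _ _)
  conv_rhs => rw [← h1]
  rw [← h1] at hint
  rw [integral_iUnion h3 h2 hint, l2Inner, tsum_mul_left, div_mul_eq_mul_div, mul_div_assoc,
    ← tsum_div_const]
  congr 2
  ext k
  set f : (Fin n → ℂ) → ℂ := fun z =>
    coeff ω (𝒜.param k) z * (starRingEnd ℂ) (coeff η (𝒜.param k) z) with hf
  have hcont : ContinuousOn f (𝒜.dom k) := (hω.1 _ _ (𝒜.isChart k)).continuousOn.mul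
    (continuous_conj.comp_continuousOn (hη.1 _ _ (𝒜.isChart k)).continuousOn)
  have hae : AEStronglyMeasurable f
      (volume.restrict (𝒜.dom k ∩ 𝒜.param k ⁻¹' M₂ ∩ 𝒜.piece k)) :=
    (hcont.aestronglyMeasurable (h k).isOpen.measurableSet
      (μ := volume)).mono_measure (Measure.restrict_mono_set volume
        (inter_subset_left.trans inter_subset_left))
  rw [eq_div_iff hm, mul_comm, ← hQ.restrict_piece 𝒜 k,
    ← hQ.integral_chart (h k) (𝒜.measurableSet_piece k) hae]
  refine setIntegral_congr_fun (h3 k) fun z hz => ?_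
  simp only [hf]
  rw [hQ.coeff_eq (h k) ω hz.1, hQ.coeff_eq (h k) η hz.1, map_mul]
  rw [← Complex.mul_conj', ]
  ring

end IsBallQuotient

/-! ### The Hilbert space of invariant functions -/

namespace IsInvariant

variable {n : ℕ} {Γ : Subgroup (Matrix.unitaryGroup (Fin n) ℂ)} {B : Set (Fin n → ℂ)}
  {f g : (Fin n → ℂ) → ℂ}

theorem of_memLp (hf : AnalyticOnNhd ℂ f B) (hinv : ∀ γ ∈ Γ, ∀ z ∈ B, f (act γ z) * udet γ = f z)
    (hL : MemLp f 2 (volume.restrict B)) : IsInvariant Γ B f := by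
  refine ⟨hf, hinv, ?_⟩
  have := hL.2
  rw [eLpNorm_lt_top_iff_lintegral_rpow_enorm_lt_top two_ne_zero ENNReal.ofNat_ne_top] at this
  simpa using this

theorem zero : IsInvariant Γ B (fun _ => 0) :=
  ⟨analyticOnNhd_const, by simp, by simp⟩

theorem add (hB : IsOpen B) (hf : IsInvariant Γ B f) (hg : IsInvariant Γ B g) :
    IsInvariant Γ B (fun z => f z + g z) :=
  of_memLp (hf.analytic.add hg.analytic)
    (fun γ hγ z hz => by rw [add_mul, hf.invariant γ hγ z hz, hg.invariant γ hγ z hz])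
    ((hf.memLp hB).add (hg.memLp hB))

theorem const_mul (hB : IsOpen B) (hf : IsInvariant Γ B f) (c : ℂ) :
    IsInvariant Γ B (fun z => c * f z) :=
  of_memLp (analyticOnNhd_const.mul hf.analytic)
    (fun γ hγ z hz => by rw [mul_assoc, hf.invariant γ hγ z hz])
    ((hf.memLp hB).const_mul c)

theorem sum (hB : IsOpen B) {ι : Type*} (s : Finset ι) {f : ι → (Fin n → ℂ) → ℂ}
    (hf : ∀ i ∈ s, IsInvariant Γ B (f i)) : IsInvariant Γ B (fun z => ∑ i ∈ s, f i z) := by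
  classical
  induction s using Finset.induction_on with
  | empty => simpa using zero
  | insert i s hi ih =>
    simp only [Finset.sum_insert hi]
    exact (hf i (by simp)).add hB (ih fun j hj => hf j (by simp [hj]))

end IsInvariant

/-- Invariant functions as a subspace of `L²`. -/
def invariantSpace {n : ℕ} (Γ : Subgroup (Matrix.unitaryGroup (Fin n) ℂ)) {B : Set (Fin n → ℂ)}
    (hB : IsOpen B) : Submodule ℂ (Lp ℂ 2 (volume.restrict B)) where
  carrier := {f | ∃ h, IsInvariant Γ B h ∧ f =ᵐ[volume.restrict B] h}
  add_mem' := by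
    rintro a b ⟨f, hf, haf⟩ ⟨g, hg, hbg⟩
    exact ⟨_, hf.add hB hg, (Lp.coeFn_add a b).trans (haf.add hbg)⟩
  zero_mem' := ⟨_, IsInvariant.zero, Lp.coeFn_zero _ _ _⟩
  smul_mem' := by
    rintro c a ⟨f, hf, haf⟩
    exact ⟨_, hf.const_mul hB c, (Lp.coeFn_smul c a).trans (haf.const_smul c)⟩

section

variable {n : ℕ} {Γ : Subgroup (Matrix.unitaryGroup (Fin n) ℂ)} {B : Set (Fin n → ℂ)}

/-- The element of `invariantSpace` given by an invariant function. -/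
def IsInvariant.toSpace (hB : IsOpen B) {h : (Fin n → ℂ) → ℂ} (hh : IsInvariant Γ B h) :
    invariantSpace Γ hB :=
  ⟨(hh.memLp hB).toLp h, h, hh, MemLp.coeFn_toLp _⟩

theorem exists_toSpace (hB : IsOpen B) (x : invariantSpace Γ hB) :
    ∃ (h : (Fin n → ℂ) → ℂ) (hh : IsInvariant Γ B h), x = hh.toSpace hB := by
  obtain ⟨x, h, hh, hx⟩ := x
  exact ⟨h, hh, Subtype.ext (Lp.ext (hx.trans (hh.memLp hB).coeFn_toLp.symm))⟩

theorem inner_toSpace (hB : IsOpen B) {f g : (Fin n → ℂ) → ℂ} (hf : IsInvariant Γ B f)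
    (hg : IsInvariant Γ B g) :
    inner ℂ (hf.toSpace hB) (hg.toSpace hB) = ∫ z in B, g z * (starRingEnd ℂ) (f z) := by
  rw [Submodule.coe_inner, L2.inner_def]
  refine integral_congr_ae ?_
  filter_upwards [(hf.memLp hB).coeFn_toLp, (hg.memLp hB).coeFn_toLp] with z h1 h2
  simp only [IsInvariant.toSpace, RCLike.inner_apply]
  rw [h1, h2]

theorem lintegral_enorm_sq_eq (μ : Measure (Fin n → ℂ)) (f : Lp ℂ 2 μ) :
    ∫⁻ z, ‖f z‖ₑ ^ 2 ∂μ = ‖f‖ₑ ^ 2 := by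
  have := eLpNorm_nnreal_pow_eq_lintegral (μ := μ) (f := f) (p := 2) two_ne_zero
  rw [Lp.enorm_def]
  simpa using this.symm

theorem eqOn_of_ae_eq (hB : IsOpen B) {f g : (Fin n → ℂ) → ℂ} (hf : ContinuousOn f B)
    (hg : ContinuousOn g B) (h : f =ᵐ[volume.restrict B] g) : EqOn f g B :=
  Measure.eqOn_open_of_ae_eq h hB hf hg

theorem toSpace_eq_zero (hB : IsOpen B) {h : (Fin n → ℂ) → ℂ} (hh : IsInvariant Γ B h) :
    hh.toSpace hB = 0 ↔ ∀ z ∈ B, h z = 0 := by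
  constructor
  · intro h0
    have h1 : (hh.memLp hB).toLp h = 0 := congrArg Subtype.val h0
    have h2 : h =ᵐ[volume.restrict B] fun _ => 0 := by
      refine (hh.memLp hB).coeFn_toLp.symm.trans ?_
      rw [h1]
      exact Lp.coeFn_zero _ _ _
    exact eqOn_of_ae_eq hB hh.analytic.continuousOn continuousOn_const h2
  · intro h0
    refine Subtype.ext (Lp.ext ?_)
    refine (hh.memLp hB).coeFn_toLp.trans (EventuallyEq.trans ?_ (Lp.coeFn_zero _ _ _).symm)
    filter_upwards [ae_restrict_mem hB.measurableSet] with z hz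
    exact h0 z hz

/-- Point evaluations are locally bounded by the L² norm, so an L²-convergent sequence of invariant
functions converges at every point with local bounds. The limit is holomorphic and invariant, and it
represents the L² limit, as a subsequence converges almost everywhere. -/
theorem isClosed_invariantSpace (hB : IsOpen B) (hact : ∀ γ ∈ Γ, ∀ z ∈ B, act γ z ∈ B) :
    IsClosed (invariantSpace Γ hB : Set (Lp ℂ 2 (volume.restrict B))) := by
  refine IsSeqClosed.isClosed fun x f hx hf => ?_
  choose h hh hxh using hx
  have hdiff : ∀ i j, ∫⁻ z in B, ‖h i z - h j z‖ₑ ^ 2 = ‖x i - x j‖ₑ ^ 2 := by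
    intro i j
    rw [← lintegral_enorm_sq_eq]
    refine lintegral_congr_ae ?_
    filter_upwards [hxh i, hxh j, Lp.coeFn_sub (x i) (x j)] with z h1 h2 h3
    rw [h3, Pi.sub_apply, h1, h2]
  have hnorm : ∀ i, ∫⁻ z in B, ‖h i z‖ₑ ^ 2 = ‖x i‖ₑ ^ 2 := by
    intro i
    rw [← lintegral_enorm_sq_eq]
    refine lintegral_congr_ae ?_
    filter_upwards [hxh i] with z h1
    rw [h1]
  have hcauchy : ∀ z ∈ B, CauchySeq fun j => h j z := by
    intro z hz
    obtain ⟨C, hC, hev⟩ := exists_enorm_sq_le_mul_lintegral hB hz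
    have hle : ∀ i j, ‖h i z - h j z‖ ≤ Real.sqrt C.toReal * ‖x i - x j‖ := by
      intro i j
      have h1 := hev.self_of_nhds (fun z => h i z - h j z) ((hh i).analytic.sub (hh j).analytic)
      rw [hdiff] at h1
      have h2 : ‖h i z - h j z‖ ^ 2 ≤ C.toReal * ‖x i - x j‖ ^ 2 := by
        have := ENNReal.toReal_mono (ENNReal.mul_ne_top hC (by simp)) h1
        simpa using this
      rw [← Real.sqrt_sq (norm_nonneg (x i - x j)), ← Real.sqrt_mul ENNReal.toReal_nonneg]
      exact Real.le_sqrt_of_sq_le h2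
    have hx := hf.cauchySeq
    rw [Metric.cauchySeq_iff] at hx ⊢
    intro ε hε
    obtain ⟨K, hK⟩ := hx (ε / (Real.sqrt C.toReal + 1)) (by positivity)
    refine ⟨K, fun i hi j hj => ?_⟩
    have h3 := hK i hi j hj
    rw [dist_eq_norm] at h3 ⊢
    rw [lt_div_iff₀ (by positivity)] at h3
    nlinarith [hle i j, norm_nonneg (x i - x j)]
  choose! H hH using fun z hz => cauchySeq_tendsto_of_complete (hcauchy z hz)
  have hHan : AnalyticOnNhd ℂ H B := by
    refine analyticOnNhd_of_tendsto hB (fun j => (hh j).analytic) (fun z hz => ?_) hH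
    obtain ⟨C, hC, hev⟩ := exists_enorm_sq_le_mul_lintegral hB hz
    obtain ⟨R, hR⟩ := hf.norm.bddAbove_range
    refine ⟨Real.sqrt (C.toReal * R ^ 2), ?_⟩
    filter_upwards [hev] with w hw j
    have h1 := hw (h j) (hh j).analytic
    rw [hnorm] at h1
    have h2 : ‖h j w‖ ^ 2 ≤ C.toReal * ‖x j‖ ^ 2 := by
      have := ENNReal.toReal_mono (ENNReal.mul_ne_top hC (by simp)) h1
      simpa using this
    refine Real.le_sqrt_of_sq_le (h2.trans ?_)
    have := hR ⟨j, rfl⟩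
    gcongr
  have hae : f =ᵐ[volume.restrict B] H := by
    obtain ⟨ns, hns, hlim⟩ := (tendstoInMeasure_of_tendsto_Lp hf).exists_seq_tendsto_ae
    have hall : ∀ᵐ z ∂volume.restrict B, ∀ j, x j z = h j z := ae_all_iff.2 fun j => hxh j
    filter_upwards [hlim, hall, ae_restrict_mem hB.measurableSet] with z h1 h2 hz
    refine tendsto_nhds_unique h1 ?_
    simp only [h2]
    exact (hH z hz).comp hns.tendsto_atTop
  refine ⟨H, IsInvariant.of_memLp hHan (fun γ hγ z hz => ?_) ((Lp.memLp f).ae_eq hae), hae⟩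
  refine tendsto_nhds_unique ((hH _ (hact γ hγ z hz)).mul_const _) ?_
  simp only [fun j => (hh j).invariant γ hγ z hz]
  exact hH z hz

/-- A countable orthonormal basis of the space of invariant functions. -/
theorem exists_countable_basis (hB : IsOpen B) (hact : ∀ γ ∈ Γ, ∀ z ∈ B, act γ z ∈ B) :
    ∃ (ι : Set ℕ) (e : ι → (Fin n → ℂ) → ℂ), (∀ i, IsInvariant Γ B (e i)) ∧
      (∀ i, ∫ z in B, e i z * (starRingEnd ℂ) (e i z) = 1) ∧
      (∀ i j, i ≠ j → ∫ z in B, e i z * (starRingEnd ℂ) (e j z) = 0) ∧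
      ∀ h, IsInvariant Γ B h → (∀ i, ∫ z in B, h z * (starRingEnd ℂ) (e i z) = 0) →
        ∀ z ∈ B, h z = 0 := by
  have := (isClosed_invariantSpace hB hact).completeSpace_coe
  obtain ⟨w, b, hb⟩ := exists_hilbertBasis ℂ (invariantSpace Γ hB)
  have : Fact ((2 : ENNReal) ≠ ⊤) := ⟨ENNReal.ofNat_ne_top⟩
  -- Distinct orthonormal vectors are at distance √2, so balls of radius 1/2 about them are
  -- disjoint, and L² is separable.
  have hcount : w.Countable := by
    have hdisj : w.PairwiseDisjoint fun x => ball x (1 / 2) := by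
      intro x hx y hy hxy
      refine ball_disjoint_ball ?_
      have h0 : inner ℂ x y = 0 := by
        have := b.orthonormal.2 (i := ⟨x, hx⟩) (j := ⟨y, hy⟩) (by simpa using hxy)
        rwa [hb] at this
      have h1 : ‖x‖ = 1 := by
        have := b.orthonormal.1 ⟨x, hx⟩
        rwa [hb] at this
      have h2 : ‖x - y‖ ^ 2 = ‖x‖ ^ 2 + ‖y‖ ^ 2 := by
        rw [@norm_sub_sq ℂ, h0]
        simp
      rw [dist_eq_norm]
      nlinarith [norm_nonneg (x - y), sq_nonneg ‖y‖]
    exact hdisj.countable_of_isOpen (fun _ _ => isOpen_ball)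
      fun x _ => ⟨x, mem_ball_self (by norm_num)⟩
  have := hcount.to_subtype
  obtain ⟨ν, hν⟩ := exists_injective_nat w
  let eq := Equiv.ofInjective ν hν
  choose h hh hxh using fun x : w => exists_toSpace hB x.1
  have hinner : ∀ x y : w, ∫ z in B, h y z * (starRingEnd ℂ) (h x z) = inner ℂ (b x) (b y) := by
    intro x y
    rw [hb, hxh x, hxh y, inner_toSpace]
  refine ⟨range ν, fun i => h (eq.symm i), fun i => hh _, fun i => ?_, fun i j hij => ?_, ?_⟩
  · classical
    rw [hinner, orthonormal_iff_ite.1 b.orthonormal, if_pos rfl]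
  · rw [hinner]
    exact b.orthonormal.2 fun hc => hij (eq.symm.injective hc).symm
  · intro f hf h0
    rw [← toSpace_eq_zero hB hf]
    have hz : ∀ x : w, inner ℂ (b x) (hf.toSpace hB) = 0 := by
      intro x
      rw [hb, hxh x, inner_toSpace]
      have := h0 (eq x)
      simpa using this
    exact b.repr.injective (by ext x; rw [b.repr_apply_apply, hz]; simp)

/-- Parseval's identity for a reproducing kernel. -/
theorem hasSum_norm_sq_of_reproducing (hB : IsOpen B) (hact : ∀ γ ∈ Γ, ∀ z ∈ B, act γ z ∈ B)
    {ι : Type*} {e : ι → (Fin n → ℂ) → ℂ} (he : ∀ i, IsInvariant Γ B (e i))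
    (h1 : ∀ i, ∫ z in B, e i z * (starRingEnd ℂ) (e i z) = 1)
    (h2 : ∀ i j, i ≠ j → ∫ z in B, e i z * (starRingEnd ℂ) (e j z) = 0)
    (h3 : ∀ h, IsInvariant Γ B h → (∀ i, ∫ z in B, h z * (starRingEnd ℂ) (e i z) = 0) →
        ∀ z ∈ B, h z = 0) {k : (Fin n → ℂ) → ℂ} (hk : IsInvariant Γ B k) {w : Fin n → ℂ}
    (hkw : ∀ h, IsInvariant Γ B h → ∫ z in B, h z * (starRingEnd ℂ) (k z) = h w) :
    HasSum (fun i => ((‖e i w‖ ^ 2 : ℝ) : ℂ)) (k w) := by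
  classical
  have := (isClosed_invariantSpace hB hact).completeSpace_coe
  have hon : Orthonormal ℂ fun i => (he i).toSpace hB := by
    rw [orthonormal_iff_ite]
    intro i j
    rw [inner_toSpace]
    split_ifs with hij
    · rw [hij, h1]
    · exact h2 j i (Ne.symm hij)
  have hbot : (Submodule.span ℂ (range fun i => (he i).toSpace hB))ᗮ = ⊥ := by
    rw [Submodule.eq_bot_iff]
    intro x hx
    obtain ⟨f, hf, rfl⟩ := exists_toSpace hB x
    rw [toSpace_eq_zero]
    refine h3 f hf fun i => ?_
    rw [← inner_toSpace hB (he i) hf]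
    exact (Submodule.mem_orthogonal _ _).1 hx _ (Submodule.subset_span ⟨i, rfl⟩)
  -- Parseval for k with itself: ⟨k, k⟩ = k w, and each product of coefficients is |eᵢ w|² by the
  -- reproducing property.
  have key := (HilbertBasis.mkOfOrthogonalEqBot hon hbot).hasSum_inner_mul_inner
    (hk.toSpace hB) (hk.toSpace hB)
  simp only [HilbertBasis.coe_mkOfOrthogonalEqBot] at key
  rw [inner_toSpace, hkw k hk] at key
  have hterm : ∀ i, inner ℂ (hk.toSpace hB) ((he i).toSpace hB) *
      inner ℂ ((he i).toSpace hB) (hk.toSpace hB) = ((‖e i w‖ ^ 2 : ℝ) : ℂ) := by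
    intro i
    rw [← inner_conj_symm ((he i).toSpace hB), inner_toSpace, hkw _ (he i), Complex.mul_conj']
    push_cast
    rfl
  simp only [hterm] at key
  exact key

end

/-! ### The reproducing kernel for invariant functions -/

/-- The Bergman kernel of the ball. -/
def ballKernel {n : ℕ} (w z : Fin n → ℂ) : ℂ :=
  (n.factorial / Real.pi ^ n : ℝ) * (1 / (1 - herm z w) ^ (n + 1))

/-- The kernel reproducing the invariant functions. -/
def invKernel {n : ℕ} (m : ℕ) (Γ : Subgroup (Matrix.unitaryGroup (Fin n) ℂ)) [Fintype Γ]
    (w z : Fin n → ℂ) : ℂ :=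
  (m : ℂ)⁻¹ * ∑ γ : Γ, udet γ.1 * ballKernel w (act γ.1 z)

lemma one_sub_herm_ne_zero {n : ℕ} {w z : Fin n → ℂ} (hw : w ∈ unitBall n)
    (hz : z ∈ unitBall n) : 1 - herm w z ≠ 0 := fun h => by
  have h1 := norm_herm_lt_one hw hz
  rw [← sub_eq_zero.1 h] at h1
  simp at h1

lemma analyticOnNhd_ballKernel {n : ℕ} {w : Fin n → ℂ} (hw : w ∈ unitBall n) :
    AnalyticOnNhd ℂ (ballKernel w) (unitBall n) := by
  have h1 : AnalyticOnNhd ℂ (fun z => herm z w) (unitBall n) := by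
    unfold herm
    refine Finset.analyticOnNhd_fun_sum _ fun i _ => ?_
    exact ((ContinuousLinearMap.proj (R := ℂ) (φ := fun _ : Fin n => ℂ) i).analyticOnNhd _).mul
      analyticOnNhd_const
  refine analyticOnNhd_const.mul (analyticOnNhd_const.div
    ((analyticOnNhd_const.sub h1).pow (n + 1)) fun z hz => ?_)
  exact pow_ne_zero _ (one_sub_herm_ne_zero hz hw)

lemma conj_ballKernel {n : ℕ} (w z : Fin n → ℂ) : (starRingEnd ℂ) (ballKernel w z) =
    (n.factorial / Real.pi ^ n : ℝ) * (1 / (1 - herm w z) ^ (n + 1)) := by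
  rw [ballKernel, map_mul, Complex.conj_ofReal, map_div₀, map_pow, map_sub, map_one,
    ← herm_conj_symm]

/-- Bounded on the ball, because |⟨z,w⟩| ≤ |w| < 1 in the Euclidean norm. -/
lemma memLp_ballKernel {n : ℕ} {w : Fin n → ℂ} (hw : w ∈ unitBall n) :
    MemLp (ballKernel w) 2 (volume.restrict (unitBall n)) := by
  have : IsFiniteMeasure (volume.restrict (unitBall n)) :=
    ⟨by simpa using volume_unitBall_lt_top⟩
  have hw1 : Real.sqrt (nsq w) < 1 := by
    rw [Real.sqrt_lt' one_pos, one_pow]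
    exact mem_unitBall.1 hw
  refine MemLp.of_bound ((analyticOnNhd_ballKernel hw).continuousOn.aestronglyMeasurable
    isOpen_unitBall.measurableSet)
    ((n.factorial / Real.pi ^ n) * (1 / (1 - Real.sqrt (nsq w)) ^ (n + 1))) ?_
  filter_upwards [ae_restrict_mem isOpen_unitBall.measurableSet] with z hz
  have h1 : ‖herm z w‖ ≤ Real.sqrt (nsq w) := by
    refine Real.le_sqrt_of_sq_le ((norm_herm_sq_le z w).trans ?_)
    have := (mem_unitBall.1 hz).le
    nlinarith [nsq_nonneg w]
  have h2 : 1 - Real.sqrt (nsq w) ≤ ‖1 - herm z w‖ := by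
    have := norm_sub_norm_le (1 : ℂ) (herm z w)
    rw [norm_one] at this
    linarith
  have h3 : 0 < 1 - Real.sqrt (nsq w) := by linarith
  rw [ballKernel, norm_mul, norm_div, norm_pow, norm_one, Complex.norm_real, Real.norm_of_nonneg
    (by positivity)]
  gcongr

lemma measurableEmbedding_act {n : ℕ} (γ : Matrix.unitaryGroup (Fin n) ℂ) :
    MeasurableEmbedding (act γ) :=
  (actL γ).continuous.measurableEmbedding (act_injective γ)

namespace IsBallQuotient

variable {n N m : ℕ} {Γ : Subgroup (Matrix.unitaryGroup (Fin n) ℂ)}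
  {F : (Fin n → ℂ) → (Fin N → ℂ)} {B : Set (Fin n → ℂ)} {M M₂ : Set (Fin N → ℂ)}

theorem preimage_act (hQ : IsBallQuotient m Γ F B M M₂) {γ : Matrix.unitaryGroup (Fin n) ℂ}
    (hγ : γ ∈ Γ) : act γ ⁻¹' B = B := by
  refine Subset.antisymm (fun z hz => ?_) fun z hz => (hQ.act_mem γ hγ z hz).1
  have := (hQ.act_mem _ (Γ.inv_mem hγ) _ hz).1
  rwa [← act_mul, inv_mul_cancel, act_one] at this

theorem setIntegral_act (hQ : IsBallQuotient m Γ F B M M₂) {γ : Matrix.unitaryGroup (Fin n) ℂ}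
    (hγ : γ ∈ Γ) (f : (Fin n → ℂ) → ℂ) : ∫ z in B, f (act γ z) = ∫ z in B, f z := by
  have := (measurePreserving_act γ).setIntegral_preimage_emb (measurableEmbedding_act γ) f B
  rwa [hQ.preimage_act hγ] at this

theorem restrict_eq (hQ : IsBallQuotient m Γ F B M M₂) :
    (volume.restrict B : Measure (Fin n → ℂ)) = volume.restrict (unitBall n) := by
  refine Measure.restrict_congr_set ?_
  have h1 : ∀ᵐ z : Fin n → ℂ, z ∉ unitBall n \ B :=
    measure_eq_zero_iff_ae_notMem.1 (hQ.thin.volume_eq_zero sdiff_subset)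
  filter_upwards [h1] with z hz
  refine propext ⟨fun h => hQ.subset_ball h, fun h => ?_⟩
  by_contra hc
  exact hz ⟨h, hc⟩

/-- An L² holomorphic function on B extends over the thin null set missing from the ball, where the
reproducing formula of the ball applies. -/
theorem integral_mul_conj_ballKernel (hQ : IsBallQuotient m Γ F B M M₂) {h : (Fin n → ℂ) → ℂ}
    (hh : IsInvariant Γ B h) {w : Fin n → ℂ} (hw : w ∈ B) :
    ∫ z in B, h z * (starRingEnd ℂ) (ballKernel w z) = h w := by
  have hsd : unitBall n \ (unitBall n \ B) = B := by
    rw [sdiff_sdiff_cancel_left hQ.subset_ball]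
  obtain ⟨H, hH, hHh⟩ := exists_analytic_extension isOpen_unitBall (A := unitBall n \ B)
    (by rw [hsd]; exact hQ.isOpen) hQ.thin (by rw [hsd]; exact hh.analytic) fun p _ =>
      ⟨univ, univ_mem, by rw [hsd, univ_inter]; exact hh.finite.ne⟩
  rw [hsd] at hHh
  have h1 : ∫⁻ z in unitBall n, ‖H z‖ₑ ^ 2 < ⊤ := by
    rw [← hQ.restrict_eq]
    refine lt_of_eq_of_lt (setLIntegral_congr_fun hQ.isOpen.measurableSet fun z hz => ?_) hh.finite
    simp only [hHh hz]
  have h2 := integral_mul_ballKernel hH h1 (hQ.subset_ball hw)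
  rw [← hQ.restrict_eq, hHh hw] at h2
  have h3 : ∫ z in B, h z * (starRingEnd ℂ) (ballKernel w z) =
      (n.factorial / Real.pi ^ n : ℝ) * ∫ z in B, H z * (1 / (1 - herm w z) ^ (n + 1)) := by
    rw [← integral_const_mul]
    refine setIntegral_congr_fun hQ.isOpen.measurableSet fun z hz => ?_
    simp only [conj_ballKernel, hHh hz]
    ring
  rw [h3, h2]
  push_cast
  have h4 : (Real.pi : ℂ) ^ n ≠ 0 := pow_ne_zero _ (by exact_mod_cast Real.pi_ne_zero)
  have h5 : (n.factorial : ℂ) ≠ 0 := by exact_mod_cast n.factorial_ne_zero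
  field_simp

/-- An average over the group against the character det: the substitution γ ↦ γδ reproduces the
factor of δ. -/
theorem isInvariant_invKernel (hQ : IsBallQuotient m Γ F B M M₂) [Fintype Γ] {w : Fin n → ℂ}
    (hw : w ∈ B) : IsInvariant Γ B (invKernel m Γ w) := by
  have hw' := hQ.subset_ball hw
  have hmaps : ∀ γ : Γ, MapsTo (act γ.1) B (unitBall n) := fun γ z hz =>
    hQ.subset_ball (hQ.act_mem γ.1 γ.2 z hz).1
  refine IsInvariant.of_memLp ?_ (fun δ hδ z hz => ?_) ?_
  · refine analyticOnNhd_const.mul (Finset.analyticOnNhd_fun_sum _ fun γ _ =>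
      analyticOnNhd_const.mul ?_)
    exact (analyticOnNhd_ballKernel hw').comp ((actL γ.1).analyticOnNhd B) (hmaps γ)
  · rw [invKernel, invKernel, mul_assoc, Finset.sum_mul]
    congr 1
    refine Fintype.sum_equiv (Equiv.mulRight (⟨δ, hδ⟩ : Γ)) _ _ fun γ => ?_
    simp only [Equiv.coe_mulRight, Subgroup.coe_mul]
    rw [udet_mul, act_mul]
    ring
  · have key : ∀ γ : Γ, MemLp (fun z => udet γ.1 * ballKernel w (act γ.1 z)) 2
        (volume.restrict B) := ?_
    · exact (memLp_finsetSum Finset.univ fun γ _ => key γ).const_mul _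
    intro γ
    refine MemLp.const_mul ?_ _
    have h1 := (measurePreserving_act γ.1).restrict_preimage_emb (measurableEmbedding_act γ.1) B
    rw [hQ.preimage_act γ.2] at h1
    have h2 := memLp_ballKernel hw'
    rw [← hQ.restrict_eq] at h2
    exact h2.comp_measurePreserving h1

/-- Since |det γ| = 1, invariance of h turns the γ-term into h(γz) times the conjugate of the ball
kernel at γz. As γ preserves the measure, every term integrates to h w, and there are m of them. -/
theorem integral_mul_conj_invKernel (hQ : IsBallQuotient m Γ F B M M₂) [Fintype Γ]
    {h : (Fin n → ℂ) → ℂ} (hh : IsInvariant Γ B h) {w : Fin n → ℂ} (hw : w ∈ B) :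
    ∫ z in B, h z * (starRingEnd ℂ) (invKernel m Γ w z) = h w := by
  have hbk : MemLp (ballKernel w) 2 (volume.restrict B) := by
    rw [hQ.restrict_eq]
    exact memLp_ballKernel (hQ.subset_ball hw)
  have hterm : ∀ γ : Γ, ∀ z ∈ B, h z * (starRingEnd ℂ) (udet γ.1 * ballKernel w (act γ.1 z)) =
      h (act γ.1 z) * (starRingEnd ℂ) (ballKernel w (act γ.1 z)) := by
    intro γ z hz
    rw [← hh.invariant γ.1 γ.2 z hz, map_mul]
    have h1 : udet γ.1 * (starRingEnd ℂ) (udet γ.1) = 1 := by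
      rw [Complex.mul_conj', norm_udet]
      simp
    linear_combination (h (act γ.1 z) * (starRingEnd ℂ) (ballKernel w (act γ.1 z))) * h1
  have hI : Integrable (fun z => h z * (starRingEnd ℂ) (ballKernel w z)) (volume.restrict B) :=
    (hh.memLp hQ.isOpen).integrable_mul hbk.star
  have hone : ∀ γ : Γ, ∫ z in B, h z * (starRingEnd ℂ) (udet γ.1 * ballKernel w (act γ.1 z)) =
      h w := by
    intro γ
    rw [setIntegral_congr_fun hQ.isOpen.measurableSet (hterm γ),
      hQ.setIntegral_act γ.2 fun z => h z * (starRingEnd ℂ) (ballKernel w z),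
      hQ.integral_mul_conj_ballKernel hh hw]
  have hint : ∀ γ ∈ (Finset.univ : Finset Γ), Integrable
      (fun z => h z * (starRingEnd ℂ) (udet γ.1 * ballKernel w (act γ.1 z)))
        (volume.restrict B) := by
    intro γ _
    have h1 := (measurePreserving_act γ.1).restrict_preimage_emb (measurableEmbedding_act γ.1) B
    rw [hQ.preimage_act γ.2] at h1
    refine (h1.integrable_comp_of_integrable hI).congr ?_
    filter_upwards [ae_restrict_mem hQ.isOpen.measurableSet] with z hz
    exact (hterm γ z hz).symm
  have hm : (m : ℂ) ≠ 0 := by exact_mod_cast hQ.pos.ne'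
  have hexp : ∀ z, h z * (starRingEnd ℂ) (invKernel m Γ w z) = (m : ℂ)⁻¹ *
      ∑ γ : Γ, h z * (starRingEnd ℂ) (udet γ.1 * ballKernel w (act γ.1 z)) := by
    intro z
    rw [invKernel, map_mul, map_inv₀, Complex.conj_natCast, map_sum, mul_left_comm, Finset.mul_sum]
  simp only [hexp]
  rw [integral_const_mul, integral_finsetSum _ hint, Finset.sum_congr rfl fun γ _ => hone γ,
    Finset.sum_const, Finset.card_univ, ← Nat.card_eq_fintype_card, hQ.card, nsmul_eq_mul,
    ← mul_assoc, inv_mul_cancel₀ hm, one_mul]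

end IsBallQuotient

/-! ### Pulling back `η ∧ η̄` -/

lemma alternating_eq_mul_stdForm {n : ℕ} (f : (Fin n → ℂ) [⋀^Fin n]→ₗ[ℂ] ℂ)
    (v : Fin n → Fin n → ℂ) : f v = f (fun j => Pi.single j 1) * stdForm n v := by
  have h2 : (fun j => Pi.single j 1 : Fin n → Fin n → ℂ) = Pi.basisFun ℂ (Fin n) := by
    ext1 j; simp
  conv_lhs => rw [f.eq_smul_basis_det (Pi.basisFun ℂ (Fin n))]
  rw [h2]
  rfl

/-- In each shuffle of η ∧ η̄ one factor contributes c and the other its conjugate, so every summand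
scales by |c|². -/
lemma wedgeConj_comp {N n : ℕ} {η : (Fin N → ℂ) [⋀^Fin n]→ₗ[ℂ] ℂ} {L : (Fin n → ℂ) → (Fin N → ℂ)}
    {c : ℂ} (hη : ∀ u : Fin n → Fin n → ℂ, η (fun j => L (u j)) = c * stdForm n u)
    (u : Fin n ⊕ Fin n → Fin n → ℂ) :
    wedgeConj η (fun j => L (u j)) = ((‖c‖ ^ 2 : ℝ) : ℂ) * wedgeConj (stdForm n) u := by
  have key : ∀ σ : Equiv.Perm.ModSumCongr (Fin n) (Fin n),
      LinearMap.mul' ℝ ℂ (AlternatingMap.domCoprod.summand (toReal η)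
        (Complex.conjAe.toLinearMap.compAlternatingMap (toReal η)) σ fun j => L (u j)) =
      ((‖c‖ ^ 2 : ℝ) : ℂ) * LinearMap.mul' ℝ ℂ (AlternatingMap.domCoprod.summand
        (toReal (stdForm n))
        (Complex.conjAe.toLinearMap.compAlternatingMap (toReal (stdForm n))) σ u) := by
    intro σ
    induction σ using Quotient.inductionOn' with | _ σ
    have h1 : ∀ s : Fin n → Fin n ⊕ Fin n,
        toReal η (fun i => L (u (s i))) = c * toReal (stdForm n) fun i => u (s i) :=
      fun s => hη fun i => u (s i)
    rw [AlternatingMap.domCoprod.summand_mk'', AlternatingMap.domCoprod.summand_mk'']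
    simp only [_root_.smul_apply, MultilinearMap.domDomCongr_apply, MultilinearMap.domCoprod_apply,
      AlternatingMap.coe_multilinearMap, LinearMap.compAlternatingMap_apply, h1]
    rw [Units.smul_def, Units.smul_def, map_zsmul, map_zsmul, LinearMap.mul'_apply,
      LinearMap.mul'_apply, mul_smul_comm]
    congr 1
    have h2 : ∀ a b : ℂ, Complex.conjAe.toLinearMap (a * b) =
        (starRingEnd ℂ) a * Complex.conjAe.toLinearMap b := fun a b => by simp
    rw [h2]
    push_cast
    rw [← Complex.mul_conj']
    ring
  simp only [wedgeConj, AlternatingMap.smul_apply, LinearMap.compAlternatingMap_apply,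
    AlternatingMap.domCoprod_apply, smul_eq_mul, _root_.sum_apply, map_sum, key,
    ← Finset.mul_sum]
  ring

/-- In a chart, `i^{n²} η ∧ η̄` is the square of the coefficient times the standard form. -/
lemma wedgeConj_fderiv {N n : ℕ} (ω : NForm N n) (φ : (Fin n → ℂ) → (Fin N → ℂ)) (z : Fin n → ℂ)
    (u : Fin n ⊕ Fin n → Fin n → ℂ) :
    wedgeConj (ω (φ z)) (fun j => fderiv ℂ φ z (u j)) =
      ((‖coeff ω φ z‖ ^ 2 : ℝ) : ℂ) * wedgeConj (stdForm n) u :=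
  wedgeConj_comp (L := fderiv ℂ φ z) (fun u => alternating_eq_mul_stdForm
    ((ω (φ z)).compLinearMap (fderiv ℂ φ z : (Fin n → ℂ) →ₗ[ℂ] (Fin N → ℂ))) u) u

/-! ### The isometry between the Bergman space of M and the invariant functions. -/

namespace IsBallQuotient

variable {n N m : ℕ} {Γ : Subgroup (Matrix.unitaryGroup (Fin n) ℂ)}
  {F : (Fin n → ℂ) → (Fin N → ℂ)} {B : Set (Fin n → ℂ)} {M M₂ : Set (Fin N → ℂ)}
  {Ω : Set (Fin n → ℂ)} {φ : (Fin n → ℂ) → (Fin N → ℂ)} {U : Set (Fin N → ℂ)}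
  {ρ : (Fin N → ℂ) → (Fin n → ℂ)}

/-- The normalizing factor between forms on `M` and functions on the ball. -/
def scale (n m : ℕ) : ℝ := Real.sqrt (2 ^ n / m)

theorem scale_sq (hQ : IsBallQuotient m Γ F B M M₂) : ((scale n m : ℝ) : ℂ) ^ 2 = 2 ^ n / m := by
  have := hQ.pos
  rw [scale, ← Complex.ofReal_pow, Real.sq_sqrt (by positivity)]
  push_cast
  rfl

theorem scale_ne_zero (hQ : IsBallQuotient m Γ F B M M₂) : ((scale n m : ℝ) : ℂ) ≠ 0 := by
  have := hQ.pos
  rw [scale, Complex.ofReal_ne_zero]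
  positivity

/-- The function on the ball corresponding to a form on `M`. -/
def lift (m : ℕ) (F : (Fin n → ℂ) → (Fin N → ℂ)) (ω : NForm N n) (z : Fin n → ℂ) : ℂ :=
  (scale n m : ℝ) * coeff ω F z

theorem isInvariant_lift (hQ : IsBallQuotient m Γ F B M M₂) (𝒜 : CountableAtlas n M)
    {ω : NForm N n} (hω : MemBergmanSpace 𝒜 ω) : IsInvariant Γ B (lift m F ω) :=
  (hQ.isInvariant_coeff 𝒜 hω).const_mul hQ.isOpen _

theorem integral_lift (hQ : IsBallQuotient m Γ F B M M₂) (𝒜 : CountableAtlas n M)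
    {ω η : NForm N n} (hω : MemBergmanSpace 𝒜 ω) (hη : MemBergmanSpace 𝒜 η) :
    ∫ z in B, lift m F ω z * (starRingEnd ℂ) (lift m F η z) = l2Inner 𝒜 ω η := by
  rw [hQ.l2Inner_eq 𝒜 hω hη, ← hQ.scale_sq, ← integral_const_mul]
  congr 1
  ext z
  simp only [lift, map_mul, Complex.conj_ofReal]
  ring

/-- Every invariant function is the lift of a form in the Bergman space. -/
theorem exists_lift_eq (hQ : IsBallQuotient m Γ F B M M₂) (𝒜 : CountableAtlas n M)
    {h : (Fin n → ℂ) → ℂ} (hh : IsInvariant Γ B h) :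
    ∃ ω, MemBergmanSpace 𝒜 ω ∧ ∀ z ∈ B, lift m F ω z = h z := by
  have h1 := hh.const_mul hQ.isOpen ((scale n m : ℝ) : ℂ)⁻¹
  obtain ⟨ω, hω, hωh⟩ := hQ.exists_form h1
  refine ⟨ω, hQ.memBergmanSpace 𝒜 hω ?_, fun z hz => ?_⟩
  · refine lt_of_eq_of_lt (setLIntegral_congr_fun hQ.isOpen.measurableSet fun z hz => ?_) h1.finite
    simp only [hωh z hz]
  · rw [lift, hωh z hz, mul_inv_cancel_left₀ hQ.scale_ne_zero]

theorem vanishesOn_of_lift (hQ : IsBallQuotient m Γ F B M M₂) (𝒜 : CountableAtlas n M)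
    {ω : NForm N n} (hω : MemBergmanSpace 𝒜 ω) (h0 : ∀ z ∈ B, lift m F ω z = 0) :
    VanishesOn M ω :=
  hQ.vanishesOn hω.1 fun z hz => (mul_eq_zero.1 (h0 z hz)).resolve_left hQ.scale_ne_zero

theorem lift_eq_zero (hQ : IsBallQuotient m Γ F B M M₂) {ω : NForm N n} (hω : VanishesOn M ω) :
    ∀ z ∈ B, lift m F ω z = 0 := by
  intro z hz
  obtain ⟨W, S, g, hg, hzS⟩ := hQ.exists_sheet_at hz
  rw [lift, hω S F hg.isChart z hzS, mul_zero]

theorem exists_bergmanBasis (hQ : IsBallQuotient m Γ F B M M₂) (𝒜 : CountableAtlas n M) :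
    ∃ (ι : Set ℕ) (φ : ι → NForm N n), IsBergmanBasis 𝒜 φ := by
  obtain ⟨ι, e, he, h1, h2, h3⟩ :=
    exists_countable_basis hQ.isOpen fun γ hγ z hz => (hQ.act_mem γ hγ z hz).1
  choose ω hω hωe using fun i => hQ.exists_lift_eq 𝒜 (he i)
  have hint : ∀ i, ∀ f : (Fin n → ℂ) → ℂ, ∫ z in B, f z * (starRingEnd ℂ) (lift m F (ω i) z) =
      ∫ z in B, f z * (starRingEnd ℂ) (e i z) := fun i f =>
    setIntegral_congr_fun hQ.isOpen.measurableSet fun z hz => by simp only [hωe i z hz]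
  have hint' : ∀ i j, ∫ z in B, lift m F (ω i) z * (starRingEnd ℂ) (lift m F (ω j) z) =
      ∫ z in B, e i z * (starRingEnd ℂ) (e j z) := fun i j =>
    setIntegral_congr_fun hQ.isOpen.measurableSet fun z hz => by
      simp only [hωe i z hz, hωe j z hz]
  refine ⟨ι, ω, hω, fun k => ?_, fun k l hkl => ?_, fun η hη h0 => ?_⟩
  · rw [← hQ.integral_lift 𝒜 (hω k) (hω k), hint', h1]
  · rw [← hQ.integral_lift 𝒜 (hω k) (hω l), hint', h2 k l hkl]
  · refine hQ.vanishesOn_of_lift 𝒜 hη (h3 _ (hQ.isInvariant_lift 𝒜 hη) fun i => ?_)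
    rw [← hint, hQ.integral_lift 𝒜 hη (hω i), h0 i]

section Basis

variable {𝒜 : CountableAtlas n M} {ι : Type} {e : ι → NForm N n}

/-- The Bergman kernel form on the base of the covering. -/
theorem hasSum_coeff (hQ : IsBallQuotient m Γ F B M M₂) [Fintype Γ] (he : IsBergmanBasis 𝒜 e)
    {w : Fin n → ℂ} (hw : w ∈ B) :
    HasSum (fun k => ((‖coeff (e k) F w‖ ^ 2 : ℝ) : ℂ)) ((m / 2 ^ n) * invKernel m Γ w w) := by
  obtain ⟨h1, h2, h3, h4⟩ := he
  -- The lifts are an orthonormal basis of the invariant functions; the factor m / 2ⁿ in the result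
  -- undoes the squared scale.
  have key := hasSum_norm_sq_of_reproducing hQ.isOpen
    (fun γ hγ z hz => (hQ.act_mem γ hγ z hz).1) (e := fun k => lift m F (e k))
    (fun k => hQ.isInvariant_lift 𝒜 (h1 k))
    (fun k => by rw [hQ.integral_lift 𝒜 (h1 k) (h1 k), h2])
    (fun k l hkl => by rw [hQ.integral_lift 𝒜 (h1 k) (h1 l), h3 k l hkl])
    (fun h hh h0 => by
      obtain ⟨ω, hω, hωh⟩ := hQ.exists_lift_eq 𝒜 hh
      have h5 := hQ.lift_eq_zero (h4 ω hω fun k => by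
        rw [← hQ.integral_lift 𝒜 hω (h1 k), ← h0 k]
        exact setIntegral_congr_fun hQ.isOpen.measurableSet fun z hz => by
          simp only [hωh z hz])
      exact fun z hz => (hωh z hz).symm.trans (h5 z hz))
    (hQ.isInvariant_invKernel hw) fun h hh => hQ.integral_mul_conj_invKernel hh hw
  have hs := hQ.scale_sq
  have hm : (m : ℂ) ≠ 0 := by exact_mod_cast hQ.pos.ne'
  have h5 := key.mul_left ((m : ℂ) / 2 ^ n)
  have hterm : ∀ k, (m : ℂ) / 2 ^ n * ((‖lift m F (e k) w‖ ^ 2 : ℝ) : ℂ) =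
      ((‖coeff (e k) F w‖ ^ 2 : ℝ) : ℂ) := by
    intro k
    rw [lift, norm_mul, mul_pow, Complex.norm_real, Real.norm_eq_abs, sq_abs]
    push_cast
    rw [hs]
    field_simp
  simp only [hterm] at h5
  exact h5

/-- Bessel's equality for finite combinations of the lifted basis. -/
theorem lintegral_sum_lift (hQ : IsBallQuotient m Γ F B M M₂) (he : IsBergmanBasis 𝒜 e)
    (s : Finset ι) (a : ι → ℂ) :
    ∫⁻ z in B, ‖∑ k ∈ s, a k * lift m F (e k) z‖ₑ ^ 2 =
      ENNReal.ofReal (∑ k ∈ s, ‖a k‖ ^ 2) := by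
  classical
  have hinv : ∀ k, IsInvariant Γ B (lift m F (e k)) := fun k => hQ.isInvariant_lift 𝒜 (he.1 k)
  have hf : IsInvariant Γ B fun z => ∑ k ∈ s, a k * lift m F (e k) z :=
    IsInvariant.sum hQ.isOpen s fun k _ => (hinv k).const_mul hQ.isOpen (a k)
  have h1 : ∫⁻ z in B, ‖∑ k ∈ s, a k * lift m F (e k) z‖ₑ ^ 2 = ‖hf.toSpace hQ.isOpen‖ₑ ^ 2 := by
    have h2 := lintegral_enorm_sq_eq (volume.restrict B) (hf.toSpace hQ.isOpen).1
    refine Eq.trans (lintegral_congr_ae ?_) h2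
    filter_upwards [(hf.memLp hQ.isOpen).coeFn_toLp] with z hz
    rw [← hz]
    rfl
  have h2 : ((‖hf.toSpace hQ.isOpen‖ ^ 2 : ℝ) : ℂ) = ((∑ k ∈ s, ‖a k‖ ^ 2 : ℝ) : ℂ) := by
    have h3 := inner_self_eq_norm_sq_to_K (𝕜 := ℂ) (hf.toSpace hQ.isOpen)
    rw [inner_toSpace] at h3
    rw [Complex.ofReal_pow]
    refine h3.symm.trans ?_
    have hexp : ∀ z, (∑ k ∈ s, a k * lift m F (e k) z) *
        (starRingEnd ℂ) (∑ k ∈ s, a k * lift m F (e k) z) = ∑ k ∈ s, ∑ l ∈ s,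
          (a k * (starRingEnd ℂ) (a l)) *
            (lift m F (e k) z * (starRingEnd ℂ) (lift m F (e l) z)) := by
      intro z
      rw [map_sum, Finset.sum_mul_sum]
      refine Finset.sum_congr rfl fun k _ => Finset.sum_congr rfl fun l _ => ?_
      rw [map_mul]
      ring
    have hint : ∀ k l, Integrable (fun z => (a k * (starRingEnd ℂ) (a l)) *
        (lift m F (e k) z * (starRingEnd ℂ) (lift m F (e l) z))) (volume.restrict B) := fun k l =>
      (((hinv k).memLp hQ.isOpen).integrable_mul ((hinv l).memLp hQ.isOpen).star).const_mul _
    simp only [hexp]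
    rw [integral_finsetSum _ fun k _ => integrable_finsetSum _ fun l _ => hint k l]
    push_cast
    refine Finset.sum_congr rfl fun k hk => ?_
    rw [integral_finsetSum _ fun l _ => hint k l, Finset.sum_eq_single_of_mem k hk]
    · rw [integral_const_mul, hQ.integral_lift 𝒜 (he.1 k) (he.1 k), he.2.1, mul_one,
        Complex.mul_conj']
    · intro l _ hlk
      rw [integral_const_mul, hQ.integral_lift 𝒜 (he.1 k) (he.1 l), he.2.2.1 k l hlk.symm, mul_zero]
  rw [h1, ← Complex.ofReal_injective h2, ENNReal.ofReal_pow (norm_nonneg _), ofReal_norm]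

/-- The sum defining the Bergman kernel form is locally bounded in every chart. -/
theorem exists_sum_le (hQ : IsBallQuotient m Γ F B M M₂) (he : IsBergmanBasis 𝒜 e)
    (h : IsChartWith n M Ω φ U ρ) {c : Fin n → ℂ} (hc : c ∈ Ω) :
    ∃ C : ℝ, ∀ᶠ z in 𝓝 c, ∀ s : Finset ι, ∑ k ∈ s, ‖coeff (e k) φ z‖ ^ 2 ≤ C := by
  obtain ⟨C, hC, hev⟩ := exists_enorm_sq_le_mul_lintegral h.isOpen hc
  refine ⟨C.toReal, ?_⟩
  -- In a chart, the squared L² norm of a finite combination of basis coefficients is bounded by the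
  -- squared ℓ² norm of its multipliers.
  have hL2 : ∀ (s : Finset ι) (a : ι → ℂ), ∫⁻ w in Ω, ‖∑ k ∈ s, a k * coeff (e k) φ w‖ₑ ^ 2 ≤
      ENNReal.ofReal (∑ k ∈ s, ‖a k‖ ^ 2) := by
    intro s a
    have hΩ₂ := hQ.isOpen_chart_inter h
    have hcont : ContinuousOn (fun w => ∑ k ∈ s, a k * coeff (e k) φ w) Ω :=
      continuousOn_finsetSum _ fun k _ =>
        continuousOn_const.mul ((he.1 k).1 Ω φ h.isChart).continuousOn
    have h1 := hQ.lintegral_chart h MeasurableSet.univ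
      (f := fun w => ‖∑ k ∈ s, a k * coeff (e k) φ w‖ₑ ^ 2) (by
        rw [inter_univ]
        exact ((hcont.mono inter_subset_left).aemeasurable hΩ₂.measurableSet).enorm.pow_const 2)
    simp only [preimage_univ, inter_univ] at h1
    have h2 : (volume.restrict (Ω ∩ φ ⁻¹' M₂) : Measure (Fin n → ℂ)) = volume.restrict Ω := by
      refine Measure.restrict_congr_set ?_
      have h0 : ∀ᵐ z : Fin n → ℂ, z ∉ Ω \ φ ⁻¹' M₂ := measure_eq_zero_iff_ae_notMem.1
        ((hQ.thin_preimage _ _ h.isChart).volume_eq_zero sdiff_subset)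
      filter_upwards [h0] with z hz
      refine propext ⟨fun h => h.1, fun h => ⟨h, ?_⟩⟩
      by_contra hc
      exact hz ⟨h, hc⟩
    rw [h2] at h1
    have h3 : ∀ z ∈ B ∩ F ⁻¹' U, ‖((scale n m : ℝ) : ℂ)‖ₑ ^ 2 * (‖jac (fun z => ρ (F z)) z‖ₑ ^ 2 *
        ‖∑ k ∈ s, a k * coeff (e k) φ (ρ (F z))‖ₑ ^ 2) =
        ‖∑ k ∈ s, a k * lift m F (e k) z‖ₑ ^ 2 := by
      intro z hz
      rw [← mul_pow, ← mul_pow, ← enorm_mul, ← enorm_mul, Finset.mul_sum, Finset.mul_sum]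
      congr 2
      refine Finset.sum_congr rfl fun k _ => ?_
      rw [lift, hQ.coeff_eq h (e k) hz]
      ring
    -- The constant is scale² · m = 2ⁿ ≥ 1 and can be dropped.
    have hscale : 1 ≤ ‖((scale n m : ℝ) : ℂ)‖ₑ ^ 2 * (m : ENNReal) := by
      have hm := hQ.pos
      have h4 : scale n m ^ 2 * m = 2 ^ n := by
        rw [scale, Real.sq_sqrt (by positivity)]
        field_simp
      rw [← ofReal_norm, Complex.norm_real, Real.norm_eq_abs, ← ENNReal.ofReal_pow (abs_nonneg _),
        sq_abs, ← ENNReal.ofReal_natCast, ← ENNReal.ofReal_mul (sq_nonneg _), h4,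
        ENNReal.one_le_ofReal]
      exact one_le_pow₀ one_le_two
    have hR := (hQ.isOpen_preimage h.isOpen_target).measurableSet
    calc ∫⁻ w in Ω, ‖∑ k ∈ s, a k * coeff (e k) φ w‖ₑ ^ 2
        ≤ ‖((scale n m : ℝ) : ℂ)‖ₑ ^ 2 * (m : ENNReal) *
          ∫⁻ w in Ω, ‖∑ k ∈ s, a k * coeff (e k) φ w‖ₑ ^ 2 := le_mul_of_one_le_left' hscale
      _ = ∫⁻ z in B ∩ F ⁻¹' U, ‖∑ k ∈ s, a k * lift m F (e k) z‖ₑ ^ 2 := by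
        rw [mul_assoc, ← h1, ← lintegral_const_mul' _ _ (by simp)]
        exact setLIntegral_congr_fun hR h3
      _ ≤ ∫⁻ z in B, ‖∑ k ∈ s, a k * lift m F (e k) z‖ₑ ^ 2 :=
        lintegral_mono_set inter_subset_left
      _ = _ := hQ.lintegral_sum_lift he s a
  filter_upwards [hev] with z hz s
  set T := ∑ k ∈ s, ‖coeff (e k) φ z‖ ^ 2 with hT
  have hT0 : 0 ≤ T := Finset.sum_nonneg fun _ _ => sq_nonneg _
  -- The multipliers are the conjugates of the coefficients at z, so the combination takes the value
  -- T at z. The evaluation bound becomes T² ≤ C T, whence T ≤ C independently of s.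
  have h1 := hz (fun w => ∑ k ∈ s, (starRingEnd ℂ) (coeff (e k) φ z) * coeff (e k) φ w)
    (Finset.analyticOnNhd_fun_sum _ fun k _ =>
      analyticOnNhd_const.mul ((he.1 k).1 Ω φ h.isChart))
  have h2 : ∑ k ∈ s, (starRingEnd ℂ) (coeff (e k) φ z) * coeff (e k) φ z = ((T : ℝ) : ℂ) := by
    rw [hT, Complex.ofReal_sum]
    refine Finset.sum_congr rfl fun k _ => ?_
    rw [Complex.conj_mul', Complex.ofReal_pow]
  have h3 := h1.trans (mul_le_mul_right (hL2 s fun k => (starRingEnd ℂ) (coeff (e k) φ z)) C)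
  simp only [h2, RCLike.norm_conj, ← hT] at h3
  have h4 := ENNReal.toReal_mono (ENNReal.mul_ne_top hC (by simp)) h3
  rw [ENNReal.toReal_mul, ENNReal.toReal_ofReal hT0, ENNReal.toReal_pow, toReal_enorm,
    Complex.norm_real, Real.norm_of_nonneg hT0] at h4
  by_contra! hlt
  have hpos : 0 < T := lt_of_le_of_lt ENNReal.toReal_nonneg hlt
  nlinarith

end Basis

end IsBallQuotient

/-! ### Sums of squares of holomorphic functions -/

/-- Conjugation in source and target preserves holomorphy, checked one variable at a time; it
supplies the second factor of the polarized sum. -/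
theorem analyticOnNhd_conj_conj {n : ℕ} {f : (Fin n → ℂ) → ℂ} {Ω : Set (Fin n → ℂ)}
    (hΩ : IsOpen Ω) (hf : AnalyticOnNhd ℂ f Ω) :
    AnalyticOnNhd ℂ (fun z => (starRingEnd ℂ) (f (star z))) (star ⁻¹' Ω) := by
  refine analyticOnNhd_of_continuousOn_of_separately (hΩ.preimage continuous_star) ?_ ?_
  · exact Complex.continuous_conj.comp_continuousOn
      (hf.continuousOn.comp continuous_star.continuousOn fun z hz => hz)
  · intro z hz i
    have h1 : ∀ t, star (Function.update z i t) =
        Function.update (star z) i ((starRingEnd ℂ) t) := by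
      intro t
      ext j
      by_cases hj : j = i
      · subst hj; simp
      · simp [hj]
    have h2 : DifferentiableAt ℂ (fun t => f (Function.update (star z) i t)) (star z i) := by
      have h3 : Function.update (star z) i (star z i) = star z := Function.update_eq_self i _
      refine DifferentiableAt.comp (g := f) _ ?_ (differentiable_update _ i _)
      rw [h3]
      exact (hf _ hz).differentiableAt
    have h4 := h2.star_conj
    rw [show (starRingEnd ℂ) (star z i) = z i by simp] at h4
    refine h4.congr_of_eventuallyEq (Eventually.of_forall fun t => ?_)
    simp only [h1, Function.comp_apply]
    rfl

theorem summable_norm_sq_of_sum_le {n : ℕ} {ι : Type} {h : ι → (Fin n → ℂ) → ℂ}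
    {Ω : Set (Fin n → ℂ)} (hb : ∀ z ∈ Ω, ∃ C : ℝ, ∀ᶠ w in 𝓝 z, ∀ s : Finset ι,
      ∑ k ∈ s, ‖h k w‖ ^ 2 ≤ C) {z : Fin n → ℂ} (hz : z ∈ Ω) :
    Summable fun k => ‖h k z‖ ^ 2 := by
  obtain ⟨C, hC⟩ := hb z hz
  exact summable_of_sum_le (fun _ => sq_nonneg _) hC.self_of_nhds

/-- A locally bounded sum of squares of moduli of holomorphic functions is real analytic. -/
theorem analyticOnNhd_tsum_norm_sq {n : ℕ} {ι : Type} [Countable ι] {h : ι → (Fin n → ℂ) → ℂ}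
    {Ω : Set (Fin n → ℂ)} (hΩ : IsOpen Ω) (hh : ∀ k, AnalyticOnNhd ℂ (h k) Ω)
    (hb : ∀ z ∈ Ω, ∃ C : ℝ, ∀ᶠ w in 𝓝 z, ∀ s : Finset ι, ∑ k ∈ s, ‖h k w‖ ^ 2 ≤ C) :
    AnalyticOnNhd ℝ (fun z => ∑' k, ‖h k z‖ ^ 2) Ω := by
  -- Polarization: the sum of h_k(z) times the conjugate of h_k(w̄) is holomorphic in (z, w) ∈ ℂ²ⁿ,
  -- being a locally bounded limit of finite sums. P and Q are the projections to z and w.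
  set P : (Fin (n + n) → ℂ) →L[ℂ] (Fin n → ℂ) :=
    ContinuousLinearMap.pi fun i => ContinuousLinearMap.proj (Fin.castAdd n i) with hP
  set Q : (Fin (n + n) → ℂ) →L[ℂ] (Fin n → ℂ) :=
    ContinuousLinearMap.pi fun i => ContinuousLinearMap.proj (Fin.natAdd n i) with hQ
  set Ω₂ : Set (Fin (n + n) → ℂ) := P ⁻¹' Ω ∩ Q ⁻¹' (star ⁻¹' Ω) with hΩ₂
  have hΩ₂o : IsOpen Ω₂ := (hΩ.preimage P.continuous).inter
    ((hΩ.preimage continuous_star).preimage Q.continuous)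
  have hPan : AnalyticOnNhd ℂ P Ω₂ := fun p _ => P.analyticAt p
  have hQan : AnalyticOnNhd ℂ Q Ω₂ := fun p _ => Q.analyticAt p
  set t : ι → (Fin (n + n) → ℂ) → ℂ :=
    fun k p => h k (P p) * (starRingEnd ℂ) (h k (star (Q p))) with ht
  have htan : ∀ k, AnalyticOnNhd ℂ (t k) Ω₂ := fun k =>
    ((hh k).comp hPan fun p hp => hp.1).mul
      ((analyticOnNhd_conj_conj hΩ (hh k)).comp hQan fun p hp => hp.2)
  have htle : ∀ k p, ‖t k p‖ ≤ ‖h k (P p)‖ ^ 2 + ‖h k (star (Q p))‖ ^ 2 := by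
    intro k p
    rw [ht, norm_mul, RCLike.norm_conj]
    nlinarith [sq_nonneg (‖h k (P p)‖ - ‖h k (star (Q p))‖), sq_nonneg (‖h k (P p)‖),
      sq_nonneg (‖h k (star (Q p))‖)]
  have hcP : ∀ p, ContinuousAt P p := fun p => P.continuous.continuousAt
  have hcQ : ∀ p, ContinuousAt (fun p => star (Q p)) p := fun p =>
    (continuous_star.comp Q.continuous).continuousAt
  have han : AnalyticOnNhd ℂ (fun p => ∑' k, t k p) Ω₂ := by
    refine analyticOnNhd_of_tendsto hΩ₂o (l := (atTop : Filter (Finset ι)))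
      (F := fun s p => ∑ k ∈ s, t k p) (fun s => Finset.analyticOnNhd_fun_sum s fun k _ => htan k)
      ?_ ?_
    · intro p hp
      obtain ⟨C₁, hC₁⟩ := hb (P p) hp.1
      obtain ⟨C₂, hC₂⟩ := hb (star (Q p)) hp.2
      refine ⟨C₁ + C₂, ?_⟩
      filter_upwards [(hcP p).eventually hC₁, (hcQ p).eventually hC₂] with w h1 h2 s
      refine (norm_sum_le _ _).trans ((Finset.sum_le_sum fun k _ => htle k w).trans ?_)
      rw [Finset.sum_add_distrib]
      exact add_le_add (h1 s) (h2 s)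
    · intro p hp
      have hs : Summable fun k => t k p := Summable.of_norm_bounded
        ((summable_norm_sq_of_sum_le hb hp.1).add (summable_norm_sq_of_sum_le hb hp.2))
        fun k => htle k p
      exact hs.hasSum
  -- The real linear embedding z ↦ (z, z̄), along which the polarized sum becomes the sum of
  -- squares.
  set J : (Fin n → ℂ) →L[ℝ] (Fin (n + n) → ℂ) := ContinuousLinearMap.pi
    (Fin.addCases (motive := fun _ => (Fin n → ℂ) →L[ℝ] ℂ)
      (fun i => ContinuousLinearMap.proj i)
      fun i => (Complex.conjCLE : ℂ →L[ℝ] ℂ).comp (ContinuousLinearMap.proj i)) with hJ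
  have hPJ : ∀ z, P (J z) = z := fun z => by
    ext i
    simp [hP, hJ]
  have hQJ : ∀ z, star (Q (J z)) = z := fun z => by
    ext i
    simp [hQ, hJ, -Fin.natAdd_eq_addNat]
  have h1 : AnalyticOnNhd ℝ (fun z => ∑' k, t k (J z)) Ω := by
    have h2 : AnalyticOnNhd ℝ (fun p => ∑' k, t k p) Ω₂ := han.restrictScalars
    refine h2.comp (fun z _ => J.analyticAt z) fun z hz => ⟨?_, ?_⟩
    · rw [mem_preimage, hPJ]; exact hz
    · rw [mem_preimage, mem_preimage, hQJ]; exact hz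
  have h3 : AnalyticOnNhd ℝ (fun z => (∑' k, t k (J z)).re) Ω := fun z hz =>
    (Complex.reCLM.analyticAt _).comp (h1 z hz)
  refine h3.congr hΩ fun z _ => ?_
  have h4 : ∀ k, t k (J z) = ((‖h k z‖ ^ 2 : ℝ) : ℂ) := fun k => by
    simp only [ht]
    rw [hPJ, hQJ, Complex.mul_conj', Complex.ofReal_pow]
  simp only [h4]
  rw [← Complex.ofReal_tsum, Complex.ofReal_re]

/-! ### Charts given by coordinate projections -/

/-- The projection of `ℂᴺ` onto the coordinates listed by `I`. -/
def coordProj {N n : ℕ} (I : Fin n → Fin N) : (Fin N → ℂ) →L[ℂ] (Fin n → ℂ) :=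
  ContinuousLinearMap.pi fun i => ContinuousLinearMap.proj (I i)

@[simp] lemma coordProj_apply {N n : ℕ} (I : Fin n → Fin N) (x : Fin N → ℂ) (i : Fin n) :
    coordProj I x i = x (I i) := rfl

/-- An injective linear map into `ℂᴺ` is bijective onto suitable coordinates. -/
lemma exists_coordProj_comp_eq {N n : ℕ} (L : (Fin n → ℂ) →L[ℂ] (Fin N → ℂ))
    (hL : Function.Injective L) : ∃ I : Fin n → Fin N, Function.Injective I ∧
      ∃ E : (Fin n → ℂ) ≃L[ℂ] (Fin n → ℂ), (coordProj I).comp L = E := by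
  set A : Matrix (Fin N) (Fin n) ℂ := LinearMap.toMatrix' (L : (Fin n → ℂ) →ₗ[ℂ] (Fin N → ℂ))
    with hA
  have hAL : ∀ v, A.mulVec v = L v := fun v => LinearMap.toMatrix'_mulVec _ v
  -- A maximal independent set of rows has n members, because the rank is n; they form an invertible
  -- square matrix.
  obtain ⟨κ, a, ha, hspan, hli⟩ := exists_linearIndependent' ℂ A.row
  have : Finite κ := Finite.of_injective a ha
  have := Fintype.ofFinite κ
  have hrank : A.rank = n := by
    rw [Matrix.rank]
    rw [LinearMap.finrank_range_of_inj]
    · simp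
    · intro v w hvw
      refine hL ?_
      rw [← hAL, ← hAL]
      exact hvw
  have hcard : Fintype.card κ = n := by
    rw [← finrank_span_eq_card hli, hspan, ← A.rank_eq_finrank_span_row, hrank]
  let σ : Fin n ≃ κ := (Fintype.equivFinOfCardEq hcard).symm
  refine ⟨a ∘ σ, ha.comp σ.injective, ?_⟩
  have hli' : LinearIndependent ℂ ((A.row ∘ a) ∘ σ) := hli.comp _ σ.injective
  have hu : IsUnit (A.submatrix (a ∘ σ) id) := Matrix.linearIndependent_rows_iff_isUnit.1 hli'
  have hinj : Function.Injective ((coordProj (a ∘ σ)).comp L) := by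
    intro v w hvw
    refine Matrix.mulVec_injective_iff_isUnit.2 hu ?_
    ext i
    have h1 := congrFun hvw i
    rw [ContinuousLinearMap.comp_apply, ContinuousLinearMap.comp_apply, coordProj_apply,
      coordProj_apply, ← hAL, ← hAL] at h1
    exact h1
  exact ⟨(LinearEquiv.ofInjectiveEndo (((coordProj (a ∘ σ)).comp L :
    (Fin n → ℂ) →L[ℂ] (Fin n → ℂ)) : (Fin n → ℂ) →ₗ[ℂ] (Fin n → ℂ)) hinj).toContinuousLinearEquiv,
    by ext1 v; rfl⟩

/-- Around each point, a submanifold is parametrized by some of the coordinates. -/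
theorem IsChartWith.exists_coordProj {N n : ℕ} {M U : Set (Fin N → ℂ)} {Ω : Set (Fin n → ℂ)}
    {φ : (Fin n → ℂ) → (Fin N → ℂ)} {ρ : (Fin N → ℂ) → (Fin n → ℂ)}
    (h : IsChartWith n M Ω φ U ρ) {c : Fin n → ℂ} (hc : c ∈ Ω) :
    ∃ (I : Fin n → Fin N) (Ω' : Set (Fin n → ℂ)) (φ' : (Fin n → ℂ) → (Fin N → ℂ))
      (U' : Set (Fin N → ℂ)), Function.Injective I ∧ IsChartWith n M Ω' φ' U' (coordProj I) ∧
        φ c ∈ φ' '' Ω' ∧ IsPreconnected Ω' := by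
  obtain ⟨I, hI, E, hE⟩ := exists_coordProj_comp_eq (fderiv ℂ φ c) (h.fderiv_injective hc)
  set q : (Fin n → ℂ) → (Fin n → ℂ) := fun z => coordProj I (φ z) with hq
  have hqan : AnalyticOnNhd ℂ q Ω := fun z hz =>
    ((coordProj I).analyticAt _).comp (h.analytic z hz)
  have hqd : ∀ z ∈ Ω, fderiv ℂ q z = (coordProj I).comp (fderiv ℂ φ z) := fun z hz =>
    ((coordProj I).hasFDerivAt.comp z (h.analytic z hz).differentiableAt.hasFDerivAt).fderiv
  have hst : HasStrictFDerivAt q (E : (Fin n → ℂ) →L[ℂ] (Fin n → ℂ)) c := by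
    rw [← hE, ← hqd c hc]
    exact (hqan c hc).hasStrictFDerivAt
  -- The inverse function theorem for π_I ∘ φ; composing φ with its inverse parametrizes M by the
  -- coordinates listed in I.
  set e := hst.toOpenPartialHomeomorph q with he
  have hce : c ∈ e.source := hst.mem_toOpenPartialHomeomorph_source
  have heq : ∀ z, e z = q z := fun z => rfl
  have hqc : q c ∈ e.target := e.map_source hce
  have hsymm : e.symm (q c) = c := e.left_inv hce
  have han : AnalyticAt ℂ e.symm (q c) :=
    e.analyticAt_symm' (i := E) hce (hqan c hc) (by rw [← hE, ← hqd c hc]; rfl)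
  obtain ⟨ε, hε, hball⟩ := Metric.mem_nhds_iff.1 ((han.eventually_analyticAt).and
    ((show ∀ᶠ y in 𝓝 (q c), y ∈ e.target from e.open_target.mem_nhds hqc).and ((e.symm.continuousAt hqc).preimage_mem_nhds
      (h.isOpen.mem_nhds (hsymm.symm ▸ hc)))))
  have hballT : ∀ y ∈ ball (q c) ε, AnalyticAt ℂ e.symm y ∧ y ∈ e.target ∧ e.symm y ∈ Ω :=
    fun y hy => hball hy
  -- Intersecting with ρ⁻¹(`e.source`) excludes other points of M that have the same I-coordinates;
  -- a ball as domain is connected.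
  refine ⟨I, ball (q c) ε, fun y => φ (e.symm y),
    (U ∩ ρ ⁻¹' e.source) ∩ coordProj I ⁻¹' ball (q c) ε, hI, ?_, ?_,
    (convex_ball _ _).isPreconnected⟩
  · constructor
    · exact isOpen_ball
    · exact fun y hy => (h.analytic _ (hballT y hy).2.2).comp (hballT y hy).1
    · exact (h.analytic_inv.continuousOn.isOpen_inter_preimage h.isOpen_target e.open_source).inter
        (isOpen_ball.preimage (coordProj I).continuous)
    · ext x
      constructor
      · rintro ⟨y, hy, rfl⟩
        obtain ⟨-, h2, h3⟩ := hballT y hy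
        refine ⟨(h.mem h3).1, ⟨(h.mem h3).2, ?_⟩, ?_⟩
        · rw [mem_preimage, h.left_inv _ h3]
          exact e.map_target h2
        · change q (e.symm y) ∈ ball (q c) ε
          have h4 : q (e.symm y) = y := e.right_inv h2
          rw [h4]
          exact hy
      · rintro ⟨hxM, ⟨hxU, hxs⟩, hxb⟩
        obtain ⟨h1, h2⟩ := h.inv_mem ⟨hxM, hxU⟩
        refine ⟨coordProj I x, hxb, ?_⟩
        have h3 : coordProj I x = e (ρ x) := by
          rw [heq]
          change _ = coordProj I (φ (ρ x))
          rw [h2]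
        change φ (e.symm (coordProj I x)) = x
        rw [h3, e.left_inv hxs, h2]
    · exact fun x _ => (coordProj I).analyticAt x
    · intro y hy
      exact e.right_inv (hballT y hy).2.1
  · exact ⟨q c, mem_ball_self hε, congrArg φ hsymm⟩

/-! ### Existence of the Bergman kernel form -/

/-- The Lindelöf property of ℂᴺ extracts a countable family of chart neighbourhoods that covers M.
-/
theorem nonempty_countableAtlas {N n : ℕ} {M : Set (Fin N → ℂ)}
    (hM : ∀ p ∈ M, ∃ Ω φ U ρ, IsChartWith n M Ω φ U ρ ∧ p ∈ φ '' Ω) :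
    Nonempty (CountableAtlas n M) := by
  choose Ω φ U ρ h hp using fun p : M => hM p p.2
  obtain ⟨T, hT, hTU⟩ := TopologicalSpace.isOpen_iUnion_countable U fun p => (h p).isOpen_target
  have hcov : ∀ p ∈ M, ∃ q ∈ T, p ∈ φ q '' Ω q := by
    intro p hpM
    have h1 : p ∈ ⋃ q, U q :=
      mem_iUnion.2 ⟨⟨p, hpM⟩, ((h _).image_eq.subset (hp ⟨p, hpM⟩)).2⟩
    rw [← hTU] at h1
    obtain ⟨q, hq, hpq⟩ := mem_iUnion₂.1 h1
    exact ⟨q, hq, (h q).image_eq.symm.subset ⟨hpM, hpq⟩⟩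
  rcases T.eq_empty_or_nonempty with rfl | hne
  · have hM0 : M = ∅ := eq_empty_of_forall_notMem fun p hpM => by simpa using hcov p hpM
    exact ⟨⟨fun _ => ∅, fun _ _ => 0, fun _ => ⟨isOpen_empty, analyticOnNhd_const, ∅, isOpen_empty,
      by simp, fun _ => 0, analyticOnNhd_const, by simp⟩, by simp [hM0]⟩⟩
  · obtain ⟨g, rfl⟩ := hT.exists_eq_range hne
    refine ⟨⟨fun k => Ω (g k), fun k => φ (g k), fun k => (h (g k)).isChart, ?_⟩⟩
    refine Subset.antisymm (fun p hpM => ?_) (iUnion_subset fun k => ?_)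
    · obtain ⟨_, ⟨k, rfl⟩, hk⟩ := hcov p hpM
      exact mem_iUnion.2 ⟨k, hk⟩
    · rw [(h (g k)).image_eq]
      exact inter_subset_left

namespace IsBallQuotient

variable {n N m : ℕ} {Γ : Subgroup (Matrix.unitaryGroup (Fin n) ℂ)}
  {F : (Fin n → ℂ) → (Fin N → ℂ)} {B : Set (Fin n → ℂ)} {M M₂ : Set (Fin N → ℂ)}
  {Ω : Set (Fin n → ℂ)} {φ : (Fin n → ℂ) → (Fin N → ℂ)} {U : Set (Fin N → ℂ)}
  {ρ : (Fin N → ℂ) → (Fin n → ℂ)} {𝒜 : CountableAtlas n M} {ι : Type} {e : ι → NForm N n}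

/-- The coefficient of the Bergman kernel form in a chart. -/
def kernelCoeff (e : ι → NForm N n) (φ : (Fin n → ℂ) → (Fin N → ℂ)) (z : Fin n → ℂ) : ℝ :=
  ∑' k, ‖coeff (e k) φ z‖ ^ 2

theorem hasSum_kernelCoeff (hQ : IsBallQuotient m Γ F B M M₂) (he : IsBergmanBasis 𝒜 e)
    (h : IsChartWith n M Ω φ U ρ) {z : Fin n → ℂ} (hz : z ∈ Ω) :
    HasSum (fun k => ‖coeff (e k) φ z‖ ^ 2) (kernelCoeff e φ z) :=
  (summable_norm_sq_of_sum_le (fun _ hc => hQ.exists_sum_le he h hc) hz).hasSum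

/-- The right-hand side, a function of ρ x times a constant form pulled back by the derivative of ρ,
makes sense for x off M and for arbitrary vectors, so it serves as the extension to the ambient
space. -/
theorem hasSum_wedgeConj (hQ : IsBallQuotient m Γ F B M M₂) (he : IsBergmanBasis 𝒜 e)
    (h : IsChartWith n M Ω φ U ρ) {x : Fin N → ℂ} (hx : x ∈ M ∩ U)
    {v : Fin n ⊕ Fin n → Fin N → ℂ} (hv : ∀ j, v j ∈ tangentVectors M x) :
    HasSum (fun k => wedgeConj (e k x) v)
      ((kernelCoeff e φ (ρ x) : ℂ) * wedgeConj (stdForm n) fun j => fderiv ℂ ρ x (v j)) := by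
  obtain ⟨hz, hφ⟩ := h.inv_mem hx
  set z := ρ x
  rw [← hφ, h.tangentVectors_eq hz] at hv
  choose u hu using hv
  obtain rfl : (fun j => fderiv ℂ φ z (u j)) = v := funext hu
  have h1 : (fun j => fderiv ℂ ρ x (fderiv ℂ φ z (u j))) = u := by
    ext1 j
    rw [← hφ, ← ContinuousLinearMap.comp_apply, h.fderiv_inv_comp hz]
    rfl
  rw [h1]
  have h2 := (Complex.hasSum_ofReal.2 (hQ.hasSum_kernelCoeff he h hz)).mul_right
    (wedgeConj (stdForm n) u)
  have h3 : ∀ k, ((‖coeff (e k) φ z‖ ^ 2 : ℝ) : ℂ) * wedgeConj (stdForm n) u =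
      wedgeConj (e k x) (fun j => fderiv ℂ φ z (u j)) := fun k => by
    rw [← hφ, wedgeConj_fderiv]
  simp only [h3] at h2
  exact h2

/-- The form `k(π(x)) · π^*(i^{n²} dz ∧ dz̄)`. -/
def pullbackForm (k : ℝ) (π : (Fin N → ℂ) →L[ℂ] (Fin n → ℂ)) : RealForm N n :=
  k • (wedgeConj (stdForm n)).compLinearMap ((π : (Fin N → ℂ) →ₗ[ℂ] (Fin n → ℂ)).restrictScalars ℝ)

theorem pullbackForm_apply (k : ℝ) (π : (Fin N → ℂ) →L[ℂ] (Fin n → ℂ))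
    (v : Fin n ⊕ Fin n → Fin N → ℂ) :
    pullbackForm k π v = k * wedgeConj (stdForm n) fun j => π (v j) := by
  rw [← Complex.real_smul]
  rfl

theorem exists_isBergmanKernelForm (hQ : IsBallQuotient m Γ F B M M₂) :
    ∃ K, IsBergmanKernelForm n M K := by
  obtain ⟨𝒜⟩ := nonempty_countableAtlas hQ.exists_chart
  obtain ⟨ι, e, he⟩ := hQ.exists_bergmanBasis 𝒜
  have hK : ∀ x, ∃ T : RealForm N n, x ∈ M → ∀ v : Fin n ⊕ Fin n → (Fin N → ℂ),
      (∀ j, v j ∈ tangentVectors M x) → HasSum (fun k => wedgeConj (e k x) v) (T v) := by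
    intro x
    by_cases hx : x ∈ M
    · obtain ⟨Ω, φ, U, ρ, h, hxΩ⟩ := hQ.exists_chart x hx
      refine ⟨pullbackForm (kernelCoeff e φ (ρ x)) (fderiv ℂ ρ x), fun _ v hv => ?_⟩
      rw [pullbackForm_apply]
      exact hQ.hasSum_wedgeConj he h (h.image_eq.subset hxΩ) hv
    · exact ⟨0, fun h => (hx h).elim⟩
  choose K hK using hK
  exact ⟨K, 𝒜, ι, e, he, hK⟩

end IsBallQuotient

/-! ### Algebraicity of the kernel -/

namespace IsAlgFun

variable {n : ℕ} {D : Set (Fin n → ℂ)} {f : (Fin n → ℂ) → ℂ} [hD : Fact (IsOpen D ∧ IsConnected D)]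

theorem inv (hf : IsAlgFun D f) (h0 : ∀ z ∈ D, f z ≠ 0) : IsAlgFun D (fun z => (f z)⁻¹) := by
  obtain ⟨z, hz⟩ := hD.out.2.nonempty
  refine hf.of_mul ⟨z, hz, h0 z hz⟩ (hf.1.inv h0) ((const 1).congr hD.out.1 fun w hw => ?_)
  exact (mul_inv_cancel₀ (h0 w hw)).symm

/-- The Jacobian determinant of a map with algebraic components is algebraic. -/
theorem jac {q : (Fin n → ℂ) → (Fin n → ℂ)} (hq : AnalyticOnNhd ℂ q D)
    (hqa : ∀ i, IsAlgFun D fun z => q z i) : IsAlgFun D (jac q) := by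
  refine IsAlgFun.congr hD.out.1 (f := fun z => ∑ σ : Equiv.Perm (Fin n),
    ((Equiv.Perm.sign σ : ℤ) : ℂ) * ∏ i, _root_.fderiv ℝ (fun z => q z (σ i)) z (Pi.single i 1))
    (sum _ fun σ _ => (const _).mul (prod _ fun i _ => (hqa (σ i)).fderiv _)) fun z hz => ?_
  rw [jac_eq]
  refine Finset.sum_congr rfl fun σ _ => ?_
  congr 1
  refine Finset.prod_congr rfl fun i _ => ?_
  have h1 : DifferentiableAt ℂ q z := (hq z hz).differentiableAt
  have h2 : DifferentiableAt ℂ (fun z => q z (σ i)) z := differentiableAt_pi.1 h1 _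
  have h3 : _root_.fderiv ℂ (fun z => q z (σ i)) z =
      (ContinuousLinearMap.proj (σ i)).comp (_root_.fderiv ℂ q z) :=
    ((ContinuousLinearMap.proj (R := ℂ) (φ := fun _ => ℂ) (σ i)).hasFDerivAt.comp z
      h1.hasFDerivAt).fderiv
  rw [h2.fderiv_restrictScalars ℝ, h3]
  rfl

end IsAlgFun

namespace IsBallQuotient

variable {n N m : ℕ} {Γ : Subgroup (Matrix.unitaryGroup (Fin n) ℂ)}
  {F : (Fin n → ℂ) → (Fin N → ℂ)} {B : Set (Fin n → ℂ)} {M M₂ : Set (Fin N → ℂ)}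
  {Ω : Set (Fin n → ℂ)} {φ : (Fin n → ℂ) → (Fin N → ℂ)} {U : Set (Fin N → ℂ)}
  {𝒜 : CountableAtlas n M} {ι : Type} {e : ι → NForm N n} {I : Fin n → Fin N}

/-- On the diagonal the kernel is a rational expression in z and z̄ whose denominators 1 - ⟨γz, z⟩
do not vanish. -/
theorem isAlgFun_invKernel (hQ : IsBallQuotient m Γ F B M M₂) [Fintype Γ] {D : Set (Fin n → ℂ)}
    [hD : Fact (IsOpen D ∧ IsConnected D)] (hDB : D ⊆ B) :
    IsAlgFun D fun z => invKernel m Γ z z := by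
  unfold invKernel ballKernel
  refine (IsAlgFun.const _).mul (IsAlgFun.sum _ fun γ _ => (IsAlgFun.const _).mul
    ((IsAlgFun.const _).mul ?_))
  simp only [one_div]
  refine IsAlgFun.inv ?_ fun z hz => pow_ne_zero _ (one_sub_herm_ne_zero
    (hQ.subset_ball (hQ.act_mem γ.1 γ.2 z (hDB hz)).1) (hQ.subset_ball (hDB hz)))
  simp only [sub_eq_add_neg]
  refine ((IsAlgFun.const 1).add (IsAlgFun.neg ?_)).pow _
  exact IsAlgFun.sum _ fun i _ => (IsAlgFun.sum _ fun j _ =>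
    (IsAlgFun.const _).mul (IsAlgFun.coord j)).mul (IsAlgFun.coord i).conj

theorem analyticOnNhd_kernelCoeff [Countable ι] (hQ : IsBallQuotient m Γ F B M M₂)
    (he : IsBergmanBasis 𝒜 e) {ρ : (Fin N → ℂ) → (Fin n → ℂ)} (h : IsChartWith n M Ω φ U ρ) :
    AnalyticOnNhd ℝ (kernelCoeff e φ) Ω :=
  analyticOnNhd_tsum_norm_sq h.isOpen (fun k => (he.1 k).1 Ω φ h.isChart)
    fun _ hc => hQ.exists_sum_le he h hc

/-- The transformation rule of the kernel under the covering map. -/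
theorem kernelCoeff_mul_norm_jac_sq [Fintype Γ] (hQ : IsBallQuotient m Γ F B M M₂)
    (he : IsBergmanBasis 𝒜 e) {ρ : (Fin N → ℂ) → (Fin n → ℂ)} (h : IsChartWith n M Ω φ U ρ)
    {z : Fin n → ℂ} (hz : z ∈ B ∩ F ⁻¹' U) :
    ((‖jac (fun z => ρ (F z)) z‖ ^ 2 : ℝ) : ℂ) * (kernelCoeff e φ (ρ (F z)) : ℂ) =
      (m / 2 ^ n) * invKernel m Γ z z := by
  refine HasSum.unique ?_ (hQ.hasSum_coeff he hz.1)
  rw [← Complex.ofReal_mul, Complex.hasSum_ofReal]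
  have h1 := (hQ.hasSum_kernelCoeff he h (hQ.chart_mem h hz).1).mul_left
    (‖jac (fun z => ρ (F z)) z‖ ^ 2)
  have h2 : ∀ k, ‖jac (fun z => ρ (F z)) z‖ ^ 2 * ‖coeff (e k) φ (ρ (F z))‖ ^ 2 =
      ‖coeff (e k) F z‖ ^ 2 := fun k => by
    rw [hQ.coeff_eq h (e k) hz, norm_mul, mul_pow, mul_comm]
  simp only [h2] at h1
  exact h1

/-- In this chart ρ ∘ F consists of components of F, so its Jacobian is algebraic and can be
cancelled in the transformation rule. Cancellation needs the analyticity of the kernel coefficient,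
which comes from the sum of squares. -/
theorem isAlgFun_kernelCoeff [Countable ι] [Fintype Γ] (hQ : IsBallQuotient m Γ F B M M₂)
    (he : IsBergmanBasis 𝒜 e) (h : IsChartWith n M Ω φ U (coordProj I))
    (hFalg : IsComplexAlgebraicMapOn F B) {D : Set (Fin n → ℂ)}
    [hD : Fact (IsOpen D ∧ IsConnected D)] (hDB : D ⊆ B ∩ F ⁻¹' U) :
    IsAlgFun D fun z => (kernelCoeff e φ (coordProj I (F z)) : ℂ) := by
  have hq := (hQ.analytic_chart h).mono hDB
  have hj := IsAlgFun.jac hq fun i => IsAlgFun.of_isComplexAlgebraicOn (hFalg (I i))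
    fun z hz => (hDB hz).1
  have hj2 : IsAlgFun D fun z => ((‖jac (fun z => coordProj I (F z)) z‖ ^ 2 : ℝ) : ℂ) :=
    (hj.mul hj.conj).congr hD.out.1 fun z _ => by
      simp only [Complex.mul_conj', Complex.ofReal_pow]
  obtain ⟨z₀, hz₀⟩ := hD.out.2.nonempty
  refine hj2.of_mul ⟨z₀, hz₀, ?_⟩ ?_ ?_
  · have := hQ.jac_ne_zero h (hDB hz₀)
    rw [Complex.ofReal_ne_zero]
    exact pow_ne_zero 2 (norm_ne_zero_iff.2 this)
  · have h1 : AnalyticOnNhd ℝ (fun z => kernelCoeff e φ (coordProj I (F z))) D :=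
      (hQ.analyticOnNhd_kernelCoeff he h).comp (hq.restrictScalars (𝕜 := ℝ))
        fun z hz => (hQ.chart_mem h (hDB hz)).1
    exact fun z hz => (Complex.ofRealCLM.analyticAt _).comp (h1 z hz)
  · exact ((IsAlgFun.const _).mul (hQ.isAlgFun_invKernel fun z hz => (hDB hz).1)).congr hD.out.1
      fun z hz => (hQ.kernelCoeff_mul_norm_jac_sq he h (hDB hz)).symm

lemma analyticOnNhd_realCoord_option {k : (Fin n → ℂ) → ℝ} (hk : AnalyticOnNhd ℝ k Ω)
    (P : MvPolynomial (Option (Fin n ⊕ Fin n)) ℝ) :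
    AnalyticOnNhd ℝ (fun y => MvPolynomial.eval
      (fun o : Option (Fin n ⊕ Fin n) => o.elim (k y) (realCoord y)) P) Ω := by
  refine AnalyticOnNhd.aeval_mvPolynomial
    (f := fun y (o : Option (Fin n ⊕ Fin n)) => o.elim (k y) (realCoord y)) (fun o => ?_) P
  rcases o with _ | (i | i)
  · exact hk
  · exact fun y _ => (Complex.reCLM.comp
      (ContinuousLinearMap.proj (R := ℝ) (φ := fun _ => ℂ) i)).analyticAt y
  · exact fun y _ => (Complex.imCLM.comp
      (ContinuousLinearMap.proj (R := ℝ) (φ := fun _ => ℂ) i)).analyticAt y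

/-- The Bergman kernel is algebraic as a function of suitable coordinates. -/
theorem exists_mvPolynomial_kernelCoeff [Countable ι] [Fintype Γ]
    (hQ : IsBallQuotient m Γ F B M M₂) (he : IsBergmanBasis 𝒜 e)
    (h : IsChartWith n M Ω φ U (coordProj I)) (hΩ : IsPreconnected Ω) (hne : Ω.Nonempty)
    (hFalg : IsComplexAlgebraicMapOn F B) (r : ℝ) :
    ∃ P : MvPolynomial (Option (Fin n ⊕ Fin n)) ℝ, P ≠ 0 ∧ ∀ y ∈ Ω, MvPolynomial.eval
      (fun o : Option (Fin n ⊕ Fin n) => o.elim (kernelCoeff e φ y * r) (realCoord y)) P = 0 := by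
  obtain ⟨c, hc⟩ := hne
  -- The center c may lie over V₂; a nearby w lies over M₂ and so has a preimage z₀ under the
  -- covering.
  obtain ⟨w, hw₂, hwΩ⟩ := (((hQ.thin_preimage Ω φ h.isChart).frequently_notMem
    hc).and_eventually (h.isOpen.mem_nhds hc)).exists
  have hw : φ w ∈ M₂ := by_contra fun hcon => hw₂ ⟨hwΩ, hcon⟩
  obtain ⟨z₀, hz₀B, hz₀⟩ := hQ.exists_preimage hw
  have hz₀U : z₀ ∈ B ∩ F ⁻¹' U := ⟨hz₀B, by rw [mem_preimage, hz₀]; exact (h.mem hwΩ).2⟩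
  obtain ⟨ε, hε, hball⟩ :=
    Metric.isOpen_iff.1 (hQ.isOpen_preimage h.isOpen_target) z₀ hz₀U
  have : Fact (IsOpen (ball z₀ ε) ∧ IsConnected (ball z₀ ε)) :=
    ⟨isOpen_ball, ⟨z₀, mem_ball_self hε⟩, (convex_ball z₀ ε).isPreconnected⟩
  have hka := hQ.isAlgFun_kernelCoeff he h hFalg hball
  have hqa : ∀ i, IsAlgFun (ball z₀ ε) fun z => coordProj I (F z) i := fun i =>
    IsAlgFun.of_isComplexAlgebraicOn (hFalg (I i)) fun z hz => (hball hz).1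
  -- These are 2n + 1 functions: the real coordinates of π ∘ F and the kernel coefficient, with real
  -- parts and imaginary parts expressed through conjugates.
  obtain ⟨P, hP, hP0⟩ := exists_mvPolynomial_of_isAlgFun (D := ball z₀ ε)
    (ι := Option (Fin n ⊕ Fin n))
    (by simp only [Fintype.card_option, Fintype.card_sum, Fintype.card_fin]; omega)
    (y := fun o z => o.elim (kernelCoeff e φ (coordProj I (F z)) * r)
      (realCoord (coordProj I (F z)))) (by
      rintro (_ | (i | i))
      · exact (hka.mul (IsAlgFun.const r)).congr isOpen_ball fun z _ => by simp
      · refine (((hqa i).add (hqa i).conj).mul (IsAlgFun.const 2⁻¹)).congr isOpen_ball fun z _ => ?_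
        simp only [Complex.add_conj, Option.elim_some, realCoord, Sum.elim_inl]
        push_cast
        ring
      · refine (((hqa i).add (hqa i).conj.neg).mul (IsAlgFun.const (2 * Complex.I)⁻¹)).congr isOpen_ball
          fun z _ => ?_
        simp only [← sub_eq_add_neg, Complex.sub_conj, Option.elim_some, realCoord, Sum.elim_inr]
        push_cast
        field_simp)
  refine ⟨P, hP, ?_⟩
  have hk : AnalyticOnNhd ℝ (fun y => kernelCoeff e φ y * r) Ω :=
    (hQ.analyticOnNhd_kernelCoeff he h).mul analyticOnNhd_const
  have hq := hQ.analytic_chart h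
  refine (analyticOnNhd_realCoord_option hk P).eqOn_zero_of_preconnected_of_eventuallyEq_zero hΩ
    (hQ.chart_mem h hz₀U).1 ?_
  -- The Jacobian at z₀ is invertible, so π ∘ F maps neighbourhoods of z₀ onto neighbourhoods of its
  -- image and the relation holds near that image.
  set E := (LinearMap.equivOfDetNeZero _ (hQ.jac_ne_zero h hz₀U)).toContinuousLinearEquiv with hE
  have hst : HasStrictFDerivAt (fun z => coordProj I (F z))
      (E : (Fin n → ℂ) →L[ℂ] (Fin n → ℂ)) z₀ := by
    have h1 : (E : (Fin n → ℂ) →L[ℂ] (Fin n → ℂ)) = fderiv ℂ (fun z => coordProj I (F z)) z₀ := by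
      ext1 v
      rfl
    rw [h1]
    exact (hq z₀ hz₀U).hasStrictFDerivAt
  rw [EventuallyEq, ← hst.map_nhds_eq_of_equiv, eventually_map]
  filter_upwards [isOpen_ball.mem_nhds (mem_ball_self hε)] with z hz
  exact hP0 z hz

/-- The relation found in the chart is reused in ℂᴺ in the variables listed by I; renaming along the
injective I keeps the polynomial nonzero. -/
theorem isRealAlgebraicOn_kernelCoeff [Countable ι] [Fintype Γ]
    (hQ : IsBallQuotient m Γ F B M M₂) (he : IsBergmanBasis 𝒜 e)
    (h : IsChartWith n M Ω φ U (coordProj I)) (hI : Function.Injective I)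
    (hΩ : IsPreconnected Ω) (hne : Ω.Nonempty) (hFalg : IsComplexAlgebraicMapOn F B) (r : ℝ) :
    IsRealAlgebraicOn (fun x => kernelCoeff e φ (coordProj I x) * r) (coordProj I ⁻¹' Ω) := by
  refine ⟨?_, ?_⟩
  · exact ((hQ.analyticOnNhd_kernelCoeff he h).comp
      (fun x _ => ((coordProj I).restrictScalars ℝ).analyticAt x) fun x hx => hx).mul
        analyticOnNhd_const
  · obtain ⟨P, hP, hP0⟩ := hQ.exists_mvPolynomial_kernelCoeff he h hΩ hne hFalg r
    have hinj : Function.Injective (Option.map (Sum.map I I)) :=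
      Option.map_injective (hI.sumMap hI)
    refine ⟨MvPolynomial.rename (Option.map (Sum.map I I)) P,
      fun h0 => hP (MvPolynomial.rename_injective _ hinj (by rw [h0, map_zero])), fun x hx => ?_⟩
    rw [MvPolynomial.eval_rename, ← hP0 _ hx]
    congr 2
    ext1 o
    rcases o with _ | (i | i) <;> rfl

theorem isRealAlgebraicFormOn (hQ : IsBallQuotient m Γ F B M M₂)
    (hFalg : IsComplexAlgebraicMapOn F B) {K : (Fin N → ℂ) → RealForm N n}
    (hK : IsBergmanKernelForm n M K) : IsRealAlgebraicFormOn M K := by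
  obtain ⟨𝒜, ι, e, he, hsum⟩ := hK
  have := hQ.finite
  have := Fintype.ofFinite Γ
  intro p hp
  obtain ⟨Ω₀, φ₀, U₀, ρ₀, h₀, c, hc, rfl⟩ := hQ.exists_chart p hp
  obtain ⟨I, Ω, φ, U, hI, h, hpΩ, hΩ⟩ := h₀.exists_coordProj hc
  obtain ⟨b, hb, hbc⟩ := hpΩ
  have hpU : coordProj I (φ₀ c) ∈ Ω := by rw [← hbc, h.left_inv b hb]; exact hb
  refine ⟨U ∩ coordProj I ⁻¹' Ω,
    fun x => pullbackForm (kernelCoeff e φ (coordProj I x)) (coordProj I),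
    h.isOpen_target.inter (h.isOpen.preimage (coordProj I).continuous),
    ⟨hbc ▸ (h.mem hb).2, hpU⟩, fun s => ?_, ?_⟩
  -- On basis vectors the form is the kernel coefficient times a complex constant; r stands for the
  -- real and the imaginary part of that constant.
  · have key : ∀ r, IsRealAlgebraicOn (fun x => kernelCoeff e φ (coordProj I x) * r)
        (U ∩ coordProj I ⁻¹' Ω) := fun r => by
      obtain ⟨h1, P, hP, hP0⟩ :=
        hQ.isRealAlgebraicOn_kernelCoeff he h hI hΩ ⟨b, hb⟩ hFalg r
      exact ⟨h1.mono inter_subset_right, P, hP, fun x hx => hP0 x hx.2⟩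
    simp only [pullbackForm_apply, Complex.re_ofReal_mul, Complex.im_ofReal_mul]
    exact ⟨key _, key _⟩
  · rintro x ⟨⟨hxU, hxΩ⟩, hxM⟩ v hv
    have h1 := hQ.hasSum_wedgeConj he h ⟨hxM, hxU⟩ hv
    rw [ContinuousLinearMap.fderiv] at h1
    rw [pullbackForm_apply]
    exact h1.unique (hsum x hxM v hv)

theorem hasAlgebraicBergmanKernel {G : Set (Fin N → ℂ)}
    (hQ : IsBallQuotient m Γ F B (regularPart G) M₂) (hFalg : IsComplexAlgebraicMapOn F B) :
    HasAlgebraicBergmanKernel n G :=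
  ⟨hQ.exists_isBergmanKernelForm, fun _ => hQ.isRealAlgebraicFormOn hFalg⟩

end IsBallQuotient

end AlgBergman
end

theorem mainTheorem7 {n N m : ℕ} (V G : Set (Fin N → ℂ))
    (hV : AlgBergman.IsAlgebraicVariety V) (hG : AlgBergman.IsDomainIn G V)
    (Γ : Subgroup (Matrix.unitaryGroup (Fin n) ℂ)) (hfin : Finite Γ) (hm : Nat.card Γ = m)
    (V₁ : Set (Fin n → ℂ)) (hV₁ : AlgBergman.IsAnalyticSubvariety V₁ (AlgBergman.unitBall n))
    (hV₁_proper : V₁ ≠ AlgBergman.unitBall n)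
    (V₂ : Set (Fin N → ℂ)) (hV₂ : AlgBergman.IsAnalyticSubvariety V₂ G)
    (hV₂_proper : G ⊆ closure (G \ V₂))
    (F : (Fin n → ℂ) → (Fin N → ℂ))
    (hF : AlgBergman.IsHolomorphicCovering m F (AlgBergman.unitBall n \ V₁) (G \ V₂))
    (hdeck : AlgBergman.HasDeckGroup F (AlgBergman.unitBall n \ V₁) Γ)
    (hFalg : AlgBergman.IsComplexAlgebraicMapOn F (AlgBergman.unitBall n \ V₁)) :
    AlgBergman.HasAlgebraicBergmanKernel n G :=
  (AlgBergman.isBallQuotient_of_covering hfin hm hV₁ hV₁_proper hV₂ hV₂_proper hF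
    hdeck).hasAlgebraicBergmanKernel hFalg
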